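/- Let $\kappa>0$, $h\in(0,1]$, and let $$\Delta_h f(x)=\tfrac{1+h}{2}\bigl(f(x+1)-f(x)\bigr)+\tfrac{1-h}{2}\bigl(f(x-1)-f(x)\bigr),\qquad x\in\mathbb Z .$$ Let $\xi=(\xi(x))_{x\in\mathbb Z}$ be a random field with values in $(-\infty,0]$ which is non-constant (there is no constant $c$ with $\xi(x)=c$ for all $x$ almost surely) and satisfies $\operatorname{ess\,sup}\xi(0)=0$. Let $u$ be the bounded non-negative solution of $$\partial_t u(t,x)=\kappa\Delta_h u(t,x)+\xi(x)u(t,x),\quad t\ge 0,\ x\in\mathbb Z,\qquad u(0,\cdot)\equiv 1 .$$ Let $Y$ be the continuous-time random walk on $\mathbb Z$ with generator $\kappa\Delta_{-h}$, let $\mathbb E_1$ denote expectation for $Y$ started in $1$, and let $T_0$ be the first hitting time of $0$ by $Y$. With $\langle\cdot\rangle$ the expectation with respect to $\xi$, put $$L^{\pm}(\beta)=\Bigl\langle\Bigl(\log\mathbb E_1\exp\Bigl\{\int_0^{T_0}(\xi(Y_s)+\beta)\,ds\Bigr\}\Bigr)^{\pm}\Bigr\rangle\in[0,\infty],\qquad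 L(\beta)=L^+(\beta)-L^-(\beta)$$ whenever $L^+(\beta)$ or $L^-(\beta)$ is finite, and let $\beta_{cr}$ be the real number such that $L^+(\beta)=\infty$ for $\beta>\beta_{cr}$ and $L^+(\beta)<\infty$ for $\beta<\beta_{cr}$. Assume that either (i) the law of $\xi$ is invariant and ergodic under the shift of $\mathbb Z$ and there is $b<0$ such that almost surely $\xi(x)\in[b,0]$ for all $x$; or (ii) the $\xi(x)$, $x\in\mathbb Z$, are i.i.d. Then $\beta_{cr}$ exists, almost surely the solution $u$ exists and satisfies $u(t,0)>0$ for all $t\ge 0$, and there is a deterministic $\lambda_0\in\mathbb R$ such that almost surely $$\lim_{t\to\infty}\frac1t\log u(t,0)=\lambda_0 .$$ Moreover, if $\beta\mapsto L(-\beta)$ has a zero in $(-\beta_{cr},0)$, then it is unique there and equals $\lambda_0$; if there is no such zero, then $\lambda_0=-\beta_{cr}$. -/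

import Mathlib

open MeasureTheory ProbabilityTheory Filter Topology Set
open scoped ENNReal

noncomputable section

namespace PAM

/-! ### The Cauchy problem -/

/-- The discrete Laplace operator on `ℤ` with drift `h`. -/
def driftLaplacian (h : ℝ) (f : ℤ → ℝ) (x : ℤ) : ℝ :=
  (1 + h) / 2 * (f (x + 1) - f x) + (1 - h) / 2 * (f (x - 1) - f x)

/-- `u` (time first, then space; only times `t ≥ 0` matter) is a bounded non-negative solution of
`∂ₜ u = κ Δ_h u + ζ u` on `[0, ∞) × ℤ` with `u(0, ·) = 1`. The time derivative is one-sided at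
`t = 0`. -/
structure IsSolution (κ h : ℝ) (ζ : ℤ → ℝ) (u : ℝ → ℤ → ℝ) : Prop where
  initial : ∀ x, u 0 x = 1
  equation : ∀ t, 0 ≤ t → ∀ x,
    HasDerivWithinAt (fun s => u s x) (κ * driftLaplacian h (u t) x + ζ x * u t x) (Ici 0) t
  nonneg : ∀ t, 0 ≤ t → ∀ x, 0 ≤ u t x
  bounded : ∃ C : ℝ, ∀ t, 0 ≤ t → ∀ x, u t x ≤ C

/-! ### The random walk with generator `κ Δ_{-h}`

It is realised through its holding times, which are i.i.d. exponential of rate `κ`, and its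
steps, which are i.i.d. and independent of the holding times, equal to `+1` with probability
`(1 - h) / 2` and to `-1` with probability `(1 + h) / 2`. -/

/-- The law of one step of the walk. -/
def stepMeasure (h : ℝ) : Measure ℤ :=
  ENNReal.ofReal ((1 - h) / 2) • Measure.dirac 1 +
    ENNReal.ofReal ((1 + h) / 2) • Measure.dirac (-1)

/-- The sample space of the walk: `(w i).1` is the `i`-th holding time, `(w i).2` the step
made at its end. -/
abbrev WalkSpace : Type := ℕ → ℝ × ℤ

/-- The law of the holding times and steps. -/
def walkMeasure (κ h : ℝ) : Measure WalkSpace :=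
  Measure.infinitePi fun _ : ℕ => (expMeasure κ).prod (stepMeasure h)

/-- The number of jumps up to time `t` (inclusive): the `n`-th jump (counted from `0`) takes place
at the time `∑ i ≤ n, (w i).1`. -/
def jumpCount (w : WalkSpace) (t : ℝ) : ℕ :=
  {n : ℕ | ∑ i ∈ Finset.range (n + 1), (w i).1 ≤ t}.ncard

/-- The position `Y_t` of the walk started in `x`. -/
def walk (x : ℤ) (w : WalkSpace) (t : ℝ) : ℤ :=
  x + ∑ i ∈ Finset.range (jumpCount w t), (w i).2

/-- The first hitting time `T_n` of `n` by the walk started in `x` (`∞` if `n` is never hit). -/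
def hittingTime (x n : ℤ) (w : WalkSpace) : ℝ≥0∞ :=
  sInf (ENNReal.ofReal '' {t : ℝ | 0 ≤ t ∧ walk x w t = n})

/-- `E_1 exp {∫_0^{T_0} (ζ(Y_s) + β) ds}`, with values in `[0, ∞]`. -/
def hittingFunctional (κ h : ℝ) (ζ : ℤ → ℝ) (β : ℝ) : ℝ≥0∞ :=
  ∫⁻ w, ENNReal.ofReal (Real.exp
    (∫ s in {s : ℝ | 0 ≤ s ∧ ENNReal.ofReal s < hittingTime 1 0 w}, (ζ (walk 1 w s) + β)))
    ∂(walkMeasure κ h)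

/-! ### The functions `L⁺`, `L⁻`, `L` and the critical value

`P` is the law of the potential. -/

/-- `L⁺(β)`, with values in `[0, ∞]`. -/
def LPlus (κ h : ℝ) (P : Measure (ℤ → ℝ)) (β : ℝ) : ℝ≥0∞ :=
  ∫⁻ ζ, (ENNReal.log (hittingFunctional κ h ζ β)).toENNReal ∂P

/-- `L⁻(β)`, with values in `[0, ∞]`. -/
def LMinus (κ h : ℝ) (P : Measure (ℤ → ℝ)) (β : ℝ) : ℝ≥0∞ :=
  ∫⁻ ζ, (-ENNReal.log (hittingFunctional κ h ζ β)).toENNReal ∂P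

/-- `L(β) = L⁺(β) - L⁻(β)`, with values in `[-∞, ∞]`; meaningful if `L⁺(β)` or `L⁻(β)` is finite,
in particular for `β` below the critical value. -/
def L (κ h : ℝ) (P : Measure (ℤ → ℝ)) (β : ℝ) : EReal :=
  (LPlus κ h P β : EReal) - (LMinus κ h P β : EReal)

/-- `βcr` is the critical value: `L⁺` is infinite above and finite below it. -/
def IsCriticalValue (κ h : ℝ) (P : Measure (ℤ → ℝ)) (βcr : ℝ) : Prop :=
  (∀ β, βcr < β → LPlus κ h P β = ∞) ∧ ∀ β, β < βcr → LPlus κ h P β < ∞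

/-! ### Assumptions on the law of the potential -/

/-- The left shift on `ℤ → ℝ`. -/
def shift (ζ : ℤ → ℝ) : ℤ → ℝ := fun x => ζ (x + 1)

/-- `P` is shift-invariant and ergodic, and concentrated on `[b, 0]^ℤ` for some `b < 0`. -/
def IsErgodicBounded (P : Measure (ℤ → ℝ)) : Prop :=
  Ergodic shift P ∧ ∃ b : ℝ, b < 0 ∧ ∀ᵐ ζ ∂P, ∀ x, ζ x ∈ Icc b 0

/-- `P` is the law of an i.i.d. family, whose common law `η` lives on `(-∞, 0]`. -/
def IsIIDNonpos (P : Measure (ℤ → ℝ)) : Prop :=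
  ∃ η : Measure ℝ, IsProbabilityMeasure η ∧ (∀ᵐ y ∂η, y ∈ Iic (0 : ℝ)) ∧
    P = Measure.infinitePi fun _ : ℤ => η

end PAM

end

/-! Write `φ_β` for the hitting functional (`phi`), `psi` for its logarithm and `ell` for the mean
of `psi`; `ell` is the real-valued version of `L`. The solution `u(t,0)` is the total mass at time
`t` (`kernelMass`) of the walk with generator `κ Δ_h` started in `0` and killed at rate `-ξ`. In its
endpoint the kernel evolves by the adjoint generator `κ Δ_{-h}`, which is why the walk `Y` appears.
Since `Y` must cross every site between `n` and `0`, the weight of travelling from `n` to `0` is a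
product of shifted copies of `φ_β`. Extended to all of `ℤ`, this product is a positive solution of
`κ Δ_{-h} v + (ξ + β) v = 0`, and by the ergodic theorem it behaves like `exp (n ell β)`.

Upper bound: if `ell β < 0` (or `psi` has mean `-∞`), then `exp (-β t)` times this product dominates
the kernel by comparison, and it is summable over endpoints. Hence the mass is at most `C exp (-β
t)` (`IsAdmissible.ae_exists_kernelMass_le`).

Lower bound, above the critical value: `φ_β` is infinite at some site to the right, so the diagonal
resolvent diverges there. Some return probability then exceeds `exp (-γ t)`, and
supermultiplicativity carries this to all times (`IsAdmissible.ae_exists_exp_le_kernelMass`). Lower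
bound, between the zero of `ell` and the critical value: at a point `β` where `ell ≥ 0` has
derivative `m > 0`, the resolvent from `0` to `n` is at least of order `exp (n ell β)`. Comparison
with `β ± δ` shows that times near `m n` carry the Laplace integral, so the mass at such times is
not much below `exp (-β t)` (`IsAdmissible.ae_eventually_exp_le_kernelMass`). Since `ell` is
increasing, such `β` are dense.

The critical value is the threshold for almost sure finiteness of `φ_β`. The recursion `passage_eq`
upgrades finiteness at `β` to a deterministic bound at every smaller parameter
(`IsAdmissible.exists_bound`), so it is also the threshold for `L⁺`. If `ell` has no zero in `(0,
βcr)`, it is negative there, because it is continuous and negative at `0`, and the two bounds meet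
at `βcr`. -/

namespace PAM

/-! ### A one-sided pointwise ergodic theorem -/

/-- The running maximum of the Birkhoff sums, started from `0`. -/
noncomputable def birkhoffMax {α : Type*} (T : α → α) (g : α → ℝ) : ℕ → α → ℝ
  | 0, _ => 0
  | n + 1, x => max 0 (g x + birkhoffMax T g n (T x))

section Birkhoff

variable {α : Type*} {T : α → α} {g : α → ℝ}

theorem birkhoffMax_nonneg (n : ℕ) (x : α) : 0 ≤ birkhoffMax T g n x := by
  cases n <;> simp [birkhoffMax]

theorem birkhoffSum_le_birkhoffMax (n : ℕ) (x : α) :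
    birkhoffSum T g n x ≤ birkhoffMax T g n x := by
  induction n generalizing x with
  | zero => simp [birkhoffMax]
  | succ n ih =>
    rw [birkhoffSum_succ']
    exact le_max_of_le_right (by linarith [ih (T x)])

theorem birkhoffMax_le_succ (n : ℕ) (x : α) :
    birkhoffMax T g n x ≤ birkhoffMax T g (n + 1) x := by
  induction n generalizing x with
  | zero => exact birkhoffMax_nonneg _ _
  | succ n ih => exact max_le_max le_rfl (by linarith [ih (T x)])

theorem birkhoffMax_monotone (x : α) : Monotone fun n => birkhoffMax T g n x :=
  monotone_nat_of_le_succ fun n => birkhoffMax_le_succ n x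

/-- Boundedness of the running maxima is thus an invariant event, so ergodicity gives it measure
zero or full measure. -/
theorem bddAbove_birkhoffMax_comp_iff (x : α) :
    BddAbove (range fun n => birkhoffMax T g n (T x)) ↔
      BddAbove (range fun n => birkhoffMax T g n x) := by
  constructor
  · rintro ⟨K, hK⟩
    refine ⟨max 0 (g x + K), ?_⟩
    rintro _ ⟨n, rfl⟩
    refine (birkhoffMax_le_succ n x).trans (max_le_max le_rfl ?_)
    have := hK ⟨n, rfl⟩
    simp only at this
    linarith
  · rintro ⟨K, hK⟩
    refine ⟨K - g x, ?_⟩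
    rintro _ ⟨n, rfl⟩
    have h1 := hK ⟨n + 1, rfl⟩
    have h2 : g x + birkhoffMax T g n (T x) ≤ birkhoffMax T g (n + 1) x := le_max_right _ _
    simp only at h1 ⊢
    linarith

variable [MeasurableSpace α] {μ : Measure α}

theorem measurable_birkhoffMax (hT : Measurable T) (hg : Measurable g) (n : ℕ) :
    Measurable (birkhoffMax T g n) := by
  induction n with
  | zero => exact measurable_const
  | succ n ih => exact measurable_const.max (hg.add (ih.comp hT))

theorem integrable_birkhoffMax [IsFiniteMeasure μ] (hT : MeasurePreserving T μ μ)
    (hg : Integrable g μ) (n : ℕ) : Integrable (birkhoffMax T g n) μ := by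
  induction n with
  | zero => exact integrable_const 0
  | succ n ih => exact (integrable_const 0).sup (hg.add (hT.integrable_comp_of_integrable ih))

/-- The Birkhoff sums of a function with negative mean are almost surely bounded above. -/
theorem ae_bddAbove_birkhoffSum [IsProbabilityMeasure μ] (hT : Ergodic T μ)
    (hgm : Measurable g) (hg : Integrable g μ) (hneg : ∫ x, g x ∂μ < 0) :
    ∀ᵐ x ∂μ, BddAbove (range fun n => birkhoffSum T g n x) := by
  set B : Set α := {x | BddAbove (range fun n => birkhoffMax T g n x)} with hB
  have hMm := measurable_birkhoffMax hT.measurable hgm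
  have hBm : MeasurableSet B := by
    exact measurableSet_bddAbove_range hMm
  have hBT : T ⁻¹' B = B := by
    ext x
    exact bddAbove_birkhoffMax_comp_iff x
  rcases hT.toPreErgodic.ae_empty_or_univ hBm hBT with h0 | h1
  · exfalso
    have hunb : ∀ᵐ x ∂μ, x ∉ B := by
      exact measure_eq_zero_iff_ae_notMem.mp (ae_eq_empty.mp h0)
    -- The integrand is `M (n+1) - M n ∘ T` for the running maxima `M`. By invariance its integral
    -- is that of `M (n+1) - M n ≥ 0`. Where `M n` is unbounded the integrand converges to `g`,
    -- which would force `∫ g ≥ 0`.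
    have hpos : ∀ n, 0 ≤ ∫ x, max (-birkhoffMax T g n (T x)) (g x) ∂μ := by
      intro n
      have e : ∀ x, max (-birkhoffMax T g n (T x)) (g x)
          = birkhoffMax T g (n + 1) x - birkhoffMax T g n (T x) := by
        intro x
        simp only [birkhoffMax]
        rw [← max_sub_sub_right]
        congr 1 <;> ring
      have hi := integrable_birkhoffMax hT.toMeasurePreserving hg n
      have hi1 := integrable_birkhoffMax hT.toMeasurePreserving hg (n + 1)
      have hc : ∫ x, birkhoffMax T g n (T x) ∂μ = ∫ x, birkhoffMax T g n x ∂μ := by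
        have h2 := integral_map (μ := μ) (f := birkhoffMax T g n) hT.measurable.aemeasurable
          (by rw [hT.map_eq]; exact (hMm n).aestronglyMeasurable)
        rw [hT.map_eq] at h2
        exact h2.symm
      simp_rw [e]
      have h3 := hT.toMeasurePreserving.integrable_comp_of_integrable hi
      rw [integral_sub (g := fun x => birkhoffMax T g n (T x)) hi1 h3, hc, ← integral_sub hi1 hi]
      exact integral_nonneg fun x => sub_nonneg.mpr (birkhoffMax_le_succ n x)
    have hlim : Tendsto (fun n => ∫ x, max (-birkhoffMax T g n (T x)) (g x) ∂μ) atTop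
        (𝓝 (∫ x, g x ∂μ)) := by
      refine tendsto_integral_of_dominated_convergence (fun x => |g x|) ?_ hg.abs ?_ ?_
      · intro n
        exact ((((hMm n).comp hT.measurable).neg).max hgm).aestronglyMeasurable
      · intro n
        refine Eventually.of_forall fun x => ?_
        have := birkhoffMax_nonneg (T := T) (g := g) n (T x)
        rw [Real.norm_eq_abs, abs_le]
        constructor
        · exact le_max_of_le_right (neg_abs_le _)
        · exact max_le (by linarith [abs_nonneg (g x)]) (le_abs_self _)
      · filter_upwards [hunb] with x hx
        have hx' : ¬ BddAbove (range fun n => birkhoffMax T g n (T x)) := fun h =>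
          hx ((bddAbove_birkhoffMax_comp_iff x).mp h)
        have ht := tendsto_atTop_atTop_of_monotone' (birkhoffMax_monotone (T := T) (g := g) (T x)) hx'
        refine tendsto_const_nhds.congr' ?_
        filter_upwards [ht.eventually_ge_atTop (-g x)] with n hn
        rw [max_eq_right (by linarith)]
    exact absurd (ge_of_tendsto' hlim hpos) (not_le.mpr hneg)
  · have h1' : ∀ᵐ x ∂μ, x ∈ B := mem_ae_iff.mpr (ae_eq_univ.mp h1)
    filter_upwards [h1'] with x hxB
    obtain ⟨K, hK⟩ := hxB
    refine ⟨K, ?_⟩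
    rintro _ ⟨n, rfl⟩
    exact (birkhoffSum_le_birkhoffMax n x).trans (hK ⟨n, rfl⟩)

/-- A one-sided linear bound with a random constant is all that is used later; convergence of the
averages is never needed. -/
theorem ae_birkhoffSum_le [IsProbabilityMeasure μ] (hT : Ergodic T μ)
    (hgm : Measurable g) (hg : Integrable g μ) {η : ℝ} (hη : ∫ x, g x ∂μ < η) :
    ∀ᵐ x ∂μ, ∃ K : ℝ, ∀ n : ℕ, birkhoffSum T g n x ≤ K + n * η := by
  have h := ae_bddAbove_birkhoffSum (g := fun x => g x - η) hT (hgm.sub_const η)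
    (hg.sub (integrable_const η)) (by
      rw [integral_sub hg (integrable_const η)]; simpa using hη)
  filter_upwards [h] with x ⟨K, hK⟩
  refine ⟨K, fun n => ?_⟩
  have h1 : birkhoffSum T (fun x => g x - η) n x ≤ K := hK ⟨n, rfl⟩
  simp only [birkhoffSum, Finset.sum_sub_distrib, Finset.sum_const, Finset.card_range,
    nsmul_eq_mul] at h1 ⊢
  linarith

theorem ae_le_birkhoffSum [IsProbabilityMeasure μ] (hT : Ergodic T μ)
    (hgm : Measurable g) (hg : Integrable g μ) {η : ℝ} (hη : η < ∫ x, g x ∂μ) :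
    ∀ᵐ x ∂μ, ∃ K : ℝ, ∀ n : ℕ, n * η - K ≤ birkhoffSum T g n x := by
  have h := ae_birkhoffSum_le (g := fun x => - g x) (η := -η) hT hgm.neg hg.neg (by
      rw [integral_neg]; linarith)
  filter_upwards [h] with x ⟨K, hK⟩
  refine ⟨K, fun n => ?_⟩
  have h1 := hK n
  simp only [birkhoffSum, Finset.sum_neg_distrib] at h1 ⊢
  linarith

end Birkhoff

/-! ### The shift -/

/-- The left shift as a measurable equivalence. -/
def shiftEquiv : (ℤ → ℝ) ≃ᵐ (ℤ → ℝ) where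
  toFun := shift
  invFun ζ x := ζ (x - 1)
  left_inv ζ := by ext x; simp [shift]
  right_inv ζ := by ext x; simp [shift]
  measurable_toFun := measurable_pi_lambda _ fun x => measurable_pi_apply (x + 1)
  measurable_invFun := measurable_pi_lambda _ fun x => measurable_pi_apply (x - 1)

theorem shift_iterate (n : ℕ) (ζ : ℤ → ℝ) (x : ℤ) : (shift^[n] ζ) x = ζ (x + n) := by
  induction n generalizing ζ with
  | zero => simp
  | succ n ih => rw [Function.iterate_succ_apply, ih]; simp [shift]; ring_nf

theorem shiftEquiv_symm_iterate (n : ℕ) (ζ : ℤ → ℝ) (x : ℤ) :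
    (shiftEquiv.symm^[n] ζ) x = ζ (x - n) := by
  induction n generalizing ζ with
  | zero => simp
  | succ n ih =>
    rw [Function.iterate_succ_apply, ih]
    change ζ (x - n - 1) = _
    push_cast; ring_nf

/-! ### Mixing and ergodicity of the shift under an i.i.d. law. -/

section IID

variable (η : Measure ℝ) [IsProbabilityMeasure η]

theorem measurePreserving_shift_infinitePi :
    MeasurePreserving shift (Measure.infinitePi fun _ : ℤ => η)
      (Measure.infinitePi fun _ : ℤ => η) := by
  refine ⟨shiftEquiv.measurable, ?_⟩
  refine Measure.eq_infinitePi (μ := fun _ : ℤ => η) fun s t ht => ?_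
  rw [Measure.map_apply (show Measurable shift from shiftEquiv.measurable) (MeasurableSet.pi s.countable_toSet fun i _ => ht i)]
  have : shift ⁻¹' (Set.pi s t)
      = Set.pi (s.map (Equiv.addRight (1 : ℤ)).toEmbedding : Finset ℤ) (fun i => t (i - 1)) := by
    ext ζ
    simp only [mem_preimage, Set.mem_pi, shift, Finset.coe_map, mem_image, Finset.mem_coe,
      forall_exists_index, and_imp, forall_apply_eq_imp_iff₂]
    simp
  rw [this, Measure.infinitePi_pi (μ := fun _ : ℤ => η) (fun i _ => ht _)]
  simp

/-- Once the shift has moved `s'` off `s`, the two cylinders involve disjoint sets of coordinates,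
so independence gives an exact equality. -/
theorem infinitePi_inter_shift_iterate_of_rectangle (s s' : Finset ℤ) (t t' : ℤ → Set ℝ)
    (ht : ∀ i, MeasurableSet (t i)) (ht' : ∀ i, MeasurableSet (t' i)) :
    ∀ᶠ n : ℕ in atTop, (Measure.infinitePi fun _ : ℤ => η)
        (Set.pi s t ∩ shift^[n] ⁻¹' Set.pi s' t') =
      (Measure.infinitePi fun _ : ℤ => η) (Set.pi s t) *
        (Measure.infinitePi fun _ : ℤ => η) (Set.pi s' t') := by
  classical
  obtain ⟨M, hM⟩ := s.bddAbove
  obtain ⟨m, hm⟩ := s'.bddBelow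
  filter_upwards [eventually_ge_atTop (M - m + 1).toNat] with n hn
  have hn' : M - m + 1 ≤ n := Int.toNat_le.mp hn
  set e : ℤ ↪ ℤ := (Equiv.addRight (n : ℤ)).toEmbedding with he
  have hdisj : Disjoint s (s'.map e) := by
    rw [Finset.disjoint_left]
    intro i hi hi'
    obtain ⟨j, hj, rfl⟩ := Finset.mem_map.mp hi'
    have h1 := hM hi
    have h2 := hm hj
    simp [he] at h1
    omega
  have hset : Set.pi (s : Set ℤ) t ∩ shift^[n] ⁻¹' Set.pi (s' : Set ℤ) t'
      = Set.pi (s ∪ s'.map e : Finset ℤ) (fun i => if i ∈ s then t i else t' (i - n)) := by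
    ext ζ
    simp only [mem_inter_iff, Set.mem_pi, mem_preimage, shift_iterate, Finset.coe_union,
      mem_union, Finset.mem_coe, Finset.mem_map]
    constructor
    · rintro ⟨h1, h2⟩ i (hi | ⟨j, hj, rfl⟩)
      · simpa [hi] using h1 i hi
      · have : e j ∉ s := fun h => Finset.disjoint_left.mp hdisj h (Finset.mem_map_of_mem e hj)
        rw [if_neg this]
        simpa [he] using h2 j hj
    · intro h
      refine ⟨fun i hi => by simpa [hi] using h i (Or.inl hi), fun j hj => ?_⟩
      have : e j ∉ s := fun h => Finset.disjoint_left.mp hdisj h (Finset.mem_map_of_mem e hj)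
      have h2 := h (e j) (Or.inr ⟨j, hj, rfl⟩)
      rw [if_neg this] at h2
      simpa [he] using h2
  rw [hset, Measure.infinitePi_pi (μ := fun _ : ℤ => η), Measure.infinitePi_pi (μ := fun _ : ℤ => η) (fun i _ => ht i),
    Measure.infinitePi_pi (μ := fun _ : ℤ => η) (fun i _ => ht' i), Finset.prod_union hdisj, Finset.prod_map]
  · congr 1
    · exact Finset.prod_congr rfl fun i hi => by simp [hi]
    · refine Finset.prod_congr rfl fun j hj => ?_
      have : e j ∉ s := fun h => Finset.disjoint_left.mp hdisj h (Finset.mem_map_of_mem e hj)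
      simp [this]
      simp [he]
  · intro i _
    split_ifs
    exacts [ht i, ht' _]

end IID

/-- A Dynkin-class argument: if `ν` and `ν n` are finite measures of the same mass, the convergence
`ν n A → ν A` extends from a generating `π`-system to all measurable sets, provided that the
`ν n` are dominated by a common finite measure. -/
theorem tendsto_measure_of_isPiSystem {α : Type*} {m : MeasurableSpace α} {C : Set (Set α)}
    (hC : m = MeasurableSpace.generateFrom C) (hpi : IsPiSystem C)
    {ν : ℕ → Measure α} {ν' ρ : Measure α} [IsFiniteMeasure ρ]
    (hle : ∀ n, ν n ≤ ρ) (hle' : ν' ≤ ρ) (huniv : ∀ n, ν n univ = ν' univ)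
    (h : ∀ A ∈ C, Tendsto (fun n => ν n A) atTop (𝓝 (ν' A))) {A : Set α}
    (hA : MeasurableSet A) : Tendsto (fun n => ν n A) atTop (𝓝 (ν' A)) := by
  have hfin : ∀ n, IsFiniteMeasure (ν n) := fun n =>
    ⟨(hle n univ).trans_lt (measure_lt_top ρ _)⟩
  have hfin' : IsFiniteMeasure ν' := ⟨(hle' univ).trans_lt (measure_lt_top ρ _)⟩
  induction A, hA using MeasurableSpace.induction_on_inter hC hpi with
  | empty => simp
  | basic t ht => exact h t ht
  | compl t ht ih =>
    simp_rw [measure_compl ht (measure_ne_top _ _), huniv]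
    exact ENNReal.Tendsto.sub tendsto_const_nhds ih (Or.inl (measure_ne_top _ _))
  | iUnion f hd hm ih =>
    simp_rw [measure_iUnion hd hm]
    have hsum : ∑' i, ρ (f i) ≠ ∞ := by
      rw [← measure_iUnion hd hm]; exact measure_ne_top _ _
    have e : ∀ (σ : Measure α), σ ≤ ρ → ∑' i, σ (f i)
        = ENNReal.ofReal (∑' i, (σ (f i)).toReal) := by
      intro σ hσ
      have hne : ∑' i, σ (f i) ≠ ∞ := ne_top_of_le_ne_top hsum (ENNReal.tsum_le_tsum fun i => hσ _)
      rw [← ENNReal.tsum_toReal_eq (fun i => ENNReal.ne_top_of_tsum_ne_top hne i),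
        ENNReal.ofReal_toReal hne]
    simp_rw [e _ (hle _), e _ hle']
    refine ENNReal.tendsto_ofReal ?_
    refine tendsto_tsum_of_dominated_convergence (bound := fun i => (ρ (f i)).toReal)
      (ENNReal.summable_toReal hsum) (fun i => ?_) (Eventually.of_forall fun n i => ?_)
    · exact (ENNReal.tendsto_toReal (measure_ne_top _ _)).comp (ih i)
    · rw [Real.norm_of_nonneg ENNReal.toReal_nonneg]
      exact ENNReal.toReal_mono (measure_ne_top _ _) (hle n _)

/-- The shift is mixing on cylinders. Extending first to one arbitrary set and then to the other, an
invariant `A` satisfies `P A = P A * P A`. -/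
theorem ergodic_shift_infinitePi (η : Measure ℝ) [IsProbabilityMeasure η] :
    Ergodic shift (Measure.infinitePi fun _ : ℤ => η) := by
  set P := Measure.infinitePi fun _ : ℤ => η with hP
  have hmp : MeasurePreserving shift P P := measurePreserving_shift_infinitePi η
  set C : Set (Set (ℤ → ℝ)) := squareCylinders (fun _ => {s : Set ℝ | MeasurableSet s}) with hC
  have hgen : (MeasurableSpace.pi : MeasurableSpace (ℤ → ℝ)) = MeasurableSpace.generateFrom C :=
    generateFrom_squareCylinders.symm
  have hpi : IsPiSystem C := by
    exact isPiSystem_squareCylinders (fun _ => MeasurableSpace.isPiSystem_measurableSet) (fun _ => mem_ofPred.mpr MeasurableSet.univ)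
  have hCm : ∀ A ∈ C, MeasurableSet A := fun A hA => by
    rw [hgen]; exact MeasurableSpace.measurableSet_generateFrom hA
  have step1 : ∀ A ∈ C, ∀ B, MeasurableSet B →
      Tendsto (fun n => P (A ∩ shift^[n] ⁻¹' B)) atTop (𝓝 (P A * P B)) := by
    intro A hA B hB
    have hAm := hCm A hA
    have key := tendsto_measure_of_isPiSystem hgen hpi
      (ν := fun n => (P.restrict A).map shift^[n]) (ν' := P A • P) (ρ := P) ?_ ?_ ?_ ?_ hB
    · refine (Eq.subst (motive := fun z => Tendsto _ atTop (𝓝 z)) rfl key).congr fun n => ?_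
      rw [Measure.map_apply (hmp.iterate n).measurable hB, Measure.restrict_apply ((hmp.iterate n).measurable hB),
        inter_comm]
    · intro n
      calc (P.restrict A).map shift^[n] ≤ P.map shift^[n] :=
            Measure.map_mono Measure.restrict_le_self (hmp.iterate n).measurable
        _ = P := (hmp.iterate n).map_eq
    · refine Measure.le_iff.mpr fun s _ => ?_
      simpa using mul_le_of_le_one_left (zero_le (a := P s)) prob_le_one
    · intro n
      rw [Measure.map_apply (hmp.iterate n).measurable MeasurableSet.univ]
      simp
    · intro B hB
      obtain ⟨s, t, ht, rfl⟩ := hA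
      obtain ⟨s', t', ht', rfl⟩ := hB
      have hev := infinitePi_inter_shift_iterate_of_rectangle η s s' t t' (fun i => ht i trivial) (fun i => ht' i trivial)
      refine tendsto_const_nhds.congr' ?_
      filter_upwards [hev] with n hn
      have hBm := hCm _ ⟨s', t', ht', rfl⟩
      rw [Measure.map_apply (hmp.iterate n).measurable hBm, Measure.restrict_apply ((hmp.iterate n).measurable hBm),
        inter_comm]
      exact hn.symm
  refine ⟨hmp, ⟨fun A hA hAinv => ?_⟩⟩
  have hinv : ∀ n : ℕ, shift^[n] ⁻¹' A = A := by
    intro n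
    induction n with
    | zero => rfl
    | succ n ih => rw [Function.iterate_succ, preimage_comp, ih, hAinv]
  have key := tendsto_measure_of_isPiSystem hgen hpi
      (ν := fun n => P.restrict A) (ν' := P A • P) (ρ := P)
      (fun _ => Measure.restrict_le_self) (by
        refine Measure.le_iff.mpr fun s _ => ?_
        simpa using mul_le_of_le_one_left (zero_le (a := P s)) prob_le_one) (by simp) (by
        intro B hB
        have h1 := step1 B hB A hA
        simp only [hinv] at h1
        rw [Measure.restrict_apply (hCm B hB)]
        simpa [mul_comm] using h1) hA
  have hsq : P A = P A * P A := by
    have := tendsto_nhds_unique tendsto_const_nhds key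
    simpa [Measure.restrict_apply hA] using this
  have h01 : P A = 0 ∨ P A = 1 := by
    by_cases h0 : P A = 0
    · exact Or.inl h0
    · right
      have := (ENNReal.mul_right_inj h0 (measure_ne_top P A)).mp (hsq.symm.trans (mul_one _).symm)
      exact this
  rw [Filter.eventuallyConst_set']
  rcases h01 with h0 | h1
  · left
    exact ae_eq_empty.mpr h0
  · right
    have := (prob_compl_eq_zero_iff hA).mpr h1
    exact ae_eq_univ.mpr this

end PAM

namespace PAM

/-! ### Weighted hitting sums on the half-line -/

section Hitting

variable (a b : ℝ≥0∞) (c c' : ℤ → ℝ≥0∞)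

/-- The weighted sum over the nearest-neighbour paths from `y` to `0` with at most `n` steps, where
each visit to `y` carries the weight `c y` and the steps to the left and to the right carry the
weights `a` and `b`. -/
noncomputable def hitSeq : ℕ → ℤ → ℝ≥0∞
  | 0, y => if y ≤ 0 then 1 else 0
  | n + 1, y => if y ≤ 0 then 1 else c y * (a * hitSeq n (y - 1) + b * hitSeq n (y + 1))

/-- The weighted sum over all nearest-neighbour paths from `y` to `0`. -/
noncomputable def hitSum (y : ℤ) : ℝ≥0∞ := ⨆ n, hitSeq a b c n y

/-- The weighted sum over all nearest-neighbour paths from `x` to `x - 1`. -/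
noncomputable def passage (x : ℤ) : ℝ≥0∞ := hitSum a b (fun y => c (y + (x - 1))) 1

variable {a b c c'}

theorem hitSeq_of_nonpos (n : ℕ) {y : ℤ} (hy : y ≤ 0) : hitSeq a b c n y = 1 := by
  cases n <;> simp [hitSeq, hy]

theorem hitSeq_succ_of_pos (n : ℕ) {y : ℤ} (hy : 0 < y) :
    hitSeq a b c (n + 1) y = c y * (a * hitSeq a b c n (y - 1) + b * hitSeq a b c n (y + 1)) := by
  simp [hitSeq, not_le.mpr hy]

theorem hitSeq_le_succ (n : ℕ) (y : ℤ) : hitSeq a b c n y ≤ hitSeq a b c (n + 1) y := by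
  induction n generalizing y with
  | zero =>
    rcases le_or_gt y 0 with hy | hy
    · simp [hitSeq_of_nonpos, hy]
    · simp [hitSeq, not_le.mpr hy]
  | succ n ih =>
    rcases le_or_gt y 0 with hy | hy
    · simp [hitSeq_of_nonpos, hy]
    · rw [hitSeq_succ_of_pos n hy, hitSeq_succ_of_pos (n + 1) hy]
      gcongr <;> exact ih _

theorem hitSeq_monotone (y : ℤ) : Monotone fun n => hitSeq a b c n y :=
  monotone_nat_of_le_succ fun n => hitSeq_le_succ n y

/-- The sums over paths with at most `n` steps only depend on the weights within distance `n`. -/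
theorem hitSeq_mono_weight (n : ℕ) (y : ℤ) (h : ∀ z, 1 ≤ z → z ≤ y + n → c z ≤ c' z) :
    hitSeq a b c n y ≤ hitSeq a b c' n y := by
  induction n generalizing y with
  | zero => simp [hitSeq]
  | succ n ih =>
    rcases le_or_gt y 0 with hy | hy
    · simp [hitSeq_of_nonpos, hy]
    · rw [hitSeq_succ_of_pos n hy, hitSeq_succ_of_pos n hy]
      push_cast at h
      gcongr
      · exact h y hy (by omega)
      · exact ih _ fun z h1 h2 => h z h1 (by omega)
      · exact ih _ fun z h1 h2 => h z h1 (by omega)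

theorem hitSum_mono_weight (h : ∀ z, c z ≤ c' z) (y : ℤ) : hitSum a b c y ≤ hitSum a b c' y :=
  iSup_mono fun n => hitSeq_mono_weight n y fun z _ _ => h z

theorem hitSum_of_nonpos {y : ℤ} (hy : y ≤ 0) : hitSum a b c y = 1 := by
  simp [hitSum, hitSeq_of_nonpos, hy]

theorem hitSum_of_pos {y : ℤ} (hy : 0 < y) :
    hitSum a b c y = c y * (a * hitSum a b c (y - 1) + b * hitSum a b c (y + 1)) := by
  have h1 : hitSum a b c y = ⨆ n, hitSeq a b c (n + 1) y :=
    ((hitSeq_monotone y).iSup_nat_add 1).symm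
  rw [h1]
  simp_rw [hitSeq_succ_of_pos _ hy]
  have h2 := ENNReal.iSup_add_iSup_of_monotone
    (f := fun n => a * hitSeq a b c n (y - 1)) (g := fun n => b * hitSeq a b c n (y + 1))
    (fun m n h => mul_le_mul_right (hitSeq_monotone (y - 1) h) a)
    (fun m n h => mul_le_mul_right (hitSeq_monotone (y + 1) h) b)
  rw [← ENNReal.mul_iSup, ← h2, ← ENNReal.mul_iSup, ← ENNReal.mul_iSup, hitSum, hitSum]

/-- Minimality of the hitting sums among supersolutions. -/
theorem hitSum_mul_le {V : ℤ → ℝ≥0∞}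
    (hV : ∀ y, 1 ≤ y → c y * (a * V (y - 1) + b * V (y + 1)) ≤ V y) {y : ℤ} (hy : 0 ≤ y) :
    hitSum a b c y * V 0 ≤ V y := by
  rw [hitSum, ENNReal.iSup_mul]
  refine iSup_le fun n => ?_
  induction n generalizing y with
  | zero =>
    rcases hy.eq_or_lt with rfl | hy
    · simp [hitSeq]
    · simp [hitSeq, not_le.mpr hy]
  | succ n ih =>
    rcases hy.eq_or_lt with rfl | hy
    · simp [hitSeq]
    · rw [hitSeq_succ_of_pos n hy]
      refine le_trans ?_ (hV y hy)
      rw [mul_assoc, add_mul, mul_assoc, mul_assoc]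
      gcongr
      · exact ih (by omega)
      · exact ih (by omega)

/-- Minimality moved to the target `x - 1`: a supersolution on `[x, ∞)` loses at most the passage
factor in one step to the right. -/
theorem passage_mul_le {V : ℤ → ℝ≥0∞} {x : ℤ}
    (hV : ∀ y, x ≤ y → c y * (a * V (y - 1) + b * V (y + 1)) ≤ V y) :
    passage a b c x * V (x - 1) ≤ V x := by
  have := hitSum_mul_le (a := a) (b := b) (c := fun y => c (y + (x - 1)))
    (V := fun y => V (y + (x - 1))) (fun y hy => ?_) (y := 1) (by norm_num)
  · simpa [passage] using this
  · have h := hV (y + (x - 1)) (by omega)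
    have e1 : y - 1 + (x - 1) = y + (x - 1) - 1 := by ring
    have e2 : y + 1 + (x - 1) = y + (x - 1) + 1 := by ring
    simp only [e1, e2]
    exact h

theorem passage_comp_add (k x : ℤ) : passage a b (fun y => c (y + k)) x = passage a b c (x + k) := by
  simp only [passage]
  congr 1
  ext y
  congr 1
  ring

/-- The strong Markov property in algebraic form: a path from `2` to `0` splits at its first visit
to `1`. Both inequalities come from minimality. -/
theorem hitSum_two : hitSum a b c 2 = passage a b c 2 * passage a b c 1 := by
  have h1 : passage a b c 1 = hitSum a b c 1 := by simp [passage]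
  apply le_antisymm
  -- The candidate supersolution: travel to `1` first, then from `1` to `0`.
  · set V : ℤ → ℝ≥0∞ := fun y => if y ≤ 0 then 1 else
      passage a b c 1 * hitSum a b (fun z => c (z + 1)) (y - 1) with hVdef
    have hV1 : V 1 = passage a b c 1 := by simp [hVdef, hitSum_of_nonpos]
    have hV2 : V 2 = passage a b c 2 * passage a b c 1 := by
      simp [hVdef, passage, mul_comm]
    have hV0 : V 0 = 1 := by simp [hVdef]
    have hle : passage a b c 2 * passage a b c 1 ≤ hitSum a b c 2 := by
      rw [h1]
      refine passage_mul_le (x := 2) (V := hitSum a b c) fun y hy => ?_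
      rw [hitSum_of_pos (by omega : 0 < y)]
    have := hitSum_mul_le (a := a) (b := b) (c := c) (V := V) (fun y hy => ?_) (y := 2) (by norm_num)
    · rwa [hV0, mul_one, hV2] at this
    · rcases hy.eq_or_lt with rfl | hy
      · rw [show (1 : ℤ) - 1 = 0 by norm_num, show (1 : ℤ) + 1 = 2 by norm_num, hV0, hV1, hV2]
        conv_rhs => rw [h1, hitSum_of_pos one_pos]
        norm_num [hitSum_of_nonpos]
        gcongr
      · have e : V y = passage a b c 1 * hitSum a b (fun z => c (z + 1)) (y - 1) := by
          simp [hVdef, show ¬ y ≤ 0 by omega]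
        have e1 : V (y + 1) = passage a b c 1 * hitSum a b (fun z => c (z + 1)) (y - 1 + 1) := by
          simp [hVdef, show ¬ y + 1 ≤ 0 by omega]
        have e2 : V (y - 1) = passage a b c 1 * hitSum a b (fun z => c (z + 1)) (y - 1 - 1) := by
          simp [hVdef, show ¬ y - 1 ≤ 0 by omega]
        rw [e, e1, e2, hitSum_of_pos (by omega : 0 < y - 1)]
        simp only [sub_add_cancel]
        apply le_of_eq
        ring
  · rw [h1]
    refine passage_mul_le (x := 2) (V := hitSum a b c) fun y hy => ?_
    rw [hitSum_of_pos (by omega : 0 < y)]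

/-- The recursion for the passage sums. -/
theorem passage_eq (x : ℤ) :
    passage a b c x = c x * (a + b * (passage a b c (x + 1) * passage a b c x)) := by
  have h0 : ∀ c : ℤ → ℝ≥0∞, passage a b c 1 = c 1 * (a + b * (passage a b c 2 * passage a b c 1)) := by
    intro c
    rw [← hitSum_two]
    conv_lhs => rw [passage, show (fun y => c (y + (1 - 1))) = c by simp, hitSum_of_pos one_pos]
    norm_num [hitSum_of_nonpos]
  have h := h0 (fun y => c (y + (x - 1)))
  rw [passage_comp_add, passage_comp_add] at h
  simpa [show (2 : ℤ) + (x - 1) = x + 1 by ring] using h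

theorem passage_mono_weight (h : ∀ z, c z ≤ c' z) (x : ℤ) : passage a b c x ≤ passage a b c' x :=
  hitSum_mono_weight (fun _ => h _) 1

/-- Iterates `passage_mul_le` over the levels `1, …, n`. Applied to the resolvent, it yields the
lower bound by a product of passage functionals. -/
theorem prod_passage_mul_le {V : ℤ → ℝ≥0∞}
    (hV : ∀ y, 1 ≤ y → c y * (a * V (y - 1) + b * V (y + 1)) ≤ V y) (n : ℕ) :
    (∏ j ∈ Finset.range n, passage a b c (j + 1)) * V 0 ≤ V n := by
  induction n with
  | zero => simp
  | succ n ih =>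
    rw [Finset.prod_range_succ, mul_comm _ (passage a b c _), mul_assoc]
    refine (mul_le_mul_right ih _).trans ?_
    have := passage_mul_le (a := a) (b := b) (c := c) (V := V) (x := n + 1) fun y hy =>
      hV y (by omega)
    simpa using this

theorem hitSeq_le_one (hab : a + b = 1) (hc : ∀ y, c y ≤ 1) (n : ℕ) (y : ℤ) :
    hitSeq a b c n y ≤ 1 := by
  induction n generalizing y with
  | zero => simp only [hitSeq]; split_ifs <;> simp
  | succ n ih =>
    rcases le_or_gt y 0 with hy | hy
    · simp [hitSeq_of_nonpos, hy]
    · rw [hitSeq_succ_of_pos n hy]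
      calc c y * (a * hitSeq a b c n (y - 1) + b * hitSeq a b c n (y + 1))
          ≤ 1 * (a * 1 + b * 1) := by gcongr; exacts [hc y, ih _, ih _]
        _ = 1 := by simp [hab]

theorem passage_le_one (hab : a + b = 1) (hc : ∀ y, c y ≤ 1) (x : ℤ) : passage a b c x ≤ 1 :=
  iSup_le fun n => hitSeq_le_one hab (fun _ => hc _) n 1

theorem hitSum_one_le_one (hab : a + b = 1) (y : ℤ) : hitSum a b 1 y ≤ 1 :=
  iSup_le fun n => hitSeq_le_one hab (fun _ => le_rfl) n y

/-- The unweighted walk with drift to the left hits `0` with probability one. -/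
theorem hitSum_one_eq_one (hab : a + b = 1) (hlt : b ≤ a) (y : ℤ) : hitSum a b 1 y = 1 := by
  have hat : a ≠ ∞ := ne_top_of_le_ne_top ENNReal.one_ne_top (hab ▸ le_self_add)
  have hbt : b ≠ ∞ := ne_top_of_le_ne_top ENNReal.one_ne_top (hab ▸ le_add_self)
  set A := a.toReal with hA
  set B := b.toReal with hB
  have hAB : A + B = 1 := by
    rw [hA, hB, ← ENNReal.toReal_add hat hbt, hab]; simp
  have hBA : B ≤ A := ENNReal.toReal_mono hat hlt
  have hB0 : 0 ≤ B := ENNReal.toReal_nonneg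
  have hft : ∀ y, hitSum a b 1 y ≠ ∞ := fun y =>
    ne_top_of_le_ne_top ENNReal.one_ne_top (hitSum_one_le_one hab y)
  set g : ℤ → ℝ := fun y => 1 - (hitSum a b 1 y).toReal with hg
  have hg0 : ∀ y, 0 ≤ g y := fun y => by
    have := ENNReal.toReal_mono ENNReal.one_ne_top (hitSum_one_le_one (a := a) (b := b) hab y)
    simp only [hg]; simp at this; linarith
  have hg1 : ∀ y, g y ≤ 1 := fun y => by
    have : 0 ≤ (hitSum a b 1 y).toReal := ENNReal.toReal_nonneg
    simp only [hg]; linarith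
  have hgz : g 0 = 0 := by simp [hg, hitSum_of_nonpos]
  have hrec : ∀ y, 0 < y → A * (g y - g (y - 1)) = B * (g (y + 1) - g y) := by
    intro y hy
    have h := congrArg ENNReal.toReal (hitSum_of_pos (a := a) (b := b) (c := 1) hy)
    rw [Pi.one_apply, one_mul, ENNReal.toReal_add (ENNReal.mul_ne_top hat (hft _))
      (ENNReal.mul_ne_top hbt (hft _)), ENNReal.toReal_mul, ENNReal.toReal_mul, ← hA, ← hB] at h
    simp only [hg]
    have : A = 1 - B := by linarith
    rw [this] at h ⊢
    linarith
  -- The escape probability `g` has increments in ratio `A / B ≥ 1`, so they never fall below the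
  -- first one. As `g` is bounded by `1`, this forces `g 1 = 0`.
  have hinc : ∀ n : ℕ, g 1 ≤ g (n + 1) - g n := by
    intro n
    induction n with
    | zero => simp [hgz]
    | succ n ih =>
      have h := hrec (n + 1) (by omega)
      have e : ((n : ℤ) + 1 - 1) = n := by ring
      rw [e] at h
      push_cast
      by_contra hcon
      push Not at hcon
      have hg1' := hg0 1
      have h2 : A * g 1 ≤ A * (g (n + 1) - g n) := by
        apply mul_le_mul_of_nonneg_left ih; linarith
      -- For `B = 0` the ratio is meaningless, but then the recursion makes `g` constant.
      rcases hB0.eq_or_lt with h0 | h0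
      · rw [← h0] at h hAB
        have : A = 1 := by linarith
        rw [this] at h
        have h3 : g 1 ≤ 0 := by linarith
        have h4 := hrec (n + 1 + 1) (by omega)
        rw [this, ← h0] at h4
        have e' : ((n : ℤ) + 1 + 1 - 1) = n + 1 := by ring
        rw [e'] at h4
        linarith
      · have h3 : B * (g (n + 1 + 1) - g (n + 1)) < B * g 1 := mul_lt_mul_of_pos_left hcon h0
        have h4 : B * g 1 ≤ A * g 1 := mul_le_mul_of_nonneg_right hBA hg1'
        linarith
  have hlin : ∀ n : ℕ, n * g 1 ≤ g n := by
    intro n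
    induction n with
    | zero => simp [hgz]
    | succ n ih => push_cast; linarith [hinc n]
  have hg10 : g 1 = 0 := by
    by_contra hne
    have hpos : 0 < g 1 := lt_of_le_of_ne (hg0 1) (Ne.symm hne)
    obtain ⟨n, hn⟩ := exists_nat_gt (1 / g 1)
    have := hlin n
    rw [div_lt_iff₀ hpos] at hn
    linarith [hg1 n]
  have hone : hitSum a b 1 1 = 1 := by
    rw [← ENNReal.toReal_eq_one_iff]
    simp only [hg] at hg10; linarith
  rcases le_or_gt y 0 with hy | hy
  · exact hitSum_of_nonpos hy
  · obtain ⟨n, rfl⟩ := Int.eq_ofNat_of_zero_le hy.le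
    apply le_antisymm (hitSum_one_le_one hab _)
    have := prod_passage_mul_le (a := a) (b := b) (c := 1) (V := hitSum a b 1)
      (fun y hy => (hitSum_of_pos (by omega)).ge) n
    have hp : ∀ x, passage a b 1 x = 1 := fun x => hone
    simpa [hp, hitSum_of_nonpos] using this

end Hitting

end PAM

namespace PAM

/-! ### The weights of the walk -/

/-- The weight of a visit to `x`, that is, the exponential moment of `ζ x + β` with respect to a
holding time. -/
noncomputable def visitWeight (κ : ℝ) (ζ : ℤ → ℝ) (β : ℝ) (x : ℤ) : ℝ≥0∞ :=
  ENNReal.ofReal κ / ENNReal.ofReal (κ - ζ x - β)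

/-- The probability of a step to the left of the walk with generator `κ Δ_{-h}`. -/
noncomputable def stepLeft (h : ℝ) : ℝ≥0∞ := ENNReal.ofReal ((1 + h) / 2)

/-- The probability of a step to the right of the walk with generator `κ Δ_{-h}`. -/
noncomputable def stepRight (h : ℝ) : ℝ≥0∞ := ENNReal.ofReal ((1 - h) / 2)

theorem stepLeft_add_stepRight {h : ℝ} (hh : h ∈ Ioc (0 : ℝ) 1) :
    stepLeft h + stepRight h = 1 := by
  rw [stepLeft, stepRight, ← ENNReal.ofReal_add (by linarith [hh.1]) (by linarith [hh.2])]
  ring_nf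
  simp

theorem stepRight_le_stepLeft {h : ℝ} (hh : h ∈ Ioc (0 : ℝ) 1) : stepRight h ≤ stepLeft h :=
  ENNReal.ofReal_le_ofReal (by linarith [hh.1])

theorem isProbabilityMeasure_stepMeasure {h : ℝ} (hh : h ∈ Ioc (0 : ℝ) 1) :
    IsProbabilityMeasure (stepMeasure h) := by
  constructor
  have := stepLeft_add_stepRight hh
  rw [stepLeft, stepRight, add_comm] at this
  simpa [stepMeasure] using this

theorem lintegral_stepMeasure (h : ℝ) (f : ℤ → ℝ≥0∞) :
    ∫⁻ z, f z ∂stepMeasure h = stepLeft h * f (-1) + stepRight h * f 1 := by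
  simp [stepMeasure, lintegral_add_measure, lintegral_smul_measure, stepLeft, stepRight, add_comm]

theorem lintegral_Ioi_exp_neg {q : ℝ} (hq : 0 < q) :
    ∫⁻ t in Ioi (0 : ℝ), ENNReal.ofReal (Real.exp (-(q * t))) = ENNReal.ofReal (1 / q) := by
  have hint := exp_neg_integrableOn_Ioi 0 hq
  simp only [neg_mul] at hint
  rw [← ofReal_integral_eq_lintegral_ofReal hint (Eventually.of_forall fun t => (Real.exp_pos _).le)]
  congr 1
  have := integral_exp_mul_Ioi (neg_lt_zero.mpr hq) 0
  simp only [neg_mul] at this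
  rw [this]
  simp [neg_div_neg_eq]

/-- The Laplace transform of an exponential function, which is infinite when it diverges. -/
theorem lintegral_Ioi_exp_mul (q : ℝ) :
    ∫⁻ t in Ioi (0 : ℝ), ENNReal.ofReal (Real.exp (-(q * t))) = (ENNReal.ofReal q)⁻¹ := by
  rcases lt_or_ge 0 q with hq | hq
  · rw [lintegral_Ioi_exp_neg hq, one_div, ENNReal.ofReal_inv_of_pos hq]
  · rw [ENNReal.ofReal_of_nonpos hq, ENNReal.inv_zero, eq_top_iff]
    calc (∞ : ℝ≥0∞) = ∫⁻ t in Ioi (0 : ℝ), 1 := by simp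
      _ ≤ _ := by
        refine setLIntegral_mono' measurableSet_Ioi fun t ht => ?_
        rw [ENNReal.one_le_ofReal]
        apply Real.one_le_exp
        have : 0 < t := ht
        nlinarith

/-- For `θ ≥ κ` both sides are `∞`: the denominator truncates to `0`, and a positive number divided
by `0` is `∞` in `ℝ≥0∞`. Hence `visitWeight` needs no case distinction. -/
theorem lintegral_exp_expMeasure {κ : ℝ} (hκ : 0 < κ) (θ : ℝ) :
    ∫⁻ s, ENNReal.ofReal (Real.exp (θ * s)) ∂expMeasure κ =
      ENNReal.ofReal κ / ENNReal.ofReal (κ - θ) := by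
  have hd : expMeasure κ = volume.withDensity (exponentialPDF κ) := rfl
  have hm : Measurable (exponentialPDF κ) :=
    (measurable_exponentialPDFReal κ).ennreal_ofReal
  rw [hd, lintegral_withDensity_eq_lintegral_mul _ hm (by fun_prop), ENNReal.div_eq_inv_mul,
    ← lintegral_Ioi_exp_mul, ← lintegral_mul_const _ (by fun_prop),
    ← lintegral_indicator measurableSet_Ioi]
  refine lintegral_congr_ae ?_
  have h0 : ∀ᵐ s : ℝ, s ≠ 0 := by simp [ae_iff]
  filter_upwards [h0] with s hs
  rcases lt_or_gt_of_ne hs with hs | hs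
  · simp [exponentialPDF_of_neg hs, hs.le]
  · rw [indicator_of_mem (mem_Ioi.mpr hs), Pi.mul_apply, exponentialPDF_of_nonneg hs.le,
      ← ENNReal.ofReal_mul (by positivity), ← ENNReal.ofReal_mul (by positivity), mul_assoc,
      ← Real.exp_add]
    ring_nf

theorem ae_pos_expMeasure (κ : ℝ) : ∀ᵐ s ∂expMeasure κ, 0 < s := by
  have hd : expMeasure κ = volume.withDensity (exponentialPDF κ) := rfl
  have hm : Measurable (exponentialPDF κ) :=
    (measurable_exponentialPDFReal κ).ennreal_ofReal
  rw [hd, ae_withDensity_iff hm]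
  have h0 : ∀ᵐ s : ℝ, s ≠ 0 := by simp [ae_iff]
  filter_upwards [h0] with s hs hne
  by_contra hcon
  exact hne (exponentialPDF_of_neg (lt_of_le_of_ne (not_lt.mp hcon) hs))

/-! ### First-step decomposition of an infinite product -/

/-- Prepending an entry to a sequence. -/
def consSeq {α : Type*} (p : α × (ℕ → α)) : ℕ → α
  | 0 => p.1
  | n + 1 => p.2 n

theorem measurable_consSeq {α : Type*} [MeasurableSpace α] :
    Measurable (consSeq : α × (ℕ → α) → ℕ → α) := by
  refine measurable_pi_lambda _ fun n => ?_
  cases n with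
  | zero => exact measurable_fst
  | succ n => exact (measurable_pi_apply n).comp measurable_snd

/-- Checked on boxes. A finite set of coordinates is first padded with `univ` to an initial segment,
so that coordinate `0` can be split off. -/
theorem map_consSeq_infinitePi {α : Type*} [MeasurableSpace α] (ν : Measure α)
    [IsProbabilityMeasure ν] :
    (ν.prod (Measure.infinitePi fun _ : ℕ => ν)).map consSeq =
      Measure.infinitePi fun _ : ℕ => ν := by
  classical
  refine Measure.eq_infinitePi (μ := fun _ : ℕ => ν) fun s t ht => ?_
  obtain ⟨N, hN⟩ := s.exists_nat_subset_range
  set t' : ℕ → Set α := fun i => if i ∈ s then t i else univ with ht'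
  have hm' : ∀ i, MeasurableSet (t' i) := fun i => by
    simp only [ht']; split_ifs; exacts [ht i, MeasurableSet.univ]
  have hset : Set.pi (s : Set ℕ) t = Set.pi (Finset.range (N + 1) : Finset ℕ) t' := by
    ext w
    simp only [Set.mem_pi, Finset.mem_coe, Finset.mem_range, ht']
    constructor
    · intro h i _
      split_ifs with hi
      exacts [h i hi, trivial]
    · intro h i hi
      have := h i (by have := Finset.mem_range.mp (hN hi); omega)
      rwa [if_pos hi] at this
  have hprod : ∏ i ∈ s, ν (t i) = ∏ i ∈ Finset.range (N + 1), ν (t' i) := by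
    rw [← Finset.prod_subset (hN.trans (Finset.range_mono (Nat.le_succ N)))]
    · exact Finset.prod_congr rfl fun i hi => by simp [ht', hi]
    · intro i _ hi
      simp [ht', hi]
  have hpre : consSeq ⁻¹' Set.pi (Finset.range (N + 1) : Finset ℕ) t' =
      t' 0 ×ˢ Set.pi (Finset.range N : Finset ℕ) (fun i => t' (i + 1)) := by
    ext ⟨z, w⟩
    simp only [mem_preimage, Set.mem_pi, Finset.mem_coe, Finset.mem_range, mem_prod]
    constructor
    · exact fun h => ⟨h 0 (by omega), fun i hi => h (i + 1) (by omega)⟩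
    · rintro ⟨h1, h2⟩ i hi
      cases i with
      | zero => exact h1
      | succ i => exact h2 i (by omega)
  rw [hset, hprod, Measure.map_apply measurable_consSeq
    (MeasurableSet.pi (Finset.countable_toSet _) fun i _ => hm' i), hpre, Measure.prod_prod,
    Measure.infinitePi_pi (μ := fun _ : ℕ => ν) (fun i _ => hm' _), Finset.prod_range_succ', mul_comm]

theorem lintegral_infinitePi_nat {α : Type*} [MeasurableSpace α] (ν : Measure α)
    [IsProbabilityMeasure ν] {f : (ℕ → α) → ℝ≥0∞} (hf : Measurable f) :
    ∫⁻ w, f w ∂(Measure.infinitePi fun _ : ℕ => ν) =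
      ∫⁻ z, ∫⁻ w, f (consSeq (z, w)) ∂(Measure.infinitePi fun _ : ℕ => ν) ∂ν := by
  conv_lhs => rw [← map_consSeq_infinitePi ν, lintegral_map hf measurable_consSeq]
  exact lintegral_prod _ (hf.comp measurable_consSeq).aemeasurable

/-! ### Path functionals of the walk -/

/-- The weight `exp ∑ (ζ + β) τ` collected by the walk from `x` until it reaches `(-∞, 0]`, on the
event that it does so within `n` steps. -/
noncomputable def pathWeight (ζ : ℤ → ℝ) (β : ℝ) : ℕ → ℤ → WalkSpace → ℝ≥0∞
  | 0, x, _ => if x ≤ 0 then 1 else 0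
  | n + 1, x, w => if x ≤ 0 then 1 else
      ENNReal.ofReal (Real.exp ((ζ x + β) * (w 0).1)) *
        pathWeight ζ β n (x + (w 0).2) (fun i => w (i + 1))

theorem pathWeight_le_succ (ζ : ℤ → ℝ) (β : ℝ) (n : ℕ) (x : ℤ) (w : WalkSpace) :
    pathWeight ζ β n x w ≤ pathWeight ζ β (n + 1) x w := by
  induction n generalizing x w with
  | zero => simp only [pathWeight]; split_ifs <;> simp
  | succ n ih =>
    rw [pathWeight, pathWeight]
    split_ifs
    · exact le_rfl
    · exact mul_le_mul_right (ih _ _) _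

theorem measurable_pathWeight (ζ : ℤ → ℝ) (β : ℝ) (n : ℕ) :
    Measurable fun p : WalkSpace × ℤ => pathWeight ζ β n p.2 p.1 := by
  induction n with
  | zero =>
    refine measurable_from_prod_countable_left fun x => ?_
    simp only [pathWeight]
    split_ifs <;> exact measurable_const
  | succ n ih =>
    refine measurable_from_prod_countable_left fun x => ?_
    simp only [pathWeight]
    split_ifs
    · exact measurable_const
    · refine Measurable.mul (by fun_prop) ?_
      have : Measurable fun w : WalkSpace => ((fun i => w (i + 1) : WalkSpace), x + (w 0).2) := by
        fun_prop
      exact ih.comp this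

theorem measurable_pathWeight_right (ζ : ℤ → ℝ) (β : ℝ) (n : ℕ) (x : ℤ) :
    Measurable (pathWeight ζ β n x) :=
  (measurable_pathWeight ζ β n).comp (measurable_id.prodMk measurable_const)

/-- Integrating out the first holding time produces `visitWeight`, and integrating out the first
step averages over the neighbours; this is the recursion of `hitSeq`. -/
theorem lintegral_pathWeight {κ h : ℝ} (hκ : 0 < κ) (hh : h ∈ Ioc (0 : ℝ) 1) (ζ : ℤ → ℝ) (β : ℝ)
    (n : ℕ) (x : ℤ) :
    ∫⁻ w, pathWeight ζ β n x w ∂walkMeasure κ h =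
      hitSeq (stepLeft h) (stepRight h) (visitWeight κ ζ β) n x := by
  have h1 := isProbabilityMeasure_expMeasure hκ
  have h2 := isProbabilityMeasure_stepMeasure hh
  have h3 : IsProbabilityMeasure (walkMeasure κ h) := by unfold walkMeasure; infer_instance
  induction n generalizing x with
  | zero => simp [pathWeight, hitSeq]
  | succ n ih =>
    rcases le_or_gt x 0 with hx | hx
    · simp [pathWeight, hitSeq, hx]
    · rw [walkMeasure, lintegral_infinitePi_nat _ (measurable_pathWeight_right ζ β _ _),
        hitSeq_succ_of_pos n hx]
      simp only [pathWeight, if_neg (not_le.mpr hx), consSeq]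
      have e : ∀ z : ℝ × ℤ, ∫⁻ w : WalkSpace, ENNReal.ofReal (Real.exp ((ζ x + β) * z.1)) *
          pathWeight ζ β n (x + z.2) (fun i => w i)
            ∂(Measure.infinitePi fun _ : ℕ => (expMeasure κ).prod (stepMeasure h)) =
          ENNReal.ofReal (Real.exp ((ζ x + β) * z.1)) *
            hitSeq (stepLeft h) (stepRight h) (visitWeight κ ζ β) n (x + z.2) := by
        intro z
        rw [lintegral_const_mul _ (measurable_pathWeight_right ζ β _ _)]
        congr 1
        exact ih _
      simp_rw [e]
      rw [lintegral_prod_mul (f := fun s => ENNReal.ofReal (Real.exp ((ζ x + β) * s)))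
        (g := fun k => hitSeq (stepLeft h) (stepRight h) (visitWeight κ ζ β) n (x + k))
        (by fun_prop) (by fun_prop), lintegral_exp_expMeasure hκ, lintegral_stepMeasure, visitWeight,
        sub_sub]
      rfl

/-- The walk from `x` with steps `w` hits `0` at the `N`-th step. -/
def IsFirstHit (x : ℤ) (w : WalkSpace) (N : ℕ) : Prop :=
  x + ∑ i ∈ Finset.range N, (w i).2 = 0 ∧ ∀ k < N, 0 < x + ∑ i ∈ Finset.range k, (w i).2

/-- The exponent collected by the walk before its `N`-th step. -/
def pathExponent (ζ : ℤ → ℝ) (β : ℝ) (x : ℤ) (w : WalkSpace) (N : ℕ) : ℝ :=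
  ∑ k ∈ Finset.range N, (ζ (x + ∑ i ∈ Finset.range k, (w i).2) + β) * (w k).1

theorem pathWeight_of_isFirstHit (ζ : ℤ → ℝ) (β : ℝ) {n N : ℕ} {x : ℤ} {w : WalkSpace}
    (hN : IsFirstHit x w N) : pathWeight ζ β n x w =
      if N ≤ n then ENNReal.ofReal (Real.exp (pathExponent ζ β x w N)) else 0 := by
  induction n generalizing N x w with
  | zero =>
    cases N with
    | zero =>
      have : x = 0 := by simpa using hN.1
      simp [pathWeight, this, pathExponent]
    | succ N =>
      have : 0 < x := by simpa using hN.2 0 (by omega)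
      simp [pathWeight, this]
  | succ n ih =>
    cases N with
    | zero =>
      have : x = 0 := by simpa using hN.1
      simp [pathWeight, this, pathExponent]
    | succ N =>
      have hx : 0 < x := by simpa using hN.2 0 (by omega)
      have hN' : IsFirstHit (x + (w 0).2) (fun i => w (i + 1)) N := by
        constructor
        · have := hN.1
          rw [Finset.sum_range_succ'] at this
          rw [← this]; ring
        · intro k hk
          have := hN.2 (k + 1) (by omega)
          rw [Finset.sum_range_succ'] at this
          convert! this using 1; ring
      rw [pathWeight, if_neg (not_le.mpr hx), ih hN']
      simp only [add_le_add_iff_right]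
      split_ifs
      · rw [← ENNReal.ofReal_mul (Real.exp_pos _).le, ← Real.exp_add, pathExponent, pathExponent,
          Finset.sum_range_succ' _ N]
        congr 2
        simp only [Finset.sum_range_succ', Finset.sum_range_zero, add_zero]
        rw [add_comm]
        congr 1
        refine Finset.sum_congr rfl fun k _ => ?_
        congr 3
        ring
      · simp

theorem iSup_pathWeight_of_isFirstHit (ζ : ℤ → ℝ) (β : ℝ) {N : ℕ} {x : ℤ} {w : WalkSpace}
    (hN : IsFirstHit x w N) :
    ⨆ n, pathWeight ζ β n x w = ENNReal.ofReal (Real.exp (pathExponent ζ β x w N)) := by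
  simp_rw [pathWeight_of_isFirstHit ζ β hN]
  refine le_antisymm (iSup_le fun n => ?_) ((le_of_eq (by simp)).trans (le_iSup _ N))
  split_ifs <;> simp

theorem pathWeight_eq_zero (ζ : ℤ → ℝ) (β : ℝ) {n : ℕ} {x : ℤ} {w : WalkSpace}
    (hpos : ∀ k, 0 < x + ∑ i ∈ Finset.range k, (w i).2) : pathWeight ζ β n x w = 0 := by
  induction n generalizing x w with
  | zero => have := hpos 0; simp at this; simp [pathWeight, this]
  | succ n ih =>
    have hx := hpos 0
    simp at hx
    rw [pathWeight, if_neg (not_le.mpr hx), ih, mul_zero]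
    intro k
    have := hpos (k + 1)
    rw [Finset.sum_range_succ'] at this
    convert! this using 1; ring

theorem pathWeight_zero_le_one (n : ℕ) (x : ℤ) (w : WalkSpace) : pathWeight 0 0 n x w ≤ 1 := by
  induction n generalizing x w with
  | zero => simp only [pathWeight]; split_ifs <;> simp
  | succ n ih =>
    rw [pathWeight]
    split_ifs
    · exact le_rfl
    · simpa using ih _ _

theorem lintegral_iSup_pathWeight {κ h : ℝ} (hκ : 0 < κ) (hh : h ∈ Ioc (0 : ℝ) 1) (ζ : ℤ → ℝ)
    (β : ℝ) (x : ℤ) :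
    ∫⁻ w, ⨆ n, pathWeight ζ β n x w ∂walkMeasure κ h =
      hitSum (stepLeft h) (stepRight h) (visitWeight κ ζ β) x := by
  rw [lintegral_iSup (fun n => measurable_pathWeight_right ζ β n x)
    (monotone_nat_of_le_succ fun n w => pathWeight_le_succ ζ β n x w)]
  simp_rw [lintegral_pathWeight hκ hh]
  rfl

theorem ae_walkMeasure {κ h : ℝ} (hκ : 0 < κ) (hh : h ∈ Ioc (0 : ℝ) 1) :
    ∀ᵐ w ∂walkMeasure κ h, ∀ i, 0 < (w i).1 ∧ ((w i).2 = 1 ∨ (w i).2 = -1) := by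
  have h1 := isProbabilityMeasure_expMeasure hκ
  have h2 := isProbabilityMeasure_stepMeasure hh
  rw [ae_all_iff]
  intro i
  have hmp := measurePreserving_eval_infinitePi
    (fun _ : ℕ => (expMeasure κ).prod (stepMeasure h)) i
  have hs : ∀ᵐ k ∂stepMeasure h, k = 1 ∨ k = -1 := by
    rw [ae_iff]
    simp [stepMeasure]
  have h3 : ∀ᵐ z ∂(expMeasure κ).prod (stepMeasure h), 0 < z.1 ∧ (z.2 = 1 ∨ z.2 = -1) :=
    (Measure.quasiMeasurePreserving_fst.ae (ae_pos_expMeasure κ)).and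
      (Measure.quasiMeasurePreserving_snd.ae hs)
  exact hmp.quasiMeasurePreserving.ae h3

/-- For zero potential and `β = 0` the path weight is at most `1` and vanishes on paths that stay
positive. Its mean is `1` by `hitSum_one_eq_one`, so almost every path leaves the positive
half-line, and with unit steps it does so exactly at `0`. -/
theorem ae_exists_isFirstHit {κ h : ℝ} (hκ : 0 < κ) (hh : h ∈ Ioc (0 : ℝ) 1) {x : ℤ} (hx : 0 ≤ x) :
    ∀ᵐ w ∂walkMeasure κ h, ∃ N, IsFirstHit x w N := by
  have h1 := isProbabilityMeasure_expMeasure hκ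
  have h2 := isProbabilityMeasure_stepMeasure hh
  have h3 : IsProbabilityMeasure (walkMeasure κ h) := by unfold walkMeasure; infer_instance
  have hint : ∫⁻ w, ⨆ n, pathWeight 0 0 n x w ∂walkMeasure κ h = 1 := by
    rw [lintegral_iSup_pathWeight hκ hh,
      ← hitSum_one_eq_one (stepLeft_add_stepRight hh) (stepRight_le_stepLeft hh) x]
    congr 1
    ext y
    simp [visitWeight, ENNReal.div_self, hκ]
  have hone : ∀ᵐ w ∂walkMeasure κ h, ⨆ n, pathWeight 0 0 n x w = 1 := by
    have hle : ∀ w : WalkSpace, ⨆ n, pathWeight 0 0 n x w ≤ 1 := fun w =>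
      iSup_le fun n => pathWeight_zero_le_one n x w
    refine ae_eq_of_ae_le_of_lintegral_le (g := fun _ => 1) (Eventually.of_forall hle) ?_
      aemeasurable_const ?_
    · rw [hint]; exact ENNReal.one_ne_top
    · rw [hint]; simp
  filter_upwards [hone, ae_walkMeasure hκ hh] with w hw hstep
  have hex : ∃ k, x + ∑ i ∈ Finset.range k, (w i).2 ≤ 0 := by
    by_contra hcon
    push Not at hcon
    simp [pathWeight_eq_zero 0 0 hcon] at hw
  classical
  refine ⟨Nat.find hex, ?_, fun k hk => not_le.mp (Nat.find_min hex hk)⟩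
  refine le_antisymm (Nat.find_spec hex) ?_
  rcases hk : Nat.find hex with _ | m
  · simpa using hx
  · have hm := not_le.mp (Nat.find_min hex (m := m) (by omega))
    rw [Finset.sum_range_succ]
    rcases (hstep m).2 with h | h <;> rw [h] <;> omega

/-! ### The continuous-time trajectory in terms of holding times and steps. -/

section Trajectory

variable {x : ℤ} {w : WalkSpace}

theorem jumpTime_strictMono (hw : ∀ i, 0 < (w i).1) :
    StrictMono fun k => ∑ i ∈ Finset.range k, (w i).1 :=
  strictMono_nat_of_lt_succ fun k => by rw [Finset.sum_range_succ]; linarith [hw k]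

theorem walk_eq (hw : ∀ i, 0 < (w i).1) {k : ℕ} {s : ℝ}
    (h1 : ∑ i ∈ Finset.range k, (w i).1 ≤ s) (h2 : s < ∑ i ∈ Finset.range (k + 1), (w i).1) :
    walk x w s = x + ∑ i ∈ Finset.range k, (w i).2 := by
  have : jumpCount w s = k := by
    have hset : {n : ℕ | ∑ i ∈ Finset.range (n + 1), (w i).1 ≤ s} = Iio k := by
      ext n
      simp only [mem_ofPred_eq, mem_Iio]
      constructor
      · intro h
        have := (jumpTime_strictMono hw).lt_iff_lt.mp (h.trans_lt h2)
        omega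
      · intro h
        exact ((jumpTime_strictMono hw).monotone (show n + 1 ≤ k by omega)).trans h1
    rw [jumpCount, hset]
    simp [Set.ncard_eq_toFinset_card']
  rw [walk, this]

theorem exists_jumpTime_le {N : ℕ} {s : ℝ} (h0 : 0 ≤ s)
    (h : s < ∑ i ∈ Finset.range N, (w i).1) :
    ∃ k < N, ∑ i ∈ Finset.range k, (w i).1 ≤ s ∧ s < ∑ i ∈ Finset.range (k + 1), (w i).1 := by
  induction N with
  | zero => simp at h; linarith
  | succ N ih =>
    rcases lt_or_ge s (∑ i ∈ Finset.range N, (w i).1) with h' | h'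
    · obtain ⟨k, hk, hk'⟩ := ih h'
      exact ⟨k, by omega, hk'⟩
    · exact ⟨N, by omega, h', h⟩

theorem hittingTime_eq (hw : ∀ i, 0 < (w i).1) {N : ℕ} (hN : IsFirstHit x w N) :
    hittingTime x 0 w = ENNReal.ofReal (∑ i ∈ Finset.range N, (w i).1) := by
  apply le_antisymm
  · refine sInf_le ⟨_, ⟨Finset.sum_nonneg fun i _ => (hw i).le, ?_⟩, rfl⟩
    rw [walk_eq hw le_rfl (jumpTime_strictMono hw (Nat.lt_succ_self N)), hN.1]
  · refine le_sInf ?_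
    rintro _ ⟨t, ⟨ht0, ht⟩, rfl⟩
    refine ENNReal.ofReal_le_ofReal ?_
    by_contra hcon
    obtain ⟨k, hk, h1, h2⟩ := exists_jumpTime_le ht0 (not_le.mp hcon)
    rw [walk_eq hw h1 h2] at ht
    exact absurd ht (hN.2 k hk).ne'

theorem setIntegral_walk (hw : ∀ i, 0 < (w i).1) (f : ℤ → ℝ) (N : ℕ) :
    IntegrableOn (fun s => f (walk x w s)) (Ico 0 (∑ i ∈ Finset.range N, (w i).1)) ∧
      ∫ s in Ico 0 (∑ i ∈ Finset.range N, (w i).1), f (walk x w s) =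
        ∑ k ∈ Finset.range N, f (x + ∑ i ∈ Finset.range k, (w i).2) * (w k).1 := by
  induction N with
  | zero => simp
  | succ N ih =>
    have hmono : ∑ i ∈ Finset.range N, (w i).1 ≤ ∑ i ∈ Finset.range (N + 1), (w i).1 :=
      (jumpTime_strictMono hw).monotone (Nat.le_succ N)
    have h0 : 0 ≤ ∑ i ∈ Finset.range N, (w i).1 := Finset.sum_nonneg fun i _ => (hw i).le
    have hcongr : EqOn (fun s => f (walk x w s))
        (fun _ => f (x + ∑ i ∈ Finset.range N, (w i).2))
        (Ico (∑ i ∈ Finset.range N, (w i).1) (∑ i ∈ Finset.range (N + 1), (w i).1)) := by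
      intro s hs
      simp only
      rw [walk_eq hw hs.1 hs.2]
    have hint : IntegrableOn (fun s => f (walk x w s))
        (Ico (∑ i ∈ Finset.range N, (w i).1) (∑ i ∈ Finset.range (N + 1), (w i).1)) :=
      (integrableOn_congr_fun hcongr measurableSet_Ico).mpr (integrableOn_const (by simp))
    rw [← Ico_union_Ico_eq_Ico h0 hmono]
    refine ⟨ih.1.union hint, ?_⟩
    rw [setIntegral_union (by
      rw [Set.disjoint_left]; intro s hs hs'; exact absurd hs.2 (not_lt.mpr hs'.1))
      measurableSet_Ico ih.1 hint, ih.2, setIntegral_congr_fun measurableSet_Ico hcongr,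
      Finset.sum_range_succ _ N, setIntegral_const]
    rw [smul_eq_mul, mul_comm, measureReal_def, Real.volume_Ico, Finset.sum_range_succ _ N,
      add_sub_cancel_left, ENNReal.toReal_ofReal (hw N).le]

theorem setIntegral_walk_hittingTime (hw : ∀ i, 0 < (w i).1) {N : ℕ} (hN : IsFirstHit x w N)
    (ζ : ℤ → ℝ) (β : ℝ) :
    ∫ s in {s : ℝ | 0 ≤ s ∧ ENNReal.ofReal s < hittingTime x 0 w}, (ζ (walk x w s) + β) =
      pathExponent ζ β x w N := by
  have hset : {s : ℝ | 0 ≤ s ∧ ENNReal.ofReal s < hittingTime x 0 w} =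
      Ico 0 (∑ i ∈ Finset.range N, (w i).1) := by
    ext s
    simp only [mem_ofPred_eq, mem_Ico, hittingTime_eq hw hN]
    refine and_congr_right fun hs => ?_
    rw [ENNReal.ofReal_lt_ofReal_iff_of_nonneg hs]
  rw [hset]
  exact (setIntegral_walk hw (fun y => ζ y + β) N).2

end Trajectory

/-- The hitting functional as a passage sum. -/
theorem hittingFunctional_eq_passage {κ h : ℝ} (hκ : 0 < κ) (hh : h ∈ Ioc (0 : ℝ) 1) (ζ : ℤ → ℝ)
    (β : ℝ) : hittingFunctional κ h ζ β =
      passage (stepLeft h) (stepRight h) (visitWeight κ ζ β) 1 := by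
  have h1 : passage (stepLeft h) (stepRight h) (visitWeight κ ζ β) 1 =
      hitSum (stepLeft h) (stepRight h) (visitWeight κ ζ β) 1 := by simp [passage]
  rw [h1, ← lintegral_iSup_pathWeight hκ hh, hittingFunctional]
  refine lintegral_congr_ae ?_
  filter_upwards [ae_walkMeasure hκ hh, ae_exists_isFirstHit hκ hh zero_le_one] with w hw ⟨N, hN⟩
  rw [iSup_pathWeight_of_isFirstHit ζ β hN, setIntegral_walk_hittingTime (fun i => (hw i).1) hN]

/-- Along a fixed path the exponent is affine in `β`, and the exponential is convex. -/
theorem hittingFunctional_convex {κ h : ℝ} (hκ : 0 < κ) (hh : h ∈ Ioc (0 : ℝ) 1) (ζ : ℤ → ℝ)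
    {β β' θ : ℝ} (h0 : 0 ≤ θ) (h1 : θ ≤ 1) :
    hittingFunctional κ h ζ ((1 - θ) * β + θ * β') ≤
      ENNReal.ofReal (1 - θ) * hittingFunctional κ h ζ β +
        ENNReal.ofReal θ * hittingFunctional κ h ζ β' := by
  have e : ∀ β, hittingFunctional κ h ζ β =
      ∫⁻ w, ⨆ n, pathWeight ζ β n 1 w ∂walkMeasure κ h := fun β => by
    rw [hittingFunctional_eq_passage hκ hh, lintegral_iSup_pathWeight hκ hh]; simp [passage]
  have hm : ∀ β, Measurable fun w => ⨆ n, pathWeight ζ β n 1 w := fun β =>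
    Measurable.iSup fun n => measurable_pathWeight_right ζ β n 1
  rw [e, e, e, ← lintegral_const_mul _ (hm _), ← lintegral_const_mul _ (hm _),
    ← lintegral_add_left ((hm _).const_mul _)]
  refine lintegral_mono_ae ?_
  filter_upwards [ae_exists_isFirstHit hκ hh zero_le_one] with w ⟨N, hN⟩
  simp only [iSup_pathWeight_of_isFirstHit ζ _ hN]
  rw [← ENNReal.ofReal_mul (by linarith), ← ENNReal.ofReal_mul h0, ← ENNReal.ofReal_add
    (mul_nonneg (by linarith) (Real.exp_pos _).le) (mul_nonneg h0 (Real.exp_pos _).le)]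
  refine ENNReal.ofReal_le_ofReal ?_
  have hconv := convexOn_exp.2 (mem_univ (pathExponent ζ β 1 w N))
    (mem_univ (pathExponent ζ β' 1 w N)) (sub_nonneg.mpr h1) h0 (by ring)
  simp only [smul_eq_mul] at hconv
  refine le_trans (le_of_eq ?_) hconv
  congr 1
  simp only [pathExponent, Finset.mul_sum, ← Finset.sum_add_distrib]
  refine Finset.sum_congr rfl fun k _ => ?_
  ring

end PAM

namespace PAM

/-! ### The heat kernel as a sum over paths -/

/-- The survival function `t ↦ exp (-q t)` on `[0, ∞)`, extended by zero. -/
noncomputable def decay (q t : ℝ) : ℝ≥0∞ :=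
  if 0 ≤ t then ENNReal.ofReal (Real.exp (-(q * t))) else 0

theorem measurable_decay (q : ℝ) : Measurable (decay q) :=
  Measurable.ite measurableSet_Ici (by fun_prop) measurable_const

theorem lconvolution_linear {f g k : ℝ → ℝ≥0∞} (hf : Measurable f) (hg : Measurable g)
    (hk : Measurable k) (A B : ℝ≥0∞) (t : ℝ) :
    (f ⋆ₗ fun t => A * g t + B * k t) t = A * (f ⋆ₗ g) t + B * (f ⋆ₗ k) t := by
  simp only [lconvolution_def]
  rw [← lintegral_const_mul _ (by fun_prop), ← lintegral_const_mul _ (by fun_prop),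
    ← lintegral_add_left (by fun_prop)]
  refine lintegral_congr fun s => ?_
  ring

theorem lconvolution_left_comm {f g k : ℝ → ℝ≥0∞} (hf : Measurable f) (hg : Measurable g)
    (hk : Measurable k) : (f ⋆ₗ (g ⋆ₗ k)) = (g ⋆ₗ (f ⋆ₗ k)) := by
  rw [lconvolution_assoc hf hg hk, lconvolution_comm (f := f) (g := g),
    ← lconvolution_assoc hg hf hk]

theorem lconvolution_eq_zero_of_neg {f g : ℝ → ℝ≥0∞} (hf : ∀ t < 0, f t = 0)
    (hg : ∀ t < 0, g t = 0) {t : ℝ} (ht : t < 0) : (f ⋆ₗ g) t = 0 := by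
  rw [lconvolution_def]
  refine lintegral_eq_zero_of_ae_eq_zero (Eventually.of_forall fun s => ?_)
  rcases lt_or_ge s 0 with hs | hs
  · simp [hf s hs]
  · simp [hg (-s + t) (by linarith)]

section Kernel

variable (A B : ℝ≥0∞) (q : ℤ → ℝ)

/-- The contribution of the paths from `x` to `y` with `k` steps to the heat kernel; steps to the
right have rate `A`, steps to the left have rate `B`. -/
noncomputable def heatSeq : ℕ → ℤ → ℤ → ℝ → ℝ≥0∞
  | 0, x, y => if x = y then decay (q x) else 0
  | k + 1, x, y =>
    decay (q x) ⋆ₗ fun t => A * heatSeq k (x + 1) y t + B * heatSeq k (x - 1) y t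

/-- The heat kernel. -/
noncomputable def heatKernel (x y : ℤ) (t : ℝ) : ℝ≥0∞ := ∑' k, heatSeq A B q k x y t

variable {A B q}

theorem measurable_heatSeq (k : ℕ) (x y : ℤ) : Measurable (heatSeq A B q k x y) := by
  induction k generalizing x y with
  | zero =>
    simp only [heatSeq]
    split_ifs
    · exact measurable_decay _
    · exact measurable_const
  | succ k ih =>
    refine measurable_lconvolution _ (measurable_decay _) ?_
    have h1 := ih (x + 1) y
    have h2 := ih (x - 1) y
    fun_prop

theorem measurable_heatKernel (x y : ℤ) : Measurable (heatKernel A B q x y) :=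
  Measurable.tsum fun k => measurable_heatSeq k x y

theorem heatSeq_of_neg (k : ℕ) (x y : ℤ) {t : ℝ} (ht : t < 0) : heatSeq A B q k x y t = 0 := by
  induction k generalizing x y t with
  | zero => simp only [heatSeq]; split_ifs <;> simp [decay, not_le.mpr ht]
  | succ k ih =>
    refine lconvolution_eq_zero_of_neg (fun s hs => by simp [decay, not_le.mpr hs]) ?_ ht
    intro s hs
    simp [ih _ _ hs]

theorem heatKernel_of_neg (x y : ℤ) {t : ℝ} (ht : t < 0) : heatKernel A B q x y t = 0 := by
  simp [heatKernel, heatSeq_of_neg _ x y ht]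

/-- Decomposition at the last step instead of the first. The holding-time factors can be reordered
because convolution is commutative and associative. -/
theorem heatSeq_succ_dual (k : ℕ) (x y : ℤ) : heatSeq A B q (k + 1) x y =
    decay (q y) ⋆ₗ fun t => A * heatSeq A B q k x (y - 1) t + B * heatSeq A B q k x (y + 1) t := by
  have hd := fun x => measurable_decay (q x)
  have hm := fun k x y => measurable_heatSeq (A := A) (B := B) (q := q) k x y
  induction k generalizing x y with
  | zero =>
    ext t
    have hs : heatSeq A B q 1 x y t = (decay (q x) ⋆ₗ fun t =>
      A * heatSeq A B q 0 (x + 1) y t + B * heatSeq A B q 0 (x - 1) y t) t := rfl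
    rw [hs, lconvolution_linear (hd _) (hm _ _ _) (hm _ _ _),
      lconvolution_linear (hd _) (hm _ _ _) (hm _ _ _)]
    have e1 : (decay (q x) ⋆ₗ heatSeq A B q 0 (x + 1) y) =
        (decay (q y) ⋆ₗ heatSeq A B q 0 x (y - 1)) := by
      by_cases h : x + 1 = y
      · subst h
        simp only [heatSeq, add_sub_cancel_right, if_true]
        exact lconvolution_comm
      · have h' : ¬ x = y - 1 := fun h' => h (by omega)
        simp [heatSeq, h, h']
    have e2 : (decay (q x) ⋆ₗ heatSeq A B q 0 (x - 1) y) =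
        (decay (q y) ⋆ₗ heatSeq A B q 0 x (y + 1)) := by
      by_cases h : x - 1 = y
      · subst h
        simp only [heatSeq, sub_add_cancel, if_true]
        exact lconvolution_comm
      · have h' : ¬ x = y + 1 := fun h' => h (by omega)
        simp [heatSeq, h, h']
    rw [e1, e2]
  | succ k ih =>
    ext t
    have key : ∀ x' : ℤ, (decay (q x) ⋆ₗ heatSeq A B q (k + 1) x' y) =
        fun t => A * (decay (q y) ⋆ₗ (decay (q x) ⋆ₗ heatSeq A B q k x' (y - 1))) t +
          B * (decay (q y) ⋆ₗ (decay (q x) ⋆ₗ heatSeq A B q k x' (y + 1))) t := by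
      intro x'
      ext t
      rw [ih x' y, lconvolution_left_comm (hd _) (hd _) (by
        have h1 := hm k x' (y - 1)
        have h2 := hm k x' (y + 1)
        fun_prop)]
      have : (decay (q x) ⋆ₗ fun t => A * heatSeq A B q k x' (y - 1) t +
          B * heatSeq A B q k x' (y + 1) t) = fun t =>
          A * (decay (q x) ⋆ₗ heatSeq A B q k x' (y - 1)) t +
            B * (decay (q x) ⋆ₗ heatSeq A B q k x' (y + 1)) t :=
        funext fun t => lconvolution_linear (hd _) (hm _ _ _) (hm _ _ _) A B t
      rw [this, lconvolution_linear (hd _) (measurable_lconvolution _ (hd _) (hm _ _ _))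
        (measurable_lconvolution _ (hd _) (hm _ _ _))]
    have hs : heatSeq A B q (k + 1 + 1) x y t = (decay (q x) ⋆ₗ fun t =>
      A * heatSeq A B q (k + 1) (x + 1) y t + B * heatSeq A B q (k + 1) (x - 1) y t) t := rfl
    have hs' : ∀ y', heatSeq A B q (k + 1) x y' = fun t =>
        A * (decay (q x) ⋆ₗ heatSeq A B q k (x + 1) y') t +
          B * (decay (q x) ⋆ₗ heatSeq A B q k (x - 1) y') t := fun y' =>
      funext fun t => lconvolution_linear (hd _) (hm _ _ _) (hm _ _ _) A B t
    have hc := fun x' y' => measurable_lconvolution (volume : Measure ℝ) (hd x) (hm k x' y')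
    rw [hs, lconvolution_linear (hd _) (hm _ _ _) (hm _ _ _), key, key,
      lconvolution_linear (hd _) (hm _ _ _) (hm _ _ _), hs', hs',
      lconvolution_linear (hd _) (hc _ _) (hc _ _), lconvolution_linear (hd _) (hc _ _) (hc _ _)]
    ring

theorem lconvolution_tsum {f : ℝ → ℝ≥0∞} (hf : Measurable f) {ι : Type*} [Countable ι]
    {g k : ι → ℝ → ℝ≥0∞} (hg : ∀ i, Measurable (g i)) (hk : ∀ i, Measurable (k i)) (A B : ℝ≥0∞)
    (t : ℝ) : (f ⋆ₗ fun t => A * (∑' i, g i t) + B * ∑' i, k i t) t =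
      ∑' i, (f ⋆ₗ fun t => A * g i t + B * k i t) t := by
  simp only [lconvolution_def]
  rw [← lintegral_tsum fun i => by fun_prop]
  refine lintegral_congr fun s => ?_
  rw [← ENNReal.tsum_mul_left, ← ENNReal.tsum_mul_left, ← ENNReal.tsum_add, ENNReal.tsum_mul_left]

theorem heatKernel_eq (x y : ℤ) (t : ℝ) : heatKernel A B q x y t =
    (if x = y then decay (q x) t else 0) + (decay (q x) ⋆ₗ fun t =>
      A * heatKernel A B q (x + 1) y t + B * heatKernel A B q (x - 1) y t) t := by
  rw [heatKernel, tsum_eq_zero_add' ENNReal.summable]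
  congr 1
  · simp only [heatSeq]; split_ifs <;> rfl
  · exact (lconvolution_tsum (measurable_decay _) (fun k => measurable_heatSeq k _ _)
      (fun k => measurable_heatSeq k _ _) A B t).symm

theorem heatKernel_eq_dual (x y : ℤ) (t : ℝ) : heatKernel A B q x y t =
    (if x = y then decay (q y) t else 0) + (decay (q y) ⋆ₗ fun t =>
      A * heatKernel A B q x (y - 1) t + B * heatKernel A B q x (y + 1) t) t := by
  rw [heatKernel, tsum_eq_zero_add' ENNReal.summable]
  congr 1
  · by_cases h : x = y
    · subst h; simp [heatSeq]
    · simp [heatSeq, h]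
  · simp_rw [heatSeq_succ_dual]
    exact (lconvolution_tsum (measurable_decay _) (fun k => measurable_heatSeq k _ _)
      (fun k => measurable_heatSeq k _ _) A B t).symm

/-- The total mass of the heat kernel. -/
noncomputable def heatMass (A B : ℝ≥0∞) (q : ℤ → ℝ) (x : ℤ) (t : ℝ) : ℝ≥0∞ :=
  ∑' y, heatKernel A B q x y t

theorem measurable_heatMass (x : ℤ) : Measurable (heatMass A B q x) :=
  Measurable.tsum fun y => measurable_heatKernel x y

theorem heatMass_of_neg (x : ℤ) {t : ℝ} (ht : t < 0) : heatMass A B q x t = 0 := by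
  simp [heatMass, heatKernel_of_neg x _ ht]

theorem heatMass_eq (x : ℤ) (t : ℝ) : heatMass A B q x t = decay (q x) t +
    (decay (q x) ⋆ₗ fun t => A * heatMass A B q (x + 1) t + B * heatMass A B q (x - 1) t) t := by
  simp only [heatMass]
  rw [lconvolution_tsum (measurable_decay _) (fun y => measurable_heatKernel _ _)
    (fun y => measurable_heatKernel _ _)]
  conv_lhs => enter [1, y]; rw [heatKernel_eq]
  rw [ENNReal.tsum_add]
  congr 1
  rw [tsum_eq_single x (fun y hy => by simp [hy.symm])]
  simp

theorem lintegral_Icc_exp {q t : ℝ} (hq : 0 < q) (ht : 0 ≤ t) :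
    ∫⁻ s in Icc 0 t, ENNReal.ofReal (Real.exp (-(q * s))) =
      ENNReal.ofReal ((1 - Real.exp (-(q * t))) / q) := by
  have hc : Continuous fun s : ℝ => Real.exp (-(q * s)) := by fun_prop
  rw [← ofReal_integral_eq_lintegral_ofReal (hc.integrableOn_Icc)
    (Eventually.of_forall fun s => (Real.exp_pos _).le), integral_Icc_eq_integral_Ioc,
    ← intervalIntegral.integral_of_le ht]
  congr 1
  have hd : ∀ s ∈ uIcc 0 t, HasDerivAt (fun s => -Real.exp (-(q * s)) / q) (Real.exp (-(q * s))) s := by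
    intro s _
    have h1 : HasDerivAt (fun s => -(q * s)) (-q) s := by
      simpa using (hasDerivAt_id' s).const_mul (-q)
    convert! (h1.exp.neg.div_const q) using 1
    field_simp
  rw [intervalIntegral.integral_eq_sub_of_hasDerivAt hd (hc.intervalIntegrable _ _)]
  simp
  ring

/-- A site is left at rate `q x ≥ κ` while only the rate `κ` is passed on to the neighbours.
Truncating at `n` steps allows an induction, with `exp (-q t) + κ (1 - exp (-q t)) / q ≤ 1` as its
step. -/
theorem sum_heatSeq_le_one {κ : ℝ} (hκ : 0 < κ) (hAB : A + B = ENNReal.ofReal κ)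
    (hq : ∀ x, κ ≤ q x) (n : ℕ) (x : ℤ) (t : ℝ) :
    ∑' y, ∑ k ∈ Finset.range n, heatSeq A B q k x y t ≤ 1 := by
  induction n generalizing x t with
  | zero => simp
  | succ n ih =>
    rcases lt_or_ge t 0 with ht | ht
    · simp [heatSeq_of_neg _ x _ ht]
    · have hms : ∀ x y, Measurable fun t => ∑ k ∈ Finset.range n, heatSeq A B q k x y t :=
        fun x y => Finset.measurable_sum _ fun k _ => measurable_heatSeq k x y
      have e : ∀ y, ∑ k ∈ Finset.range (n + 1), heatSeq A B q k x y t =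
          (if x = y then decay (q x) t else 0) + (decay (q x) ⋆ₗ fun t =>
            A * (∑ k ∈ Finset.range n, heatSeq A B q k (x + 1) y t) +
            B * (∑ k ∈ Finset.range n, heatSeq A B q k (x - 1) y t)) t := by
        intro y
        rw [Finset.sum_range_succ', add_comm]
        congr 1
        · simp only [heatSeq]; split_ifs <;> rfl
        · simp only [heatSeq, lconvolution_def]
          rw [← lintegral_finsetSum _ fun k _ => ?_]
          · refine lintegral_congr fun s => ?_
            rw [Finset.mul_sum, Finset.mul_sum, ← Finset.sum_add_distrib, Finset.mul_sum]
          · have h0 := measurable_decay (q x)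
            have h1 := measurable_heatSeq (A := A) (B := B) (q := q) k (x + 1) y
            have h2 := measurable_heatSeq (A := A) (B := B) (q := q) k (x - 1) y
            fun_prop
      simp_rw [e]
      rw [ENNReal.tsum_add, tsum_eq_single x (fun y hy => by simp [hy.symm]), if_pos rfl,
        ← lconvolution_tsum (measurable_decay _) (fun y => hms _ y) (fun y => hms _ y)]
      have hqx : 0 < q x := hκ.trans_le (hq x)
      calc decay (q x) t + _ ≤ decay (q x) t +
            ∫⁻ s in Icc 0 t, ENNReal.ofReal κ * ENNReal.ofReal (Real.exp (-(q x * s))) := by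
            gcongr
            rw [lconvolution_def, ← lintegral_indicator measurableSet_Icc]
            refine lintegral_mono fun s => ?_
            rcases lt_or_ge s 0 with hs | hs
            · simp [decay, not_le.mpr hs]
            · rcases lt_or_ge t s with hts | hts
              · have hneg : -s + t < 0 := by linarith
                simp [heatSeq_of_neg _ _ _ hneg]
              · rw [indicator_of_mem (mem_Icc.mpr ⟨hs, hts⟩), decay, if_pos hs, mul_comm, ← hAB]
                gcongr
                · exact mul_le_of_le_one_right (zero_le) (ih _ _)
                · exact mul_le_of_le_one_right (zero_le) (ih _ _)
        _ = ENNReal.ofReal (Real.exp (-(q x * t)) + κ * ((1 - Real.exp (-(q x * t))) / q x)) := by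
            have h1 : Real.exp (-(q x * t)) ≤ 1 := Real.exp_le_one_iff.mpr (by nlinarith)
            rw [lintegral_const_mul _ (by fun_prop), lintegral_Icc_exp hqx ht, decay, if_pos ht,
              ENNReal.ofReal_add (Real.exp_pos _).le, ENNReal.ofReal_mul hκ.le]
            exact mul_nonneg hκ.le (div_nonneg (by linarith) hqx.le)
        _ ≤ 1 := by
            have h1 : Real.exp (-(q x * t)) ≤ 1 := Real.exp_le_one_iff.mpr (by nlinarith)
            rw [ENNReal.ofReal_le_one]
            have : κ * ((1 - Real.exp (-(q x * t))) / q x) ≤ 1 - Real.exp (-(q x * t)) := by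
              rw [← mul_div_assoc, div_le_iff₀ hqx, mul_comm]
              exact mul_le_mul_of_nonneg_left (hq x) (by linarith)
            linarith

theorem heatMass_le_one {κ : ℝ} (hκ : 0 < κ) (hAB : A + B = ENNReal.ofReal κ)
    (hq : ∀ x, κ ≤ q x) (x : ℤ) (t : ℝ) : heatMass A B q x t ≤ 1 := by
  simp only [heatMass, heatKernel]
  rw [ENNReal.tsum_comm, ENNReal.tsum_eq_iSup_nat]
  refine iSup_le fun n => ?_
  refine le_trans (le_of_eq ?_) (sum_heatSeq_le_one hκ hAB hq n x t)
  exact (Summable.tsum_finsetSum fun k _ => ENNReal.summable).symm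

theorem heatKernel_le_one {κ : ℝ} (hκ : 0 < κ) (hAB : A + B = ENNReal.ofReal κ)
    (hq : ∀ x, κ ≤ q x) (x y : ℤ) (t : ℝ) : heatKernel A B q x y t ≤ 1 :=
  (ENNReal.le_tsum y).trans (heatMass_le_one hκ hAB hq x t)

/-! ### Laplace transforms -/

/-- The two-sided Laplace transform. -/
noncomputable def laplaceTransform (β : ℝ) (f : ℝ → ℝ≥0∞) : ℝ≥0∞ :=
  ∫⁻ t, ENNReal.ofReal (Real.exp (β * t)) * f t

theorem laplaceTransform_lconvolution (β : ℝ) {f g : ℝ → ℝ≥0∞} (hf : Measurable f)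
    (hg : Measurable g) :
    laplaceTransform β (f ⋆ₗ g) = laplaceTransform β f * laplaceTransform β g := by
  simp only [laplaceTransform, lconvolution_def]
  have e : ∀ t, ENNReal.ofReal (Real.exp (β * t)) * ∫⁻ s, f s * g (-s + t) =
      ∫⁻ s, (ENNReal.ofReal (Real.exp (β * s)) * f s) *
        (ENNReal.ofReal (Real.exp (β * (-s + t))) * g (-s + t)) := by
    intro t
    rw [← lintegral_const_mul _ (by fun_prop)]
    refine lintegral_congr fun s => ?_
    rw [show β * t = β * s + β * (-s + t) by ring, Real.exp_add,
      ENNReal.ofReal_mul (Real.exp_pos _).le]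
    ring
  simp_rw [e]
  rw [lintegral_lintegral_swap (by fun_prop), ← lintegral_mul_const _ (by fun_prop)]
  refine lintegral_congr fun s => ?_
  rw [lintegral_const_mul _ (by fun_prop)]
  congr 1
  exact lintegral_add_left_eq_self (fun t => ENNReal.ofReal (Real.exp (β * t)) * g t) (-s)

theorem laplaceTransform_decay (β q : ℝ) :
    laplaceTransform β (decay q) = (ENNReal.ofReal (q - β))⁻¹ := by
  rw [laplaceTransform, ← lintegral_Ioi_exp_mul, ← lintegral_indicator measurableSet_Ioi]
  refine lintegral_congr_ae ?_
  have h0 : ∀ᵐ s : ℝ, s ≠ 0 := by simp [ae_iff]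
  filter_upwards [h0] with s hs
  rcases lt_or_gt_of_ne hs with hs | hs
  · simp [decay, not_le.mpr hs, hs.le]
  · rw [indicator_of_mem (mem_Ioi.mpr hs), decay, if_pos hs.le,
      ← ENNReal.ofReal_mul (Real.exp_pos _).le, ← Real.exp_add]
    ring_nf

theorem laplaceTransform_linear (β : ℝ) {f g : ℝ → ℝ≥0∞} (hf : Measurable f)
    (hg : Measurable g) (A B : ℝ≥0∞) : laplaceTransform β (fun t => A * f t + B * g t) =
      A * laplaceTransform β f + B * laplaceTransform β g := by
  simp only [laplaceTransform]
  rw [← lintegral_const_mul _ (by fun_prop), ← lintegral_const_mul _ (by fun_prop),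
    ← lintegral_add_left (by fun_prop)]
  refine lintegral_congr fun t => ?_
  ring

/-- The resolvent equation in the endpoint `y`. It is the recursion of the hitting sums with a
source at `x`, which makes minimality applicable to the resolvent. -/
theorem laplaceTransform_heatKernel (β : ℝ) (x y : ℤ) :
    laplaceTransform β (heatKernel A B q x y) = (ENNReal.ofReal (q y - β))⁻¹ *
      ((if x = y then 1 else 0) + (A * laplaceTransform β (heatKernel A B q x (y - 1)) +
        B * laplaceTransform β (heatKernel A B q x (y + 1)))) := by
  have hm := fun x y => measurable_heatKernel (A := A) (B := B) (q := q) x y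
  have h1 := hm x (y - 1)
  have h2 := hm x (y + 1)
  have hd := measurable_decay (q y)
  have e : heatKernel A B q x y = fun t => (if x = y then 1 else 0) * decay (q y) t +
      1 * (decay (q y) ⋆ₗ fun t => A * heatKernel A B q x (y - 1) t +
        B * heatKernel A B q x (y + 1) t) t := by
    ext t
    rw [heatKernel_eq_dual, one_mul]
    split_ifs <;> simp
  conv_lhs => rw [e]
  rw [laplaceTransform_linear β hd (measurable_lconvolution _ hd (by fun_prop)),
    laplaceTransform_lconvolution β hd (by fun_prop), laplaceTransform_linear β h1 h2,
    laplaceTransform_decay]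
  ring

end Kernel

end PAM

namespace PAM

/-! ### From the mild equation to the differential equation -/

section Mild

variable {q : ℝ} {f : ℝ → ℝ≥0∞}

theorem intervalIntegrable_exp_mul_toReal (hf : Measurable f) {M : ℝ≥0∞} (hM : M ≠ ∞)
    (hfM : ∀ t, f t ≤ M) (s t : ℝ) :
    IntervalIntegrable (fun r => Real.exp (q * r) * (f r).toReal) volume s t := by
  have hb : IntervalIntegrable (fun r => (f r).toReal) volume s t := by
    rw [intervalIntegrable_iff]
    refine Measure.integrableOn_of_bounded (M := M.toReal) (by simp)
      hf.ennreal_toReal.aestronglyMeasurable (Eventually.of_forall fun r => ?_)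
    rw [Real.norm_of_nonneg ENNReal.toReal_nonneg]
    exact ENNReal.toReal_mono hM (hfM r)
  exact hb.continuousOn_mul (by fun_prop)

theorem toReal_mild {g : ℝ} (hg : 0 ≤ g) (hf : Measurable f) {M : ℝ≥0∞} (hM : M ≠ ∞)
    (hfM : ∀ t, f t ≤ M) (hneg : ∀ t < 0, f t = 0) {t : ℝ} (ht : 0 ≤ t) :
    (ENNReal.ofReal g * decay q t + (decay q ⋆ₗ f) t).toReal =
      Real.exp (-(q * t)) * (g + ∫ s in (0 : ℝ)..t, Real.exp (q * s) * (f s).toReal) := by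
  have hft : ∀ t, f t ≠ ∞ := fun t => ne_top_of_le_ne_top hM (hfM t)
  have hint := (intervalIntegrable_exp_mul_toReal (q := q) hf hM hfM 0 t)
  have hint' := (intervalIntegrable_iff_integrableOn_Ioc_of_le ht).mp hint
  have hnn : 0 ≤ ∫ s in (0 : ℝ)..t, Real.exp (q * s) * (f s).toReal :=
    intervalIntegral.integral_nonneg ht fun s _ => mul_nonneg (Real.exp_pos _).le ENNReal.toReal_nonneg
  have hconv : (decay q ⋆ₗ f) t = ENNReal.ofReal (Real.exp (-(q * t)) *
      ∫ s in (0 : ℝ)..t, Real.exp (q * s) * (f s).toReal) := by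
    rw [lconvolution_comm, lconvolution_def, ENNReal.ofReal_mul (Real.exp_pos _).le,
      intervalIntegral.integral_of_le ht, ofReal_integral_eq_lintegral_ofReal hint'
      (Eventually.of_forall fun s => mul_nonneg (Real.exp_pos _).le ENNReal.toReal_nonneg),
      Measure.restrict_congr_set Ioc_ae_eq_Icc, ← lintegral_const_mul _ (by fun_prop),
      ← lintegral_indicator measurableSet_Icc]
    refine lintegral_congr fun s => ?_
    rcases lt_or_ge s 0 with hs | hs
    · simp [hneg s hs, not_le.mpr hs]
    · rcases lt_or_ge t s with hts | hts
      · simp [decay, not_le.mpr hts]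
      · rw [indicator_of_mem (mem_Icc.mpr ⟨hs, hts⟩), decay, if_pos (by linarith),
          ENNReal.ofReal_mul (Real.exp_pos _).le, ENNReal.ofReal_toReal (hft s), ← mul_assoc,
          ← ENNReal.ofReal_mul (Real.exp_pos _).le, ← Real.exp_add, mul_comm]
        ring_nf
  rw [hconv, decay, if_pos ht, ← ENNReal.ofReal_mul hg, ← ENNReal.ofReal_add
    (mul_nonneg hg (Real.exp_pos _).le) (mul_nonneg (Real.exp_pos _).le hnn),
    ENNReal.toReal_ofReal (add_nonneg (mul_nonneg hg (Real.exp_pos _).le)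
      (mul_nonneg (Real.exp_pos _).le hnn))]
  ring

theorem continuousOn_mild {g : ℝ} (hg : 0 ≤ g) (hf : Measurable f) {M : ℝ≥0∞} (hM : M ≠ ∞)
    (hfM : ∀ t, f t ≤ M) (hneg : ∀ t < 0, f t = 0) :
    ContinuousOn (fun t => (ENNReal.ofReal g * decay q t + (decay q ⋆ₗ f) t).toReal) (Ici 0) := by
  have hc : Continuous fun t =>
      Real.exp (-(q * t)) * (g + ∫ s in (0 : ℝ)..t, Real.exp (q * s) * (f s).toReal) := by
    have := intervalIntegral.continuous_primitive
      (fun s t => intervalIntegrable_exp_mul_toReal (q := q) hf hM hfM s t) 0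
    fun_prop
  exact hc.continuousOn.congr fun t ht => toReal_mild hg hf hM hfM hneg ht

theorem hasDerivWithinAt_mild {g : ℝ} (hg : 0 ≤ g) (hf : Measurable f) {M : ℝ≥0∞} (hM : M ≠ ∞)
    (hfM : ∀ t, f t ≤ M) (hneg : ∀ t < 0, f t = 0)
    (hcont : ContinuousOn (fun t => (f t).toReal) (Ici 0)) {t : ℝ} (ht : 0 ≤ t) :
    HasDerivWithinAt (fun t => (ENNReal.ofReal g * decay q t + (decay q ⋆ₗ f) t).toReal)
      ((f t).toReal - q * (ENNReal.ofReal g * decay q t + (decay q ⋆ₗ f) t).toReal) (Ici 0) t := by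
  -- Extending by the value at `0` gives a continuous function on all of `ℝ`, so the two-sided
  -- fundamental theorem of calculus also covers `t = 0`.
  set F : ℝ → ℝ := fun s => (f (max s 0)).toReal with hF
  have hFc : Continuous F := by
    have : Continuous fun s : ℝ => max s 0 := by fun_prop
    exact hcont.comp_continuous this fun s => mem_Ici.mpr (le_max_right _ _)
  have hFf : ∀ s, 0 ≤ s → F s = (f s).toReal := fun s hs => by simp [hF, hs]
  set G : ℝ → ℝ := fun t => Real.exp (-(q * t)) * (g + ∫ s in (0 : ℝ)..t, Real.exp (q * s) * F s) with hG
  have hGv : ∀ t, 0 ≤ t →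
      (ENNReal.ofReal g * decay q t + (decay q ⋆ₗ f) t).toReal = G t := by
    intro t ht
    rw [toReal_mild hg hf hM hfM hneg ht, hG]
    simp only
    congr 2
    refine intervalIntegral.integral_congr fun s hs => ?_
    rw [uIcc_of_le ht] at hs
    simp only [hFf s hs.1]
  have hd : HasDerivAt G (F t - q * G t) t := by
    have h1 : HasDerivAt (fun t => ∫ s in (0 : ℝ)..t, Real.exp (q * s) * F s)
        (Real.exp (q * t) * F t) t :=
      (by fun_prop : Continuous fun s => Real.exp (q * s) * F s).integral_hasStrictDerivAt 0 t
        |>.hasDerivAt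
    have h2 : HasDerivAt (fun t => Real.exp (-(q * t))) (Real.exp (-(q * t)) * -q) t := by
      have : HasDerivAt (fun t => -(q * t)) (-q) t := by
        simpa using (hasDerivAt_id' t).const_mul (-q)
      exact this.exp
    convert! h2.mul (h1.const_add g) using 1
    simp only [hG]
    have : Real.exp (-(q * t)) * Real.exp (q * t) = 1 := by rw [← Real.exp_add]; simp
    linear_combination (-F t) * this
  rw [hGv t ht, ← hFf t ht]
  exact hd.hasDerivWithinAt.congr (fun s hs => hGv s hs) (hGv t ht)

/-- A bounded system of mild equations solves the corresponding differential equations. -/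
theorem hasDerivWithinAt_mild_system {F : ℤ → ℝ → ℝ≥0∞} {q : ℤ → ℝ} {g : ℤ → ℝ} {A B : ℝ≥0∞}
    (hA : A ≠ ∞) (hB : B ≠ ∞) (hF : ∀ z, Measurable (F z)) (hF1 : ∀ z t, F z t ≤ 1)
    (hneg : ∀ z, ∀ t < 0, F z t = 0) (hg : ∀ z, 0 ≤ g z)
    (heq : ∀ z t, F z t = ENNReal.ofReal (g z) * decay (q z) t +
      (decay (q z) ⋆ₗ fun t => A * F (z + 1) t + B * F (z - 1) t) t) :
    (∀ z, (F z 0).toReal = g z) ∧ ∀ t, 0 ≤ t → ∀ z,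
      HasDerivWithinAt (fun t => (F z t).toReal) (A.toReal * (F (z + 1) t).toReal +
        B.toReal * (F (z - 1) t).toReal - q z * (F z t).toReal) (Ici 0) t := by
  have hFt : ∀ z t, F z t ≠ ∞ := fun z t => ne_top_of_le_ne_top ENNReal.one_ne_top (hF1 z t)
  have hm : ∀ z, Measurable fun t => A * F (z + 1) t + B * F (z - 1) t := fun z => by
    have h1 := hF (z + 1)
    have h2 := hF (z - 1)
    fun_prop
  have hb : ∀ z t, A * F (z + 1) t + B * F (z - 1) t ≤ A + B := fun z t => by
    gcongr
    · exact mul_le_of_le_one_right zero_le (hF1 _ _)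
    · exact mul_le_of_le_one_right zero_le (hF1 _ _)
  have hn : ∀ z, ∀ t < 0, A * F (z + 1) t + B * F (z - 1) t = 0 := fun z t ht => by
    simp [hneg _ t ht]
  have hAB : A + B ≠ ∞ := ENNReal.add_ne_top.mpr ⟨hA, hB⟩
  have hfun : ∀ z, (fun t => (F z t).toReal) = fun t => (ENNReal.ofReal (g z) * decay (q z) t +
      (decay (q z) ⋆ₗ fun t => A * F (z + 1) t + B * F (z - 1) t) t).toReal := fun z => by
    ext t; rw [← heq]
  have hc : ∀ z, ContinuousOn (fun t => (F z t).toReal) (Ici 0) := fun z => by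
    rw [hfun z]
    exact continuousOn_mild (hg z) (hm z) hAB (hb z) (hn z)
  have hre : ∀ z t, (A * F (z + 1) t + B * F (z - 1) t).toReal =
      A.toReal * (F (z + 1) t).toReal + B.toReal * (F (z - 1) t).toReal := fun z t => by
    rw [ENNReal.toReal_add (ENNReal.mul_ne_top hA (hFt _ _)) (ENNReal.mul_ne_top hB (hFt _ _)),
      ENNReal.toReal_mul, ENNReal.toReal_mul]
  constructor
  · intro z
    rw [heq, toReal_mild (hg z) (hm z) hAB (hb z) (hn z) le_rfl]
    simp
  · intro t ht z
    have h := hasDerivWithinAt_mild (q := q z) (hg z) (hm z) hAB (hb z) (hn z) (by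
      simp only [hre]
      exact ((hc _).const_smul A.toReal).add ((hc _).const_smul B.toReal)) ht
    rw [← hfun, hre, ← heq] at h
    exact h

end Mild

/-! ### Heat flows with a potential -/

/-- Bounded non-negative solutions with general initial datum. -/
structure IsHeatFlow (κ h : ℝ) (ζ : ℤ → ℝ) (g : ℤ → ℝ) (u : ℝ → ℤ → ℝ) : Prop where
  initial : ∀ x, u 0 x = g x
  equation : ∀ t, 0 ≤ t → ∀ x,
    HasDerivWithinAt (fun s => u s x) (κ * driftLaplacian h (u t) x + ζ x * u t x) (Ici 0) t
  nonneg : ∀ t, 0 ≤ t → ∀ x, 0 ≤ u t x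
  bounded : ∃ C : ℝ, ∀ t, 0 ≤ t → ∀ x, u t x ≤ C

theorem isSolution_iff_isHeatFlow {κ h : ℝ} {ζ : ℤ → ℝ} {u : ℝ → ℤ → ℝ} :
    IsSolution κ h ζ u ↔ IsHeatFlow κ h ζ (fun _ => 1) u :=
  ⟨fun H => ⟨H.1, H.2, H.3, H.4⟩, fun H => ⟨H.1, H.2, H.3, H.4⟩⟩

/-- The heat kernel of the walk with generator `κ Δ_h` in the potential `ζ`. -/
noncomputable def kernelENN (κ h : ℝ) (ζ : ℤ → ℝ) (x y : ℤ) (t : ℝ) : ℝ≥0∞ :=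
  heatKernel (ENNReal.ofReal κ * stepLeft h) (ENNReal.ofReal κ * stepRight h)
    (fun x => κ - ζ x) x y t

/-- The real-valued heat kernel. -/
noncomputable def kernel (κ h : ℝ) (ζ : ℤ → ℝ) (x y : ℤ) (t : ℝ) : ℝ :=
  (kernelENN κ h ζ x y t).toReal

/-- The total mass of the heat kernel. -/
noncomputable def kernelMass (κ h : ℝ) (ζ : ℤ → ℝ) (x : ℤ) (t : ℝ) : ℝ :=
  (heatMass (ENNReal.ofReal κ * stepLeft h) (ENNReal.ofReal κ * stepRight h)
    (fun x => κ - ζ x) x t).toReal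

section Flow

variable {κ h : ℝ} {ζ : ℤ → ℝ}

theorem rate_add_rate (hh : h ∈ Ioc (0 : ℝ) 1) :
    ENNReal.ofReal κ * stepLeft h + ENNReal.ofReal κ * stepRight h = ENNReal.ofReal κ := by
  rw [← mul_add, stepLeft_add_stepRight hh, mul_one]

theorem kernelENN_le_one (hκ : 0 < κ) (hh : h ∈ Ioc (0 : ℝ) 1) (hζ : ∀ x, ζ x ≤ 0) (x y : ℤ)
    (t : ℝ) : kernelENN κ h ζ x y t ≤ 1 :=
  heatKernel_le_one hκ (rate_add_rate hh) (fun x => by linarith [hζ x]) x y t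

theorem ofReal_kernel (hκ : 0 < κ) (hh : h ∈ Ioc (0 : ℝ) 1) (hζ : ∀ x, ζ x ≤ 0) (x y : ℤ)
    (t : ℝ) : ENNReal.ofReal (kernel κ h ζ x y t) = kernelENN κ h ζ x y t :=
  ENNReal.ofReal_toReal (ne_top_of_le_ne_top ENNReal.one_ne_top (kernelENN_le_one hκ hh hζ x y t))

theorem kernel_nonneg (x y : ℤ) (t : ℝ) : 0 ≤ kernel κ h ζ x y t := ENNReal.toReal_nonneg

theorem kernel_le_one (hκ : 0 < κ) (hh : h ∈ Ioc (0 : ℝ) 1) (hζ : ∀ x, ζ x ≤ 0) (x y : ℤ)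
    (t : ℝ) : kernel κ h ζ x y t ≤ 1 := by
  simpa [kernel] using ENNReal.toReal_mono ENNReal.one_ne_top (kernelENN_le_one hκ hh hζ x y t)

theorem toReal_stepLeft (hh : h ∈ Ioc (0 : ℝ) 1) : (stepLeft h).toReal = (1 + h) / 2 :=
  ENNReal.toReal_ofReal (by linarith [hh.1])

theorem toReal_stepRight (hh : h ∈ Ioc (0 : ℝ) 1) : (stepRight h).toReal = (1 - h) / 2 :=
  ENNReal.toReal_ofReal (by linarith [hh.2])

theorem isHeatFlow_kernel (hκ : 0 < κ) (hh : h ∈ Ioc (0 : ℝ) 1) (hζ : ∀ x, ζ x ≤ 0) (y : ℤ) :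
    IsHeatFlow κ h ζ (fun x => if x = y then 1 else 0) (fun t x => kernel κ h ζ x y t) := by
  have H := hasDerivWithinAt_mild_system (F := fun x => kernelENN κ h ζ x y)
    (q := fun x => κ - ζ x) (g := fun x => if x = y then 1 else 0)
    (A := ENNReal.ofReal κ * stepLeft h) (B := ENNReal.ofReal κ * stepRight h)
    (ENNReal.mul_ne_top ENNReal.ofReal_ne_top ENNReal.ofReal_ne_top)
    (ENNReal.mul_ne_top ENNReal.ofReal_ne_top ENNReal.ofReal_ne_top)
    (fun x => measurable_heatKernel x y) (fun x t => kernelENN_le_one hκ hh hζ x y t)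
    (fun x t ht => heatKernel_of_neg x y ht) (fun x => by positivity) (fun x t => by
      simp only [kernelENN]
      rw [heatKernel_eq]
      split_ifs <;> simp)
  refine ⟨H.1, fun t ht x => ?_, fun t _ x => kernel_nonneg x y t,
    1, fun t _ x => kernel_le_one hκ hh hζ x y t⟩
  have h2 := H.2 t ht x
  simp only [ENNReal.toReal_mul, ENNReal.toReal_ofReal hκ.le, toReal_stepLeft hh,
    toReal_stepRight hh] at h2
  convert! h2 using 1
  simp only [kernel, driftLaplacian]
  ring

/-- The forward equation: in the endpoint the two rates are exchanged, so the drift becomes `-h`. -/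
theorem isHeatFlow_kernel_dual (hκ : 0 < κ) (hh : h ∈ Ioc (0 : ℝ) 1) (hζ : ∀ x, ζ x ≤ 0)
    (x : ℤ) :
    IsHeatFlow κ (-h) ζ (fun y => if y = x then 1 else 0) (fun t y => kernel κ h ζ x y t) := by
  have H := hasDerivWithinAt_mild_system (F := fun y => kernelENN κ h ζ x y)
    (q := fun x => κ - ζ x) (g := fun y => if y = x then 1 else 0)
    (A := ENNReal.ofReal κ * stepRight h) (B := ENNReal.ofReal κ * stepLeft h)
    (ENNReal.mul_ne_top ENNReal.ofReal_ne_top ENNReal.ofReal_ne_top)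
    (ENNReal.mul_ne_top ENNReal.ofReal_ne_top ENNReal.ofReal_ne_top)
    (fun y => measurable_heatKernel x y) (fun y t => kernelENN_le_one hκ hh hζ x y t)
    (fun y t ht => heatKernel_of_neg x y ht) (fun y => by positivity) (fun y t => by
      simp only [kernelENN]
      rw [heatKernel_eq_dual]
      congr 1
      · by_cases h : x = y
        · simp [h]
        · simp [h, Ne.symm h]
      · congr 1
        ext s
        rw [add_comm])
  refine ⟨H.1, fun t ht y => ?_, fun t _ y => kernel_nonneg x y t,
    1, fun t _ y => kernel_le_one hκ hh hζ x y t⟩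
  have h2 := H.2 t ht y
  simp only [ENNReal.toReal_mul, ENNReal.toReal_ofReal hκ.le, toReal_stepLeft hh,
    toReal_stepRight hh] at h2
  convert! h2 using 1
  simp only [kernel, driftLaplacian]
  ring

theorem isHeatFlow_kernelMass (hκ : 0 < κ) (hh : h ∈ Ioc (0 : ℝ) 1) (hζ : ∀ x, ζ x ≤ 0) :
    IsHeatFlow κ h ζ (fun _ => 1) (fun t x => kernelMass κ h ζ x t) := by
  have hle := fun x t => heatMass_le_one hκ (rate_add_rate (κ := κ) hh)
    (q := fun x => κ - ζ x) (fun x => by linarith [hζ x]) x t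
  have H := hasDerivWithinAt_mild_system (F := heatMass (ENNReal.ofReal κ * stepLeft h)
      (ENNReal.ofReal κ * stepRight h) (fun x => κ - ζ x))
    (q := fun x => κ - ζ x) (g := fun x => 1)
    (A := ENNReal.ofReal κ * stepLeft h) (B := ENNReal.ofReal κ * stepRight h)
    (ENNReal.mul_ne_top ENNReal.ofReal_ne_top ENNReal.ofReal_ne_top)
    (ENNReal.mul_ne_top ENNReal.ofReal_ne_top ENNReal.ofReal_ne_top)
    (fun x => measurable_heatMass x) hle
    (fun x t ht => heatMass_of_neg x ht) (fun x => by positivity) (fun x t => by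
      rw [heatMass_eq]; simp)
  refine ⟨H.1, fun t ht x => ?_, fun t _ x => ENNReal.toReal_nonneg,
    1, fun t _ x => ?_⟩
  · have h2 := H.2 t ht x
    simp only [ENNReal.toReal_mul, ENNReal.toReal_ofReal hκ.le, toReal_stepLeft hh,
      toReal_stepRight hh] at h2
    convert! h2 using 1
    simp only [kernelMass, driftLaplacian]
    ring
  · simpa [kernelMass] using ENNReal.toReal_mono ENNReal.one_ne_top (hle x t)

theorem hasSum_kernel (hκ : 0 < κ) (hh : h ∈ Ioc (0 : ℝ) 1) (hζ : ∀ x, ζ x ≤ 0) (x : ℤ) (t : ℝ) :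
    HasSum (fun y => kernel κ h ζ x y t) (kernelMass κ h ζ x t) := by
  have hle := heatMass_le_one hκ (rate_add_rate (κ := κ) hh)
    (q := fun x => κ - ζ x) (fun x => by linarith [hζ x]) x t
  have hne := ne_top_of_le_ne_top ENNReal.one_ne_top hle
  have h1 := ENNReal.hasSum_toReal hne
  rw [← ENNReal.tsum_toReal_eq fun y => ENNReal.ne_top_of_tsum_ne_top hne y] at h1
  exact h1

/-! ### The comparison principle -/

/-- A solution of the heat equation with non-negative initial datum is bounded below by a
multiple of the tail of an exponential series. -/
theorem comparison_aux (hκ : 0 ≤ κ) (hh : h ∈ Icc (-1 : ℝ) 1) (hζ : ∀ x, ζ x ≤ 0)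
    {w D : ℝ → ℤ → ℝ} {C : ℝ} (hC : 0 ≤ C)
    (hd : ∀ t, 0 ≤ t → ∀ x, HasDerivWithinAt (fun s => w s x) (D t x) (Ici 0) t)
    (hD : ∀ t, 0 ≤ t → ∀ x, κ * driftLaplacian h (w t) x + ζ x * w t x ≤ D t x)
    (hwC : ∀ t, 0 ≤ t → ∀ x, -C ≤ w t x) (h0 : ∀ x, 0 ≤ w 0 x) (n : ℕ) :
    ∀ t, 0 ≤ t → ∀ x, -(C * ((κ * t) ^ n / n.factorial)) ≤ w t x := by
  induction n with
  | zero => simpa using hwC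
  | succ n ih =>
    intro t ht x
    set r : ℝ → ℝ := fun s => C * ((κ * s) ^ (n + 1) / (n + 1).factorial) with hr
    -- The integrating factor removes the diagonal term, so no lower bound on the potential is
    -- needed. The derivative of `r` is `κ` times the previous bound, which compensates the worst
    -- contribution of the neighbours.
    set z : ℝ → ℝ := fun s => Real.exp ((κ - ζ x) * s) * (w s x + r s) with hz
    have hrd : ∀ s, HasDerivAt r (κ * (C * ((κ * s) ^ n / n.factorial))) s := by
      intro s
      have h1 : HasDerivAt (fun s => κ * s) κ s := by simpa using (hasDerivAt_id' s).const_mul κ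
      convert! ((h1.pow (n + 1)).div_const ((n + 1).factorial : ℝ)).const_mul C using 1
      rw [Nat.factorial_succ]
      push_cast
      have : (n.factorial : ℝ) ≠ 0 := by positivity
      field_simp
    have hzd : ∀ s, 0 ≤ s → HasDerivWithinAt z (Real.exp ((κ - ζ x) * s) * (κ - ζ x) * (w s x + r s) +
        Real.exp ((κ - ζ x) * s) * (D s x + κ * (C * ((κ * s) ^ n / n.factorial)))) (Ici 0) s := by
      intro s hs
      have h1 : HasDerivAt (fun s => Real.exp ((κ - ζ x) * s))
          (Real.exp ((κ - ζ x) * s) * (κ - ζ x)) s := by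
        have : HasDerivAt (fun s => (κ - ζ x) * s) (κ - ζ x) s := by
          simpa using (hasDerivAt_id' s).const_mul (κ - ζ x)
        exact this.exp
      exact h1.hasDerivWithinAt.mul ((hd s hs x).add (hrd s).hasDerivWithinAt)
    have hmono : MonotoneOn z (Ici 0) := by
      refine monotoneOn_of_hasDerivWithinAt_nonneg (convex_Ici 0)
        (fun s hs => (hzd s hs).continuousWithinAt)
        (fun s hs => (hzd s (interior_subset hs)).mono interior_subset) fun s hs => ?_
      have hs0 : 0 ≤ s := interior_subset hs
      rw [mul_assoc, ← mul_add]
      refine mul_nonneg (Real.exp_pos _).le ?_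
      have h1 := hD s hs0 x
      have h2 := ih s hs0 (x + 1)
      have h3 := ih s hs0 (x - 1)
      set ρ := C * ((κ * s) ^ n / n.factorial)
      have hr0 : 0 ≤ r s := by simp only [hr]; positivity
      have h4 : 0 ≤ (κ - ζ x) * r s := mul_nonneg (by linarith [hζ x]) hr0
      have h5 : 0 ≤ κ * ((1 + h) / 2 * (w s (x + 1) + ρ)) :=
        mul_nonneg hκ (mul_nonneg (by linarith [hh.1]) (by linarith))
      have h6 : 0 ≤ κ * ((1 - h) / 2 * (w s (x - 1) + ρ)) :=
        mul_nonneg hκ (mul_nonneg (by linarith [hh.2]) (by linarith))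
      simp only [driftLaplacian] at h1
      nlinarith
    have h1 : z 0 ≤ z t := hmono (mem_Ici.mpr le_rfl) (mem_Ici.mpr ht) ht
    have h2 : z 0 = w 0 x := by simp [hz, hr]
    have h3 : 0 ≤ z t := by rw [h2] at h1; exact (h0 x).trans h1
    have h4 : 0 ≤ w t x + r t := by
      by_contra hcon
      push Not at hcon
      exact absurd h3 (not_le.mpr (mul_neg_of_pos_of_neg (Real.exp_pos _) hcon))
    simp only [hr] at h4
    linarith

/-- The comparison principle. -/
theorem comparison (hκ : 0 ≤ κ) (hh : h ∈ Icc (-1 : ℝ) 1) (hζ : ∀ x, ζ x ≤ 0)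
    {w D : ℝ → ℤ → ℝ} {C : ℝ}
    (hd : ∀ t, 0 ≤ t → ∀ x, HasDerivWithinAt (fun s => w s x) (D t x) (Ici 0) t)
    (hD : ∀ t, 0 ≤ t → ∀ x, κ * driftLaplacian h (w t) x + ζ x * w t x ≤ D t x)
    (hwC : ∀ t, 0 ≤ t → ∀ x, -C ≤ w t x) (h0 : ∀ x, 0 ≤ w 0 x) :
    ∀ t, 0 ≤ t → ∀ x, 0 ≤ w t x := by
  intro t ht x
  have h1 := fun n => comparison_aux hκ hh hζ (abs_nonneg C) hd hD
    (fun t ht x => (neg_le_neg (le_abs_self C)).trans (hwC t ht x)) h0 n t ht x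
  -- The bound of `comparison_aux` holds for all `n` and vanishes in the limit.
  have h2 : Tendsto (fun n : ℕ => -(|C| * ((κ * t) ^ n / n.factorial))) atTop (𝓝 0) := by
    simpa using ((FloorSemiring.tendsto_pow_div_factorial_atTop (κ * t)).const_mul |C|).neg
  exact le_of_tendsto' h2 h1

theorem driftLaplacian_sub (f g : ℤ → ℝ) (x : ℤ) :
    driftLaplacian h (fun y => f y - g y) x = driftLaplacian h f x - driftLaplacian h g x := by
  simp only [driftLaplacian]; ring

theorem driftLaplacian_const_mul (c : ℝ) (f : ℤ → ℝ) (x : ℤ) :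
    driftLaplacian h (fun y => c * f y) x = c * driftLaplacian h f x := by
  simp only [driftLaplacian]; ring

/-- Comparison of two solutions with ordered initial data. -/
theorem IsHeatFlow.mono (hκ : 0 ≤ κ) (hh : h ∈ Icc (-1 : ℝ) 1) (hζ : ∀ x, ζ x ≤ 0)
    {f g : ℤ → ℝ} {u v : ℝ → ℤ → ℝ} (hu : IsHeatFlow κ h ζ f u) (hv : IsHeatFlow κ h ζ g v)
    (hfg : ∀ x, f x ≤ g x) {t : ℝ} (ht : 0 ≤ t) (x : ℤ) : u t x ≤ v t x := by
  obtain ⟨C, hC⟩ := hu.bounded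
  have := comparison (w := fun t x => v t x - u t x) (C := C) hκ hh hζ
    (fun t ht x => (hv.equation t ht x).sub (hu.equation t ht x))
    (fun t ht x => le_of_eq (by rw [driftLaplacian_sub]; ring))
    (fun t ht x => by linarith [hC t ht x, hv.nonneg t ht x])
    (fun x => by rw [hu.initial, hv.initial]; linarith [hfg x]) t ht x
  linarith

theorem IsHeatFlow.const_mul {g : ℤ → ℝ} {u : ℝ → ℤ → ℝ} (hu : IsHeatFlow κ h ζ g u) {c : ℝ}
    (hc : 0 ≤ c) : IsHeatFlow κ h ζ (fun x => c * g x) (fun t x => c * u t x) where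
  initial x := by rw [hu.initial]
  equation t ht x := by
    rw [driftLaplacian_const_mul]
    convert! (hu.equation t ht x).const_mul c using 1
    ring
  nonneg t ht x := mul_nonneg hc (hu.nonneg t ht x)
  bounded := by
    obtain ⟨C, hC⟩ := hu.bounded
    exact ⟨c * C, fun t ht x => mul_le_mul_of_nonneg_left (hC t ht x) hc⟩

theorem IsHeatFlow.shift_time {g : ℤ → ℝ} {u : ℝ → ℤ → ℝ} (hu : IsHeatFlow κ h ζ g u) {s : ℝ}
    (hs : 0 ≤ s) : IsHeatFlow κ h ζ (u s) (fun t x => u (t + s) x) where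
  initial x := by rw [zero_add]
  equation t ht x := by
    have h1 := hu.equation (t + s) (by linarith) x
    have h2 : HasDerivWithinAt (fun t : ℝ => t + s) 1 (Ici 0) t :=
      ((hasDerivAt_id' t).add_const s).hasDerivWithinAt
    have h3 := h1.scomp (h := fun t : ℝ => t + s) t h2 (fun r hr => by
      have : (0 : ℝ) ≤ r := hr
      exact mem_Ici.mpr (by linarith))
    simpa [Function.comp_def] using h3
  nonneg t ht x := hu.nonneg (t + s) (by linarith) x
  bounded := by
    obtain ⟨C, hC⟩ := hu.bounded
    exact ⟨C, fun t ht x => hC (t + s) (by linarith) x⟩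

theorem IsHeatFlow.unique (hκ : 0 ≤ κ) (hh : h ∈ Icc (-1 : ℝ) 1) (hζ : ∀ x, ζ x ≤ 0)
    {g : ℤ → ℝ} {u v : ℝ → ℤ → ℝ} (hu : IsHeatFlow κ h ζ g u) (hv : IsHeatFlow κ h ζ g v)
    {t : ℝ} (ht : 0 ≤ t) (x : ℤ) : u t x = v t x :=
  le_antisymm (hu.mono hκ hh hζ hv (fun _ => le_rfl) ht x)
    (hv.mono hκ hh hζ hu (fun _ => le_rfl) ht x)

/-- An exponentially decaying supersolution dominates a solution. -/
theorem IsHeatFlow.le_exp_mul (hκ : 0 ≤ κ) (hh : h ∈ Icc (-1 : ℝ) 1) (hζ : ∀ x, ζ x ≤ 0)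
    {g : ℤ → ℝ} {u : ℝ → ℤ → ℝ} (hu : IsHeatFlow κ h ζ g u) {H : ℤ → ℝ} {β : ℝ}
    (hH0 : ∀ x, 0 ≤ H x) (hH : ∀ x, κ * driftLaplacian h H x + (ζ x + β) * H x ≤ 0)
    (hgH : ∀ x, g x ≤ H x) {t : ℝ} (ht : 0 ≤ t) (x : ℤ) : u t x ≤ Real.exp (-(β * t)) * H x := by
  obtain ⟨C, hC⟩ := hu.bounded
  have hexp : ∀ s : ℝ, HasDerivAt (fun s => Real.exp (-(β * s))) (Real.exp (-(β * s)) * -β) s := by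
    intro s
    have : HasDerivAt (fun s => -(β * s)) (-β) s := by
      simpa using (hasDerivAt_id' s).const_mul (-β)
    exact this.exp
  have := comparison (w := fun t x => Real.exp (-(β * t)) * H x - u t x) (C := C) hκ hh hζ
    (fun t ht x => ((hexp t).hasDerivWithinAt.mul_const (H x)).sub (hu.equation t ht x))
    (fun t ht x => by
      rw [driftLaplacian_sub, driftLaplacian_const_mul]
      have := mul_nonneg (Real.exp_pos (-(β * t))).le (neg_nonneg.mpr (hH x))
      nlinarith)
    (fun t ht x => by
      have := mul_nonneg (Real.exp_pos (-(β * t))).le (hH0 x)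
      linarith [hC t ht x])
    (fun x => by rw [hu.initial]; simpa using hgH x) t ht x
  linarith

theorem IsHeatFlow.monotoneOn_exp_mul {g : ℤ → ℝ} {u : ℝ → ℤ → ℝ} (hκ : 0 ≤ κ)
    (hh : h ∈ Icc (-1 : ℝ) 1) (hu : IsHeatFlow κ h ζ g u)
    (x : ℤ) : MonotoneOn (fun t => Real.exp ((κ - ζ x) * t) * u t x) (Ici 0) ∧
      ∀ s, 0 ≤ s → HasDerivWithinAt (fun t => Real.exp ((κ - ζ x) * t) * u t x)
        (Real.exp ((κ - ζ x) * s) * (κ * ((1 + h) / 2 * u s (x + 1) + (1 - h) / 2 * u s (x - 1))))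
        (Ici 0) s := by
  have hd : ∀ s, 0 ≤ s → HasDerivWithinAt (fun t => Real.exp ((κ - ζ x) * t) * u t x)
        (Real.exp ((κ - ζ x) * s) * (κ * ((1 + h) / 2 * u s (x + 1) + (1 - h) / 2 * u s (x - 1))))
        (Ici 0) s := by
    intro s hs
    have h1 : HasDerivAt (fun s => Real.exp ((κ - ζ x) * s))
        (Real.exp ((κ - ζ x) * s) * (κ - ζ x)) s := by
      have : HasDerivAt (fun s => (κ - ζ x) * s) (κ - ζ x) s := by
        simpa using (hasDerivAt_id' s).const_mul (κ - ζ x)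
      exact this.exp
    convert! h1.hasDerivWithinAt.mul (hu.equation s hs x) using 1
    simp only [driftLaplacian]
    ring
  refine ⟨monotoneOn_of_hasDerivWithinAt_nonneg (convex_Ici 0)
    (fun s hs => (hd s hs).continuousWithinAt)
    (fun s hs => (hd s (interior_subset hs)).mono interior_subset) fun s hs => ?_, hd⟩
  have hs0 : 0 ≤ s := interior_subset hs
  have h1 := hu.nonneg s hs0 (x + 1)
  have h2 := hu.nonneg s hs0 (x - 1)
  have h3 : 0 ≤ (1 + h) / 2 := by linarith [hh.1]
  have h4 : 0 ≤ (1 - h) / 2 := by linarith [hh.2]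
  positivity

theorem IsHeatFlow.exp_mul_initial_le {g : ℤ → ℝ} {u : ℝ → ℤ → ℝ} (hκ : 0 ≤ κ)
    (hh : h ∈ Icc (-1 : ℝ) 1) (hu : IsHeatFlow κ h ζ g u) {t : ℝ} (ht : 0 ≤ t) (x : ℤ) :
    Real.exp (-((κ - ζ x) * t)) * g x ≤ u t x := by
  have h1 := (hu.monotoneOn_exp_mul hκ hh x).1 (mem_Ici.mpr le_rfl) (mem_Ici.mpr ht) ht
  simp only [mul_zero, Real.exp_zero, one_mul, hu.initial] at h1
  have h2 := mul_le_mul_of_nonneg_left h1 (Real.exp_pos (-((κ - ζ x) * t))).le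
  rwa [← mul_assoc, ← Real.exp_add, neg_add_cancel, Real.exp_zero, one_mul] at h2

/-- Positivity propagates to the left neighbour when the walk may step to the right. -/
theorem IsHeatFlow.pos_of_pos_right {g : ℤ → ℝ} {u : ℝ → ℤ → ℝ} (hκ : 0 < κ)
    (hh : h ∈ Icc (-1 : ℝ) 1) (hh' : -1 < h) (hu : IsHeatFlow κ h ζ g u) {x : ℤ}
    (hpos : ∀ t, 0 < t → 0 < u t (x + 1)) {t : ℝ} (ht : 0 < t) : 0 < u t x := by
  have hd := (hu.monotoneOn_exp_mul hκ.le hh x).2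
  have hs : StrictMonoOn (fun t => Real.exp ((κ - ζ x) * t) * u t x) (Ici 0) := by
    refine strictMonoOn_of_hasDerivWithinAt_pos (convex_Ici 0)
      (fun s hs => (hd s hs).continuousWithinAt)
      (fun s hs => (hd s (interior_subset hs)).mono interior_subset) fun s hs => ?_
    rw [interior_Ici] at hs
    have hs0 : 0 < s := hs
    have h1 := hpos s hs0
    have h2 := hu.nonneg s hs0.le (x - 1)
    have h3 : 0 < (1 + h) / 2 := by linarith
    have h4 : 0 ≤ (1 - h) / 2 := by linarith [hh.2]
    positivity
  have h1 := hs (mem_Ici.mpr le_rfl) (mem_Ici.mpr ht.le) ht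
  have h2 := hu.nonneg 0 le_rfl x
  simp only [mul_zero, Real.exp_zero, one_mul] at h1
  exact pos_of_mul_pos_right (h2.trans_lt h1) (Real.exp_pos _).le

/-- Only targets to the right of the start are considered, because for `h = 1` the walk never steps
to the left. -/
theorem kernel_pos (hκ : 0 < κ) (hh : h ∈ Ioc (0 : ℝ) 1) (hζ : ∀ x, ζ x ≤ 0) (x : ℤ) (n : ℕ)
    {t : ℝ} (ht : 0 < t) : 0 < kernel κ h ζ (x - n) x t := by
  have hh' : h ∈ Icc (-1 : ℝ) 1 := ⟨by linarith [hh.1], hh.2⟩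
  have hf := isHeatFlow_kernel hκ hh hζ x
  induction n generalizing t with
  | zero =>
    have := hf.exp_mul_initial_le hκ.le hh' ht.le x
    simp only [if_true, mul_one] at this
    simpa using (Real.exp_pos _).trans_le this
  | succ n ih =>
    refine hf.pos_of_pos_right hκ hh' (by linarith [hh.1]) (x := x - (n + 1 : ℕ)) (fun s hs => ?_) ht
    have := ih hs
    push_cast
    rwa [show x - ((n : ℤ) + 1) + 1 = x - n by ring]

/-- A solution restarted at time `s` dominates the flow of a single mass. -/
theorem IsHeatFlow.mul_kernel_le (hκ : 0 < κ) (hh : h ∈ Ioc (0 : ℝ) 1) (hζ : ∀ x, ζ x ≤ 0)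
    {g : ℤ → ℝ} {u : ℝ → ℤ → ℝ} (hu : IsHeatFlow κ h ζ g u) {s t : ℝ} (hs : 0 ≤ s) (ht : 0 ≤ t)
    (x y : ℤ) : kernel κ h ζ x y t * u s y ≤ u (t + s) x := by
  have hh' : h ∈ Icc (-1 : ℝ) 1 := ⟨by linarith [hh.1], hh.2⟩
  have h1 := (isHeatFlow_kernel hκ hh hζ y).const_mul (hu.nonneg s hs y)
  have h2 := h1.mono hκ.le hh' hζ (hu.shift_time hs) (fun z => by
    by_cases hz : z = y
    · simp [hz]
    · simpa [hz] using hu.nonneg s hs z) ht x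
  rw [mul_comm]
  exact h2

theorem kernelMass_le_one (hκ : 0 < κ) (hh : h ∈ Ioc (0 : ℝ) 1) (hζ : ∀ x, ζ x ≤ 0) (x : ℤ)
    (t : ℝ) : kernelMass κ h ζ x t ≤ 1 := by
  have hle := heatMass_le_one hκ (rate_add_rate (κ := κ) hh)
    (q := fun x => κ - ζ x) (fun x => by linarith [hζ x]) x t
  simpa [kernelMass] using ENNReal.toReal_mono ENNReal.one_ne_top hle

theorem kernelMass_antitone (hκ : 0 < κ) (hh : h ∈ Ioc (0 : ℝ) 1) (hζ : ∀ x, ζ x ≤ 0) (x : ℤ)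
    {s t : ℝ} (hs : 0 ≤ s) (hst : s ≤ t) : kernelMass κ h ζ x t ≤ kernelMass κ h ζ x s := by
  have hh' : h ∈ Icc (-1 : ℝ) 1 := ⟨by linarith [hh.1], hh.2⟩
  have hf := isHeatFlow_kernelMass hκ hh hζ
  have := (hf.shift_time (sub_nonneg.mpr hst)).mono hκ.le hh' hζ hf
    (fun z => kernelMass_le_one hκ hh hζ z _) hs x
  simpa using this

theorem kernelMass_pos (hκ : 0 < κ) (hh : h ∈ Ioc (0 : ℝ) 1) (hζ : ∀ x, ζ x ≤ 0) (x : ℤ)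
    {t : ℝ} (ht : 0 ≤ t) : 0 < kernelMass κ h ζ x t := by
  have hh' : h ∈ Icc (-1 : ℝ) 1 := ⟨by linarith [hh.1], hh.2⟩
  have := (isHeatFlow_kernelMass hκ hh hζ).exp_mul_initial_le hκ.le hh' ht x
  simp only [mul_one] at this
  exact (Real.exp_pos _).trans_le this

theorem kernel_le_kernelMass (hκ : 0 < κ) (hh : h ∈ Ioc (0 : ℝ) 1) (hζ : ∀ x, ζ x ≤ 0) (x y : ℤ)
    (t : ℝ) : kernel κ h ζ x y t ≤ kernelMass κ h ζ x t :=
  le_hasSum (hasSum_kernel hκ hh hζ x t) y fun z _ => kernel_nonneg x z t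

end Flow

end PAM

namespace PAM

/-! ### The passage functional -/

/-- The hitting functional, as a passage sum. -/
noncomputable def phi (κ h β : ℝ) (ζ : ℤ → ℝ) : ℝ≥0∞ :=
  passage (stepLeft h) (stepRight h) (visitWeight κ ζ β) 1

/-! ### The passage functional of a fixed potential. -/

section Deterministic

variable {κ h β β' : ℝ} {ζ ζ' : ℤ → ℝ}

theorem visitWeight_mono {x : ℤ} (hle : ζ x + β ≤ ζ' x + β') :
    visitWeight κ ζ β x ≤ visitWeight κ ζ' β' x := by
  simp only [visitWeight]
  gcongr ENNReal.ofReal κ / ENNReal.ofReal ?_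
  linarith

theorem visitWeight_ne_zero (hκ : 0 < κ) (x : ℤ) : visitWeight κ ζ β x ≠ 0 := by
  simp [visitWeight, ENNReal.div_eq_zero_iff, hκ]

theorem visitWeight_ne_top_iff (hκ : 0 < κ) {x : ℤ} :
    visitWeight κ ζ β x ≠ ∞ ↔ 0 < κ - ζ x - β := by
  simp only [visitWeight, ne_eq, ENNReal.div_eq_top, not_or, not_and]
  simp [hκ, lt_sub_iff_add_lt]

theorem visitWeight_eq_ofReal {x : ℤ} (hpos : 0 < κ - ζ x - β) :
    visitWeight κ ζ β x = ENNReal.ofReal (κ / (κ - ζ x - β)) := by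
  rw [visitWeight, ENNReal.ofReal_div_of_pos hpos]

theorem stepLeft_ne_zero (hh : h ∈ Ioc (0 : ℝ) 1) : stepLeft h ≠ 0 := by
  simp only [stepLeft, ne_eq, ENNReal.ofReal_eq_zero, not_le]
  linarith [hh.1]

theorem stepLeft_ne_top : stepLeft h ≠ ∞ := ENNReal.ofReal_ne_top

theorem stepRight_ne_top : stepRight h ≠ ∞ := ENNReal.ofReal_ne_top

theorem phi_comp_add (k : ℤ) : phi κ h β (fun y => ζ (y + k)) =
    passage (stepLeft h) (stepRight h) (visitWeight κ ζ β) (k + 1) := by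
  rw [phi, add_comm, ← passage_comp_add]
  rfl

theorem phi_shift_iterate (n : ℕ) : phi κ h β (shift^[n] ζ) =
    passage (stepLeft h) (stepRight h) (visitWeight κ ζ β) (n + 1) := by
  rw [← phi_comp_add]
  congr 1
  ext y
  exact shift_iterate n ζ y

theorem phi_shift : phi κ h β (shift ζ) =
    passage (stepLeft h) (stepRight h) (visitWeight κ ζ β) 2 := by
  have := phi_shift_iterate (κ := κ) (h := h) (β := β) (ζ := ζ) 1
  simpa [one_add_one_eq_two] using this

theorem phi_symm_iterate (n : ℕ) : phi κ h β (shiftEquiv.symm^[n] ζ) =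
    passage (stepLeft h) (stepRight h) (visitWeight κ ζ β) (1 - n) := by
  have h1 := phi_comp_add (κ := κ) (h := h) (β := β) (ζ := ζ) (-n)
  rw [show (1 : ℤ) - n = -n + 1 by ring, ← h1]
  congr 1
  ext y
  rw [shiftEquiv_symm_iterate, sub_eq_add_neg]

theorem phi_eq : phi κ h β ζ = visitWeight κ ζ β 1 *
    (stepLeft h + stepRight h * (phi κ h β (shift ζ) * phi κ h β ζ)) := by
  rw [phi_shift, phi]
  exact passage_eq 1

theorem phi_mono (hle : ∀ x, ζ x + β ≤ ζ' x + β') : phi κ h β ζ ≤ phi κ h β' ζ' :=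
  passage_mono_weight (fun x => visitWeight_mono (hle x)) 1

theorem visitWeight_mul_stepLeft_le_phi : visitWeight κ ζ β 1 * stepLeft h ≤ phi κ h β ζ := by
  conv_rhs => rw [phi_eq]
  gcongr
  exact le_self_add

theorem phi_ne_zero (hκ : 0 < κ) (hh : h ∈ Ioc (0 : ℝ) 1) : phi κ h β ζ ≠ 0 := by
  intro h0
  have := visitWeight_mul_stepLeft_le_phi (κ := κ) (h := h) (β := β) (ζ := ζ)
  rw [h0, nonpos_iff_eq_zero, mul_eq_zero] at this
  exact this.elim (visitWeight_ne_zero hκ 1) (stepLeft_ne_zero hh)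

theorem pos_of_phi_ne_top (hκ : 0 < κ) (hh : h ∈ Ioc (0 : ℝ) 1) (hphi : phi κ h β ζ ≠ ∞) :
    0 < κ - ζ 1 - β := by
  rw [← visitWeight_ne_top_iff hκ]
  intro htop
  have := visitWeight_mul_stepLeft_le_phi (κ := κ) (h := h) (β := β) (ζ := ζ)
  rw [htop, ENNReal.top_mul (stepLeft_ne_zero hh)] at this
  exact hphi (top_le_iff.mp this)

theorem phi_le_one (hκ : 0 < κ) (hh : h ∈ Ioc (0 : ℝ) 1) (hζ : ∀ x, ζ x ≤ 0) (hβ : β ≤ 0) :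
    phi κ h β ζ ≤ 1 := by
  refine passage_le_one (stepLeft_add_stepRight hh) (fun y => ?_) 1
  have hp : 0 < κ - ζ y - β := by linarith [hζ y]
  rw [visitWeight_eq_ofReal hp, ENNReal.ofReal_le_one, div_le_one hp]
  linarith [hζ y]

/-- In the recursion `phi_eq` the functional reappears on the right with this product as its
coefficient, so finiteness forces the coefficient to be at most `1`. Mere finiteness thus gives an
explicit bound one site further on. -/
theorem mul_phi_shift_le_one (hκ : 0 < κ) (hh : h ∈ Ioc (0 : ℝ) 1) (hphi : phi κ h β ζ ≠ ∞) :
    visitWeight κ ζ β 1 * stepRight h * phi κ h β (shift ζ) ≤ 1 := by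
  have h0 := phi_ne_zero (β := β) (ζ := ζ) hκ hh
  have h1 : visitWeight κ ζ β 1 * stepRight h * phi κ h β (shift ζ) * phi κ h β ζ ≤
      1 * phi κ h β ζ := by
    rw [one_mul]
    conv_rhs => rw [phi_eq]
    rw [mul_add, mul_assoc, mul_assoc]
    exact le_add_self
  exact (ENNReal.mul_le_mul_iff_left h0 hphi).mp h1

theorem phi_shift_le_inv (hκ : 0 < κ) (hh : h ∈ Ioc (0 : ℝ) 1) (hphi : phi κ h β ζ ≠ ∞) {c : ℝ≥0∞}
    (hc : c ≤ visitWeight κ ζ β 1) : phi κ h β (shift ζ) ≤ (c * stepRight h)⁻¹ := by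
  rw [ENNReal.le_inv_iff_mul_le, mul_comm]
  exact le_trans (by gcongr) (mul_phi_shift_le_one hκ hh hphi)

theorem phi_of_stepRight_eq_zero (hb : stepRight h = 0) :
    phi κ h β ζ = visitWeight κ ζ β 1 * stepLeft h := by
  rw [phi_eq, hb, zero_mul, add_zero]

theorem measurable_hitSeq_visitWeight (a b : ℝ≥0∞) (n : ℕ) (y : ℤ) :
    Measurable fun ζ : ℤ → ℝ => hitSeq a b (visitWeight κ ζ β) n y := by
  induction n generalizing y with
  | zero => simp only [hitSeq]; exact measurable_const
  | succ n ih =>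
    simp only [hitSeq]
    split_ifs
    · exact measurable_const
    · have h1 := ih (y - 1)
      have h2 := ih (y + 1)
      have h3 : Measurable fun ζ : ℤ → ℝ => visitWeight κ ζ β y := by
        simp only [visitWeight]
        fun_prop
      fun_prop

theorem phi_eq_hitSum : phi κ h β ζ = hitSum (stepLeft h) (stepRight h) (visitWeight κ ζ β) 1 := by
  simp [phi, passage]

theorem measurable_phi : Measurable (phi κ h β) := by
  have : phi κ h β = fun ζ => ⨆ n, hitSeq (stepLeft h) (stepRight h) (visitWeight κ ζ β) n 1 := by
    ext ζ; rw [phi_eq_hitSum]; rfl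
  rw [this]
  exact Measurable.iSup fun n => measurable_hitSeq_visitWeight _ _ n 1

end Deterministic

/-! ### The critical value -/

/-- The standing assumptions on the law of the potential. -/
structure IsAdmissible (P : Measure (ℤ → ℝ)) : Prop where
  ergodic : Ergodic shift P
  nonpos : ∀ᵐ ζ ∂P, ∀ x, ζ x ≤ 0
  near_zero : ∀ ε : ℝ, 0 < ε → P {ζ | -ε < ζ 1} ≠ 0
  nontrivial : P {ζ | ζ 1 < 0} ≠ 0
  bounded_or_iid : (∃ b : ℝ, b < 0 ∧ ∀ᵐ ζ ∂P, ∀ x, b ≤ ζ x) ∨ IsIIDNonpos P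

section Critical

variable {κ h β β' : ℝ} {P : Measure (ℤ → ℝ)}

theorem ergodic_shiftEquiv_symm (hP : Ergodic shift P) : Ergodic shiftEquiv.symm P :=
  Ergodic.symm (e := shiftEquiv) hP

theorem ae_of_ae_shift (hP : Ergodic shift P) {p : (ℤ → ℝ) → Prop} (h : ∀ᵐ ζ ∂P, p (shift ζ)) :
    ∀ᵐ ζ ∂P, p ζ := by
  have h1 := (ergodic_shiftEquiv_symm hP).quasiMeasurePreserving.ae h
  filter_upwards [h1] with ζ hζ
  have e : shift (shiftEquiv.symm ζ) = ζ := shiftEquiv.apply_symm_apply ζ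
  rwa [e] at hζ

theorem ae_shift_iterate (hP : Ergodic shift P) {p : (ℤ → ℝ) → Prop} (h : ∀ᵐ ζ ∂P, p ζ) :
    ∀ᵐ ζ ∂P, ∀ n : ℕ, p (shift^[n] ζ) ∧ p (shiftEquiv.symm^[n] ζ) := by
  rw [ae_all_iff]
  intro n
  exact ((hP.toMeasurePreserving.iterate n).quasiMeasurePreserving.ae h).and
    (((ergodic_shiftEquiv_symm hP).toMeasurePreserving.iterate n).quasiMeasurePreserving.ae h)

theorem IsIIDNonpos.measure_box_ne_zero (hP : IsIIDNonpos P) {ε : ℝ}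
    (hε : P {ζ | -ε < ζ 1} ≠ 0) (s : Finset ℤ) : P {ζ | ∀ y ∈ s, -ε < ζ y} ≠ 0 := by
  obtain ⟨η, hη, -, rfl⟩ := hP
  have hset : ∀ s : Finset ℤ, {ζ : ℤ → ℝ | ∀ y ∈ s, -ε < ζ y} = Set.pi s fun _ => Ioi (-ε) := by
    intro s; ext ζ; simp
  have h1 : {ζ : ℤ → ℝ | -ε < ζ 1} = Set.pi ({1} : Finset ℤ) fun _ => Ioi (-ε) := by
    ext ζ; simp
  rw [h1, Measure.infinitePi_pi (μ := fun _ : ℤ => η) (fun _ _ => measurableSet_Ioi)] at hε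
  rw [hset, Measure.infinitePi_pi (μ := fun _ : ℤ => η) (fun _ _ => measurableSet_Ioi)]
  rw [Finset.prod_singleton] at hε
  exact Finset.prod_ne_zero_iff.mpr fun _ _ => hε

/-- Almost sure finiteness of the passage functional at `β` implies boundedness below `β`. -/
theorem IsAdmissible.exists_bound (hP : IsAdmissible P) (hκ : 0 < κ) (hh : h ∈ Ioc (0 : ℝ) 1)
    (hfin : ∀ᵐ ζ ∂P, phi κ h β ζ ≠ ∞) (hlt : β' < β) :
    ∃ C : ℝ≥0∞, C ≠ ∞ ∧ ∀ᵐ ζ ∂P, phi κ h β' ζ ≤ C := by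
  -- Without steps to the right the functional is a single weight. Finiteness at `β` means `κ - ζ 1
  -- - β > 0`, hence `κ - ζ 1 - β' > β - β'`.
  by_cases hb : stepRight h = 0
  · have hc : ENNReal.ofReal κ / ENNReal.ofReal (β - β') * stepLeft h ≠ ∞ :=
      ENNReal.mul_ne_top (ENNReal.div_ne_top ENNReal.ofReal_ne_top (by simpa using hlt))
        stepLeft_ne_top
    refine ⟨_, hc, ?_⟩
    filter_upwards [hfin] with ζ hζ
    have := pos_of_phi_ne_top hκ hh hζ
    rw [phi_of_stepRight_eq_zero hb, visitWeight]
    gcongr ENNReal.ofReal κ / ENNReal.ofReal ?_ * _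
    linarith
  rcases hP.bounded_or_iid with ⟨b₀, -, hb₀⟩ | hiid
  -- A potential bounded below has weights bounded below by `c`, so `phi_shift_le_inv` gives a
  -- uniform bound for the shifted potential; shift invariance then moves it back.
  · set c : ℝ≥0∞ := ENNReal.ofReal κ / ENNReal.ofReal (κ - b₀ - β) with hc
    refine ⟨(c * stepRight h)⁻¹, ?_, ?_⟩
    · have : c ≠ 0 := by simp [hc, ENNReal.div_eq_zero_iff, hκ]
      simp [this, hb]
    · refine ae_of_ae_shift hP.ergodic ?_
      filter_upwards [hfin, hb₀] with ζ hζ hζb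
      refine (phi_mono (β' := β) fun x => by linarith).trans
        (phi_shift_le_inv hκ hh hζ ?_)
      rw [hc, visitWeight]
      gcongr ENNReal.ofReal κ / ENNReal.ofReal ?_
      linarith [hζb 1]
  -- For an i.i.d. potential compare with zero potential. With positive probability the potential
  -- exceeds `-(β - β')` on any given box, and there its weights at `β` dominate those of zero
  -- potential at `β'`. Each finite-path sum is therefore bounded by a constant that does not depend
  -- on the box.
  · set c₀ : ℤ → ℝ≥0∞ := visitWeight κ 0 β' with hc₀
    have key : phi κ h β' 0 ≤ (c₀ 1 * stepRight h)⁻¹ := by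
      rw [phi_eq_hitSum]
      refine iSup_le fun n => ?_
      have hpos := hiid.measure_box_ne_zero (hP.near_zero (β - β') (by linarith))
        (Finset.Icc 1 (n + 3))
      obtain ⟨ζ, hζ1, hζ2⟩ : ∃ ζ : ℤ → ℝ, (∀ y ∈ Finset.Icc (1 : ℤ) (n + 3), -(β - β') < ζ y) ∧
          phi κ h β ζ ≠ ∞ := by
        by_contra hcon
        push Not at hcon
        refine hpos (measure_mono_null (fun ζ hζ => ?_) hfin)
        simpa using hcon ζ hζ
      have hle : ∀ y : ℤ, 1 ≤ y → y ≤ n + 3 → c₀ y ≤ visitWeight κ ζ β y := fun y h1 h2 =>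
        visitWeight_mono (by
          have := hζ1 y (Finset.mem_Icc.mpr ⟨h1, h2⟩)
          simp only [Pi.zero_apply]; linarith)
      calc hitSeq (stepLeft h) (stepRight h) c₀ n 1
          ≤ hitSeq (stepLeft h) (stepRight h) (visitWeight κ (shift ζ) β) n 1 := by
            refine hitSeq_mono_weight n 1 fun z h1 h2 => ?_
            exact hle (z + 1) (by omega) (by omega)
        _ ≤ phi κ h β (shift ζ) := by rw [phi_eq_hitSum]; exact le_iSup (hitSeq _ _ _ · 1) n
        _ ≤ (c₀ 1 * stepRight h)⁻¹ := phi_shift_le_inv hκ hh hζ2 (hle 1 le_rfl (by omega))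
    refine ⟨(c₀ 1 * stepRight h)⁻¹, ?_, ?_⟩
    · simp [hb, hc₀, visitWeight_ne_zero hκ]
    · filter_upwards [hP.nonpos] with ζ hζ
      exact (phi_mono fun x => by simpa using hζ x).trans key

/-- Existence of a threshold for the finiteness of the passage functional. -/
theorem IsAdmissible.exists_threshold (hP : IsAdmissible P) (hκ : 0 < κ)
    (hh : h ∈ Ioc (0 : ℝ) 1) : ∃ βcr : ℝ, 0 ≤ βcr ∧ βcr ≤ κ ∧
      (∀ β < βcr, ∃ C : ℝ≥0∞, C ≠ ∞ ∧ ∀ᵐ ζ ∂P, phi κ h β ζ ≤ C) ∧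
      ∀ β, βcr < β → ¬ ∀ᵐ ζ ∂P, phi κ h β ζ ≠ ∞ := by
  set S : Set ℝ := {β | ∀ᵐ ζ ∂P, phi κ h β ζ ≠ ∞} with hS
  have h0 : (0 : ℝ) ∈ S := by
    filter_upwards [hP.nonpos] with ζ hζ
    exact ne_top_of_le_ne_top ENNReal.one_ne_top (phi_le_one hκ hh hζ le_rfl)
  have hbdd : ∀ β ∈ S, β ≤ κ := by
    intro β hβ
    by_contra hcon
    push Not at hcon
    -- For `β > κ`, a value of the potential close to `0` already makes a single holding time
    -- non-integrable.
    refine hP.near_zero (β - κ) (by linarith) (measure_mono_null (fun ζ hζ => ?_) hβ)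
    simp only [mem_ofPred_eq, mem_compl_iff, not_not] at hζ ⊢
    by_contra hne
    have := pos_of_phi_ne_top hκ hh hne
    linarith
  have hBA : BddAbove S := ⟨κ, hbdd⟩
  refine ⟨sSup S, le_csSup hBA h0, csSup_le ⟨0, h0⟩ hbdd, fun β hβ => ?_, fun β hβ hfin => ?_⟩
  · obtain ⟨β₁, h1, h2⟩ := exists_lt_of_lt_csSup ⟨0, h0⟩ hβ
    exact hP.exists_bound hκ hh h1 h2
  · exact absurd (le_csSup hBA hfin) (not_le.mpr hβ)

end Critical

end PAM

namespace PAM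

/-! ### The logarithm of the passage functional -/

/-- The logarithm of the passage functional. -/
noncomputable def psi (κ h β : ℝ) (ζ : ℤ → ℝ) : ℝ := Real.log (phi κ h β ζ).toReal

theorem measurable_psi {κ h β : ℝ} : Measurable (psi κ h β) :=
  Real.measurable_log.comp measurable_phi.ennreal_toReal

section Deterministic

variable {κ h β β' : ℝ} {ζ : ℤ → ℝ}

theorem toReal_phi_pos (hκ : 0 < κ) (hh : h ∈ Ioc (0 : ℝ) 1) (hphi : phi κ h β ζ ≠ ∞) :
    0 < (phi κ h β ζ).toReal :=
  ENNReal.toReal_pos (phi_ne_zero hκ hh) hphi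

theorem exp_psi (hκ : 0 < κ) (hh : h ∈ Ioc (0 : ℝ) 1) (hphi : phi κ h β ζ ≠ ∞) :
    Real.exp (psi κ h β ζ) = (phi κ h β ζ).toReal :=
  Real.exp_log (toReal_phi_pos hκ hh hphi)

theorem log_phi (hκ : 0 < κ) (hh : h ∈ Ioc (0 : ℝ) 1) (hphi : phi κ h β ζ ≠ ∞) :
    ENNReal.log (phi κ h β ζ) = (psi κ h β ζ : EReal) :=
  ENNReal.log_pos_real (phi_ne_zero hκ hh) hphi

theorem psi_le_log_add (hκ : 0 < κ) (hh : h ∈ Ioc (0 : ℝ) 1) {r : ℝ} (hr : 0 < r)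
    (hphi : phi κ h β ζ ≠ ∞) (hle : phi κ h β' ζ ≤ ENNReal.ofReal r * phi κ h β ζ) :
    psi κ h β' ζ ≤ Real.log r + psi κ h β ζ := by
  have hphi' : phi κ h β' ζ ≠ ∞ :=
    ne_top_of_le_ne_top (ENNReal.mul_ne_top ENNReal.ofReal_ne_top hphi) hle
  have h1 := ENNReal.toReal_mono (ENNReal.mul_ne_top ENNReal.ofReal_ne_top hphi) hle
  rw [ENNReal.toReal_mul, ENNReal.toReal_ofReal hr.le] at h1
  rw [psi, psi, ← Real.log_mul hr.ne' (toReal_phi_pos hκ hh hphi).ne']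
  exact Real.log_le_log (toReal_phi_pos hκ hh hphi') h1

theorem psi_mono (hκ : 0 < κ) (hh : h ∈ Ioc (0 : ℝ) 1) (hle : β ≤ β')
    (hphi : phi κ h β' ζ ≠ ∞) : psi κ h β ζ ≤ psi κ h β' ζ := by
  have hm : phi κ h β ζ ≤ phi κ h β' ζ := phi_mono fun x => by linarith
  simpa using psi_le_log_add hκ hh one_pos hphi (by simpa using hm)

theorem phi_ne_top_of_le (hle : β ≤ β') (hphi : phi κ h β' ζ ≠ ∞) : phi κ h β ζ ≠ ∞ :=
  ne_top_of_le_ne_top hphi (phi_mono fun x => by linarith)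

/-- The passage functional grows at least at the rate of the weight of its first visit. -/
theorem le_psi_sub_psi (hκ : 0 < κ) (hh : h ∈ Ioc (0 : ℝ) 1) (hle : β ≤ β')
    (hphi : phi κ h β' ζ ≠ ∞) :
    (β' - β) / (κ - ζ 1 - β) ≤ psi κ h β' ζ - psi κ h β ζ := by
  have hp' := pos_of_phi_ne_top hκ hh hphi
  have hp : 0 < κ - ζ 1 - β := by linarith
  set r : ℝ := (κ - ζ 1 - β') / (κ - ζ 1 - β) with hr
  have hr0 : 0 < r := div_pos hp' hp
  have hc : visitWeight κ ζ β 1 = ENNReal.ofReal r * visitWeight κ ζ β' 1 := by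
    rw [visitWeight_eq_ofReal hp, visitWeight_eq_ofReal hp', ← ENNReal.ofReal_mul hr0.le, hr]
    congr 1
    field_simp
  have hm : phi κ h β ζ ≤ ENNReal.ofReal r * phi κ h β' ζ := by
    rw [phi_eq]
    conv_rhs => rw [phi_eq]
    rw [hc, mul_assoc]
    gcongr
    · exact phi_mono fun x => by linarith
    · exact phi_mono fun x => by linarith
  have h1 := psi_le_log_add hκ hh hr0 hphi hm
  have h2 : Real.log r ≤ r - 1 := Real.log_le_sub_one_of_pos hr0
  have h3 : r - 1 = -((β' - β) / (κ - ζ 1 - β)) := by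
    rw [hr]; field_simp; ring
  linarith

end Deterministic

/-! ### Averages over the potential. -/

section Annealed

variable {κ h β β' βcr : ℝ} {P : Measure (ℤ → ℝ)}

/-- A very negative `ζ 1` makes the functional small at both parameters by the same factor
`visitWeight`. The recursion bounds `phi` above by this factor, a direct step to the left bounds it
below, and the ratio is controlled even when `psi` is unbounded. -/
theorem IsAdmissible.exists_ratio (hP : IsAdmissible P) (hκ : 0 < κ) (hh : h ∈ Ioc (0 : ℝ) 1)
    (hcr : βcr ≤ κ) (hbd : ∀ β < βcr, ∃ C : ℝ≥0∞, C ≠ ∞ ∧ ∀ᵐ ζ ∂P, phi κ h β ζ ≤ C)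
    {β₁ β₂ : ℝ} (h12 : β₁ ≤ β₂) (h2 : β₂ < βcr) :
    ∃ K : ℝ, 1 ≤ K ∧ ∀ᵐ ζ ∂P, phi κ h β₂ ζ ≤ ENNReal.ofReal K * phi κ h β₁ ζ := by
  obtain ⟨C, hC, hCb⟩ := hbd β₂ h2
  -- The largest ratio of the weights at `β₂` and `β₁` over `ζ 1 ≤ 0`, attained at `ζ 1 = 0`.
  set R : ℝ := 1 + (β₂ - β₁) / (κ - β₂) with hR
  have hκ2 : 0 < κ - β₂ := by linarith
  have hR0 : 0 < R := by have := div_nonneg (sub_nonneg.mpr h12) hκ2.le; linarith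
  set D : ℝ≥0∞ := ENNReal.ofReal R * ((stepLeft h + stepRight h * (C * C)) / stepLeft h) with hD
  have hDt : D ≠ ∞ := by
    refine ENNReal.mul_ne_top ENNReal.ofReal_ne_top (ENNReal.div_ne_top ?_ (stepLeft_ne_zero hh))
    exact ENNReal.add_ne_top.mpr ⟨stepLeft_ne_top, ENNReal.mul_ne_top stepRight_ne_top
      (ENNReal.mul_ne_top hC hC)⟩
  refine ⟨max 1 D.toReal, le_max_left _ _, ?_⟩
  filter_upwards [hCb, hP.ergodic.quasiMeasurePreserving.ae hCb, hP.nonpos] with ζ h3 h4 hζ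
  have hfin : phi κ h β₂ ζ ≠ ∞ := ne_top_of_le_ne_top hC h3
  have hp2 := pos_of_phi_ne_top hκ hh hfin
  have hp1 : 0 < κ - ζ 1 - β₁ := by linarith
  have hc : visitWeight κ ζ β₂ 1 ≤ ENNReal.ofReal R * visitWeight κ ζ β₁ 1 := by
    rw [visitWeight_eq_ofReal hp1, visitWeight_eq_ofReal hp2, ← ENNReal.ofReal_mul hR0.le]
    refine ENNReal.ofReal_le_ofReal ?_
    rw [← mul_div_assoc, div_le_div_iff₀ hp2 hp1]
    have e : R * (κ - ζ 1 - β₂) = κ - ζ 1 - β₁ + (β₂ - β₁) * (-ζ 1) / (κ - β₂) := by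
      rw [hR]; field_simp; ring
    have h5 : 0 ≤ (β₂ - β₁) * (-ζ 1) / (κ - β₂) :=
      div_nonneg (mul_nonneg (by linarith) (by linarith [hζ 1])) hκ2.le
    nlinarith
  calc phi κ h β₂ ζ = visitWeight κ ζ β₂ 1 *
        (stepLeft h + stepRight h * (phi κ h β₂ (shift ζ) * phi κ h β₂ ζ)) := phi_eq
    _ ≤ (ENNReal.ofReal R * visitWeight κ ζ β₁ 1) *
        (stepLeft h + stepRight h * (C * C)) := by gcongr
    _ = D * (visitWeight κ ζ β₁ 1 * stepLeft h) := by
        rw [hD, ENNReal.div_eq_inv_mul]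
        calc _ = ENNReal.ofReal R * visitWeight κ ζ β₁ 1 * (stepLeft h + stepRight h * (C * C)) * 1 := by
              ring
          _ = ENNReal.ofReal R * visitWeight κ ζ β₁ 1 * (stepLeft h + stepRight h * (C * C)) *
              ((stepLeft h)⁻¹ * stepLeft h) := by
              rw [ENNReal.inv_mul_cancel (stepLeft_ne_zero hh) stepLeft_ne_top]
          _ = _ := by ring
    _ ≤ ENNReal.ofReal (max 1 D.toReal) * phi κ h β₁ ζ := by
        gcongr
        · exact (ENNReal.ofReal_toReal hDt).ge.trans (ENNReal.ofReal_le_ofReal (le_max_right _ _))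
        · exact visitWeight_mul_stepLeft_le_phi

/-- Almost surely, `β ↦ psi β` is Lipschitz on compact intervals below the critical value, with a
deterministic constant. -/
theorem IsAdmissible.exists_lipschitz (hP : IsAdmissible P) (hκ : 0 < κ) (hh : h ∈ Ioc (0 : ℝ) 1)
    (hcr : βcr ≤ κ) (hbd : ∀ β < βcr, ∃ C : ℝ≥0∞, C ≠ ∞ ∧ ∀ᵐ ζ ∂P, phi κ h β ζ ≤ C)
    {β₁ β₂ : ℝ} (h12 : β₁ ≤ β₂) (h2 : β₂ < βcr) :
    ∃ K : ℝ, 0 ≤ K ∧ ∀ᵐ ζ ∂P, ∀ β ∈ Icc β₁ β₂, ∀ β' ∈ Icc β β₂,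
      psi κ h β' ζ - psi κ h β ζ ≤ K * (β' - β) := by
  obtain ⟨β₃, h23, h3⟩ := exists_between h2
  obtain ⟨K, hK1, hK⟩ := hP.exists_ratio hκ hh hcr hbd (h12.trans h23.le) h3
  obtain ⟨C, hC, hCb⟩ := hbd β₃ h3
  refine ⟨(K - 1) / (β₃ - β₂), div_nonneg (by linarith) (by linarith), ?_⟩
  filter_upwards [hK, hCb] with ζ hζK hζC β hβ β' hβ'
  have hβ3 : 0 < β₃ - β := by linarith [hβ.2]
  have hfin3 : phi κ h β₃ ζ ≠ ∞ := ne_top_of_le_ne_top hC hζC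
  have hfin : phi κ h β ζ ≠ ∞ := phi_ne_top_of_le (by linarith [hβ.2]) hfin3
  -- Then `β' = (1 - θ) β + θ β₃`. Convexity and the ratio bound at `β₃` give `φ_β' ≤ (1 + θ (K -
  -- 1)) φ_β`, and `log (1 + s) ≤ s` makes this linear in `β' - β`.
  set θ : ℝ := (β' - β) / (β₃ - β) with hθ
  have hθ0 : 0 ≤ θ := div_nonneg (by linarith [hβ'.1]) hβ3.le
  have hθ1 : θ ≤ 1 := by rw [hθ, div_le_one hβ3]; linarith [hβ'.2]
  have hconv := hittingFunctional_convex hκ hh ζ (β := β) (β' := β₃) hθ0 hθ1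
  have e : (1 - θ) * β + θ * β₃ = β' := by rw [hθ]; field_simp; ring
  rw [e] at hconv
  simp only [hittingFunctional_eq_passage hκ hh] at hconv
  change phi κ h β' ζ ≤ ENNReal.ofReal (1 - θ) * phi κ h β ζ + ENNReal.ofReal θ * phi κ h β₃ ζ
    at hconv
  have hle : phi κ h β₃ ζ ≤ ENNReal.ofReal K * phi κ h β ζ :=
    hζK.trans (by gcongr; exact phi_mono fun x => by linarith [hβ.1])
  have hle' : phi κ h β' ζ ≤ ENNReal.ofReal (1 + θ * (K - 1)) * phi κ h β ζ := by
    calc phi κ h β' ζ ≤ ENNReal.ofReal (1 - θ) * phi κ h β ζ +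
          ENNReal.ofReal θ * (ENNReal.ofReal K * phi κ h β ζ) := hconv.trans (by gcongr)
      _ = ENNReal.ofReal (1 + θ * (K - 1)) * phi κ h β ζ := by
        rw [← mul_assoc, ← add_mul, ← ENNReal.ofReal_mul hθ0, ← ENNReal.ofReal_add (by linarith)
          (mul_nonneg hθ0 (by linarith))]
        congr 2
        ring
  have hpos : 0 < 1 + θ * (K - 1) := by nlinarith
  have h5 := psi_le_log_add hκ hh hpos hfin hle'
  have h6 : Real.log (1 + θ * (K - 1)) ≤ θ * (K - 1) := by
    have := Real.log_le_sub_one_of_pos hpos; linarith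
  have h7 : θ * (K - 1) ≤ (K - 1) / (β₃ - β₂) * (β' - β) := by
    have h8 : θ ≤ (β' - β) / (β₃ - β₂) := by
      rw [hθ]
      exact div_le_div_of_nonneg_left (by linarith [hβ'.1]) (by linarith) (by linarith [hβ.2])
    calc θ * (K - 1) ≤ (β' - β) / (β₃ - β₂) * (K - 1) :=
          mul_le_mul_of_nonneg_right h8 (by linarith)
      _ = _ := by ring
  linarith

theorem ae_phi_ne_top (hbd : ∀ β < βcr, ∃ C : ℝ≥0∞, C ≠ ∞ ∧ ∀ᵐ ζ ∂P, phi κ h β ζ ≤ C)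
    (hβ : β < βcr) : ∀ᵐ ζ ∂P, phi κ h β ζ ≠ ∞ := by
  obtain ⟨C, hC, hCb⟩ := hbd β hβ
  filter_upwards [hCb] with ζ hζ using ne_top_of_le_ne_top hC hζ

/-- Integrability of `psi` does not depend on `β` below the critical value. -/
theorem IsAdmissible.integrable_psi [IsProbabilityMeasure P] (hP : IsAdmissible P) (hκ : 0 < κ)
    (hh : h ∈ Ioc (0 : ℝ) 1) (hcr : βcr ≤ κ)
    (hbd : ∀ β < βcr, ∃ C : ℝ≥0∞, C ≠ ∞ ∧ ∀ᵐ ζ ∂P, phi κ h β ζ ≤ C)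
    (hβ : β < βcr) (hβ' : β' < βcr) (hint : Integrable (psi κ h β) P) :
    Integrable (psi κ h β') P := by
  have hlo := min_le_left β β'
  have hlo' := min_le_right β β'
  obtain ⟨K, hK0, hK⟩ := hP.exists_lipschitz hκ hh hcr hbd (β₁ := min β β') (β₂ := max β β')
    (hlo.trans (le_max_left _ _)) (max_lt hβ hβ')
  have hdiff : Integrable (fun ζ => psi κ h β' ζ - psi κ h β ζ) P := by
    refine Integrable.of_bound (C := K * |β' - β|)
      (measurable_psi.sub measurable_psi).aestronglyMeasurable ?_
    filter_upwards [hK, ae_phi_ne_top hbd hβ, ae_phi_ne_top hbd hβ'] with ζ hζ h1 h2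
    rw [Real.norm_eq_abs]
    rcases le_total β β' with hle | hle
    · have h3 := hζ β ⟨hlo, le_max_left _ _⟩ β' ⟨hle, le_max_right _ _⟩
      have h4 := psi_mono hκ hh hle h2
      rwa [abs_of_nonneg (by linarith), abs_of_nonneg (by linarith)]
    · have h3 := hζ β' ⟨hlo', le_max_right _ _⟩ β ⟨hle, le_max_left _ _⟩
      have h4 := psi_mono hκ hh hle h1
      rw [abs_of_nonpos (by linarith), abs_of_nonpos (by linarith)]
      linarith
  exact (hint.add hdiff).congr (Eventually.of_forall fun ζ => by simp)

/-- The annealed exponent. -/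
noncomputable def ell (κ h : ℝ) (P : Measure (ℤ → ℝ)) (β : ℝ) : ℝ := ∫ ζ, psi κ h β ζ ∂P

theorem IsAdmissible.continuousOn_ell [IsProbabilityMeasure P] (hP : IsAdmissible P) (hκ : 0 < κ)
    (hh : h ∈ Ioc (0 : ℝ) 1) (hcr : βcr ≤ κ)
    (hbd : ∀ β < βcr, ∃ C : ℝ≥0∞, C ≠ ∞ ∧ ∀ᵐ ζ ∂P, phi κ h β ζ ≤ C)
    (hint : ∀ β < βcr, Integrable (psi κ h β) P) {β₁ β₂ : ℝ} (h12 : β₁ ≤ β₂) (h2 : β₂ < βcr) :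
    ContinuousOn (ell κ h P) (Icc β₁ β₂) := by
  obtain ⟨K, hK0, hK⟩ := hP.exists_lipschitz hκ hh hcr hbd h12 h2
  have key : ∀ β ∈ Icc β₁ β₂, ∀ β' ∈ Icc β β₂, |ell κ h P β' - ell κ h P β| ≤ K * |β' - β| := by
    intro β hβ β' hβ'
    have hi := hint β (by linarith [hβ.2])
    have hi' := hint β' (by linarith [hβ'.2])
    rw [abs_of_nonneg (by linarith [hβ'.1] : 0 ≤ β' - β), ell, ell, ← integral_sub hi' hi,
      abs_of_nonneg]
    · calc ∫ ζ, psi κ h β' ζ - psi κ h β ζ ∂P ≤ ∫ ζ, K * (β' - β) ∂P := by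
            refine integral_mono_ae (hi'.sub hi) (integrable_const _) ?_
            filter_upwards [hK] with ζ hζ using hζ β hβ β' hβ'
        _ = K * (β' - β) := by simp
    · refine integral_nonneg_of_ae ?_
      filter_upwards [ae_phi_ne_top hbd (by linarith [hβ'.2] : β' < βcr)] with ζ hζ
      exact sub_nonneg.mpr (psi_mono hκ hh hβ'.1 hζ)
  have hlip : LipschitzOnWith K.toNNReal (ell κ h P) (Icc β₁ β₂) := by
    refine LipschitzOnWith.of_dist_le_mul fun x hx y hy => ?_
    rw [Real.dist_eq, Real.dist_eq, Real.coe_toNNReal K hK0]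
    rcases le_total x y with hxy | hxy
    · rw [abs_sub_comm, abs_sub_comm x y]; exact key x hx y ⟨hxy, hy.2⟩
    · exact key y hy x ⟨hxy, hx.2⟩
  exact hlip.continuousOn

theorem IsAdmissible.integrable_inv [IsProbabilityMeasure P] (hP : IsAdmissible P) (hκ : 0 < κ) :
    Integrable (fun ζ : ℤ → ℝ => 1 / (κ - ζ 1)) P ∧ 0 < ∫ ζ : ℤ → ℝ, 1 / (κ - ζ 1) ∂P := by
  have hm : Measurable fun ζ : ℤ → ℝ => 1 / (κ - ζ 1) := by fun_prop
  have hi : Integrable (fun ζ : ℤ → ℝ => 1 / (κ - ζ 1)) P := by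
    refine Integrable.of_bound (C := 1 / κ) hm.aestronglyMeasurable ?_
    filter_upwards [hP.nonpos] with ζ hζ
    have : 0 < κ - ζ 1 := by linarith [hζ 1]
    rw [Real.norm_of_nonneg (by positivity)]
    exact one_div_le_one_div_of_le hκ (by linarith [hζ 1])
  refine ⟨hi, ?_⟩
  rw [integral_pos_iff_support_of_nonneg_ae]
  · have : Function.support (fun ζ : ℤ → ℝ => 1 / (κ - ζ 1)) =ᵐ[P] univ := by
      rw [ae_eq_univ]
      refine measure_mono_null (fun ζ hζ => ?_) hP.nonpos
      intro hcon
      have h1 : 0 < κ - ζ 1 := by linarith [hcon 1]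
      exact hζ (one_div_pos.mpr h1).ne'
    rw [measure_congr this]
    simp
  · filter_upwards [hP.nonpos] with ζ hζ
    have : 0 < κ - ζ 1 := by linarith [hζ 1]
    simp only [Pi.zero_apply]
    positivity
  · exact hi

/-- A positive lower bound for the slope of `ell` on `[0, βcr)`. It gives uniqueness of the zero and
positivity of the derivative wherever it exists. -/
theorem IsAdmissible.le_ell_sub_ell [IsProbabilityMeasure P] (hP : IsAdmissible P) (hκ : 0 < κ)
    (hh : h ∈ Ioc (0 : ℝ) 1)
    (hbd : ∀ β < βcr, ∃ C : ℝ≥0∞, C ≠ ∞ ∧ ∀ᵐ ζ ∂P, phi κ h β ζ ≤ C)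
    (hint : ∀ β < βcr, Integrable (psi κ h β) P) (h0 : 0 ≤ β) (hle : β ≤ β') (hβ' : β' < βcr) :
    (β' - β) * ∫ ζ : ℤ → ℝ, 1 / (κ - ζ 1) ∂P ≤ ell κ h P β' - ell κ h P β := by
  have hi := hint β (by linarith)
  have hi' := hint β' hβ'
  rw [ell, ell, ← integral_sub hi' hi, ← integral_const_mul]
  refine integral_mono_ae ((hP.integrable_inv hκ).1.const_mul _) (hi'.sub hi) ?_
  filter_upwards [ae_phi_ne_top hbd hβ'] with ζ hζ
  have h1 := le_psi_sub_psi hκ hh hle hζ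
  have h2 := pos_of_phi_ne_top hκ hh hζ
  refine le_trans ?_ h1
  rw [mul_one_div]
  exact div_le_div_of_nonneg_left (by linarith) (by linarith) (by linarith)

/-- At `β = 0` the functional is at most `visitWeight`, which is below `1` on the event `ζ 1 < 0` of
positive probability. -/
theorem IsAdmissible.ell_zero_neg [IsProbabilityMeasure P] (hP : IsAdmissible P) (hκ : 0 < κ)
    (hh : h ∈ Ioc (0 : ℝ) 1) (hint : Integrable (psi κ h 0) P) : ell κ h P 0 < 0 := by
  have hle : ∀ ζ : ℤ → ℝ, (∀ x, ζ x ≤ 0) → psi κ h 0 ζ ≤ 0 := fun ζ hζ => by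
    have h1 := ENNReal.toReal_mono ENNReal.one_ne_top (phi_le_one (h := h) hκ hh hζ le_rfl)
    exact Real.log_nonpos ENNReal.toReal_nonneg (by simpa using h1)
  have hpos : 0 < ∫ ζ, -psi κ h 0 ζ ∂P := by
    rw [integral_pos_iff_support_of_nonneg_ae]
    · refine pos_iff_ne_zero.mpr fun h0 => hP.nontrivial ?_
      have h1 : P (Function.support (fun ζ => -psi κ h 0 ζ) ∪ {ζ | ¬ ∀ x, ζ x ≤ 0}) = 0 :=
        measure_union_null h0 hP.nonpos
      refine measure_mono_null (fun ζ (hζ : ζ 1 < 0) => ?_) h1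
      by_cases hn : ∀ x, ζ x ≤ 0
      · left
        have hfin : phi κ h 0 ζ ≠ ∞ :=
          ne_top_of_le_ne_top ENNReal.one_ne_top (phi_le_one hκ hh hn le_rfl)
        have hsh : ∀ x, shift ζ x ≤ 0 := fun x => hn (x + 1)
        have hp : 0 < κ - ζ 1 - 0 := by linarith
        have hlt : phi κ h 0 ζ < 1 := by
          calc phi κ h 0 ζ = visitWeight κ ζ 0 1 *
                (stepLeft h + stepRight h * (phi κ h 0 (shift ζ) * phi κ h 0 ζ)) := phi_eq
            _ ≤ visitWeight κ ζ 0 1 * (stepLeft h + stepRight h * (1 * 1)) := by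
                gcongr
                · exact phi_le_one hκ hh hsh le_rfl
                · exact phi_le_one hκ hh hn le_rfl
            _ = visitWeight κ ζ 0 1 := by
                rw [mul_one, mul_one, stepLeft_add_stepRight hh, mul_one]
            _ < 1 := by
                rw [visitWeight_eq_ofReal hp, ENNReal.ofReal_lt_one, div_lt_one hp]
                linarith
        have h2 : (phi κ h 0 ζ).toReal < 1 := by
          simpa using (ENNReal.toReal_lt_toReal hfin ENNReal.one_ne_top).mpr hlt
        have h3 := Real.log_neg (toReal_phi_pos hκ hh hfin) h2
        simp only [Function.mem_support, psi]
        linarith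
      · exact Or.inr hn
    · filter_upwards [hP.nonpos] with ζ hζ
      have := hle ζ hζ
      simp only [Pi.zero_apply]; linarith
    · exact hint.neg
  rw [integral_neg] at hpos
  rw [ell]; linarith

/-- If `psi` has negative mean, possibly `-∞`, then it is dominated by an integrable function of
negative mean. -/
theorem exists_integrable_ge_psi [IsProbabilityMeasure P]
    (hbd : ∃ C : ℝ≥0∞, C ≠ ∞ ∧ ∀ᵐ ζ ∂P, phi κ h β ζ ≤ C)
    (hneg : Integrable (psi κ h β) P → ell κ h P β < 0) :
    ∃ g : (ℤ → ℝ) → ℝ, Measurable g ∧ Integrable g P ∧ (∀ ζ, psi κ h β ζ ≤ g ζ) ∧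
      ∫ ζ, g ζ ∂P < 0 := by
  by_cases hint : Integrable (psi κ h β) P
  · exact ⟨psi κ h β, measurable_psi, hint, fun _ => le_rfl, hneg hint⟩
  obtain ⟨C, hC, hCb⟩ := hbd
  set M : ℝ := |Real.log C.toReal| with hM
  have hup : ∀ᵐ ζ ∂P, psi κ h β ζ ≤ M := by
    filter_upwards [hCb] with ζ hζ
    have h1 := ENNReal.toReal_mono hC hζ
    rcases (ENNReal.toReal_nonneg (a := phi κ h β ζ)).eq_or_lt with h0 | h0
    · rw [psi, ← h0, Real.log_zero]; positivity
    · exact (Real.log_le_log h0 h1).trans (le_abs_self _)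
  have hM0 : 0 ≤ M := abs_nonneg _
  -- If no truncation had negative mean, monotone convergence would make `psi` integrable.
  set g : ℕ → (ℤ → ℝ) → ℝ := fun K ζ => max (psi κ h β ζ) (-K) with hg
  have hgm : ∀ K, Measurable (g K) := fun K => measurable_psi.max measurable_const
  have hgi : ∀ K, Integrable (g K) P := fun K => by
    refine Integrable.of_bound (C := M + K) (hgm K).aestronglyMeasurable ?_
    filter_upwards [hup] with ζ hζ
    have hK : (0 : ℝ) ≤ K := Nat.cast_nonneg K
    rw [Real.norm_eq_abs, abs_le]
    exact ⟨by have := le_max_right (psi κ h β ζ) (-(K : ℝ)); simp only [hg]; linarith,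
      max_le (by linarith) (by linarith)⟩
  by_contra hcon
  push Not at hcon
  have hge : ∀ K, 0 ≤ ∫ ζ, g K ζ ∂P := fun K =>
    hcon (g K) (hgm K) (hgi K) fun ζ => le_max_left _ _
  apply hint
  have hlin : ∫⁻ ζ, ENNReal.ofReal (M - psi κ h β ζ) ∂P ≤ ENNReal.ofReal M := by
    have hsup : ∀ ζ, ENNReal.ofReal (M - psi κ h β ζ) = ⨆ K, ENNReal.ofReal (M - g K ζ) := by
      intro ζ
      refine le_antisymm ?_ (iSup_le fun K => ENNReal.ofReal_le_ofReal
        (sub_le_sub_left (le_max_left _ _) _))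
      obtain ⟨K, hK⟩ := exists_nat_ge (-psi κ h β ζ)
      refine le_iSup_of_le K (ENNReal.ofReal_le_ofReal ?_)
      simp only [hg]
      rw [max_eq_left (by linarith)]
    simp_rw [hsup]
    rw [lintegral_iSup (f := fun K ζ => ENNReal.ofReal (M - g K ζ))
      (fun K => (measurable_const.sub (hgm K)).ennreal_ofReal)]
    · refine iSup_le fun K => ?_
      rw [← ofReal_integral_eq_lintegral_ofReal (f := fun ζ => M - g K ζ)
        ((integrable_const M).sub (hgi K))]
      · refine ENNReal.ofReal_le_ofReal ?_
        rw [integral_sub (integrable_const M) (hgi K)]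
        have := hge K
        simp
        linarith
      · filter_upwards [hup] with ζ hζ
        have hK : (0 : ℝ) ≤ K := Nat.cast_nonneg K
        exact sub_nonneg.mpr (max_le hζ (by linarith))
    · intro K K' hKK ζ
      refine ENNReal.ofReal_le_ofReal (sub_le_sub_left (max_le_max le_rfl ?_) _)
      have : (K : ℝ) ≤ K' := by exact_mod_cast hKK
      linarith
  have hi : Integrable (fun ζ => M - psi κ h β ζ) P := by
    refine ⟨(measurable_const.sub measurable_psi).aestronglyMeasurable, ?_⟩
    rw [hasFiniteIntegral_iff_ofReal]
    · exact hlin.trans_lt ENNReal.ofReal_lt_top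
    · filter_upwards [hup] with ζ hζ using sub_nonneg.mpr hζ
  exact ((integrable_const M).sub hi).congr (Eventually.of_forall fun ζ => by simp)

/-! ### The functions `L⁺`, `L⁻` and `L` -/

theorem hittingFunctional_eq_phi (hκ : 0 < κ) (hh : h ∈ Ioc (0 : ℝ) 1) (ζ : ℤ → ℝ) :
    hittingFunctional κ h ζ β = phi κ h β ζ :=
  hittingFunctional_eq_passage hκ hh ζ β

theorem LPlus_eq (hκ : 0 < κ) (hh : h ∈ Ioc (0 : ℝ) 1) (hfin : ∀ᵐ ζ ∂P, phi κ h β ζ ≠ ∞) :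
    LPlus κ h P β = ∫⁻ ζ, ENNReal.ofReal (psi κ h β ζ) ∂P := by
  refine lintegral_congr_ae ?_
  filter_upwards [hfin] with ζ hζ
  rw [hittingFunctional_eq_phi hκ hh, log_phi hκ hh hζ, EReal.toENNReal_of_ne_top (by simp)]
  simp

theorem LMinus_eq (hκ : 0 < κ) (hh : h ∈ Ioc (0 : ℝ) 1) (hfin : ∀ᵐ ζ ∂P, phi κ h β ζ ≠ ∞) :
    LMinus κ h P β = ∫⁻ ζ, ENNReal.ofReal (-psi κ h β ζ) ∂P := by
  refine lintegral_congr_ae ?_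
  filter_upwards [hfin] with ζ hζ
  rw [hittingFunctional_eq_phi hκ hh, log_phi hκ hh hζ, ← EReal.coe_neg,
    EReal.toENNReal_of_ne_top (by simp)]
  simp

theorem LPlus_lt_top [IsProbabilityMeasure P] (hκ : 0 < κ) (hh : h ∈ Ioc (0 : ℝ) 1)
    (hbd : ∃ C : ℝ≥0∞, C ≠ ∞ ∧ ∀ᵐ ζ ∂P, phi κ h β ζ ≤ C) : LPlus κ h P β < ∞ := by
  obtain ⟨C, hC, hCb⟩ := hbd
  rw [LPlus]
  calc ∫⁻ ζ, (ENNReal.log (hittingFunctional κ h ζ β)).toENNReal ∂P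
      ≤ ∫⁻ _, (ENNReal.log C).toENNReal ∂P := by
        refine lintegral_mono_ae ?_
        filter_upwards [hCb] with ζ hζ
        rw [hittingFunctional_eq_phi hκ hh]
        exact EReal.toENNReal_le_toENNReal (ENNReal.log_monotone hζ)
    _ < ∞ := by
        have : ENNReal.log C ≠ ⊤ := by simpa using hC
        simp [lt_top_iff_ne_top, this]

theorem LPlus_eq_top (hκ : 0 < κ) (hh : h ∈ Ioc (0 : ℝ) 1)
    (hinf : ¬ ∀ᵐ ζ ∂P, phi κ h β ζ ≠ ∞) : LPlus κ h P β = ∞ := by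
  rw [LPlus]
  have hm : Measurable fun ζ => (ENNReal.log (phi κ h β ζ)).toENNReal :=
    measurable_phi.ennreal_log.ereal_toENNReal
  simp_rw [hittingFunctional_eq_phi hκ hh]
  by_contra hne
  refine hinf ?_
  filter_upwards [ae_lt_top hm hne] with ζ hζ htop
  simp [htop] at hζ

theorem isCriticalValue_of_threshold [IsProbabilityMeasure P] (hκ : 0 < κ)
    (hh : h ∈ Ioc (0 : ℝ) 1)
    (hbd : ∀ β < βcr, ∃ C : ℝ≥0∞, C ≠ ∞ ∧ ∀ᵐ ζ ∂P, phi κ h β ζ ≤ C)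
    (hinf : ∀ β, βcr < β → ¬ ∀ᵐ ζ ∂P, phi κ h β ζ ≠ ∞) : IsCriticalValue κ h P βcr :=
  ⟨fun β hβ => LPlus_eq_top hκ hh (hinf β hβ), fun β hβ => LPlus_lt_top hκ hh (hbd β hβ)⟩

/-- Since `L⁺` is finite here, `L⁻ = ∞` would mean `L = -∞`. A zero of `L` therefore includes
integrability of `psi`. -/
theorem L_eq_zero_iff [IsProbabilityMeasure P] (hκ : 0 < κ) (hh : h ∈ Ioc (0 : ℝ) 1)
    (hbd : ∃ C : ℝ≥0∞, C ≠ ∞ ∧ ∀ᵐ ζ ∂P, phi κ h β ζ ≤ C) :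
    L κ h P β = 0 ↔ Integrable (psi κ h β) P ∧ ell κ h P β = 0 := by
  have hfin : ∀ᵐ ζ ∂P, phi κ h β ζ ≠ ∞ := by
    obtain ⟨C, hC, hCb⟩ := hbd
    filter_upwards [hCb] with ζ hζ using ne_top_of_le_ne_top hC hζ
  have hp := LPlus_lt_top hκ hh hbd
  have e1 := LPlus_eq hκ hh hfin
  have e2 := LMinus_eq hκ hh hfin
  by_cases hm : LMinus κ h P β = ∞
  · constructor
    · intro h0
      rw [L, hm] at h0
      lift LPlus κ h P β to NNReal using hp.ne with r
      simp at h0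
    · rintro ⟨hi, -⟩
      exfalso
      have h1 := hi.neg.lintegral_lt_top
      rw [e2] at hm
      exact h1.ne hm
  · have hi : Integrable (psi κ h β) P := by
      refine ⟨measurable_psi.aestronglyMeasurable, ?_⟩
      rw [hasFiniteIntegral_iff_norm]
      have : ∀ ζ, ENNReal.ofReal ‖psi κ h β ζ‖ =
          ENNReal.ofReal (psi κ h β ζ) + ENNReal.ofReal (-psi κ h β ζ) := by
        intro ζ
        rcases le_total 0 (psi κ h β ζ) with h0 | h0
        · rw [Real.norm_of_nonneg h0, ENNReal.ofReal_of_nonpos (neg_nonpos.mpr h0), add_zero]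
        · rw [Real.norm_of_nonpos h0, ENNReal.ofReal_of_nonpos h0, zero_add]
      simp_rw [this]
      rw [lintegral_add_left measurable_psi.ennreal_ofReal, ← e1, ← e2]
      exact ENNReal.add_lt_top.mpr ⟨hp, lt_top_iff_ne_top.mpr hm⟩
    have h1 : ell κ h P β = (LPlus κ h P β).toReal - (LMinus κ h P β).toReal := by
      rw [ell, integral_eq_lintegral_pos_part_sub_lintegral_neg_part hi, e1, e2]
    have h2 : L κ h P β = ((ell κ h P β : ℝ) : EReal) := by
      rw [L, h1, EReal.coe_sub, EReal.coe_ennreal_toReal hp.ne, EReal.coe_ennreal_toReal hm]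
    rw [h2]
    simp [hi]

end Annealed

end PAM

namespace PAM

/-! ### Positive solutions built from the passage functional -/

section Harmonic

/-- The multiplicative cocycle of a function on `ℤ`, normalised to be `1` at `0`. -/
noncomputable def cocycle (f : ℤ → ℝ) (x : ℤ) : ℝ :=
  (∏ j ∈ Finset.range x.toNat, f (j + 1)) * (∏ j ∈ Finset.range (-x).toNat, f (-j))⁻¹

variable {f : ℤ → ℝ}

theorem cocycle_natCast (n : ℕ) : cocycle f n = ∏ j ∈ Finset.range n, f (j + 1) := by
  simp [cocycle]

theorem cocycle_neg_natCast (n : ℕ) : cocycle f (-n) = (∏ j ∈ Finset.range n, f (-j))⁻¹ := by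
  simp [cocycle]

theorem cocycle_zero : cocycle f 0 = 1 := by simp [cocycle]

theorem cocycle_pos (hf : ∀ x, 0 < f x) (x : ℤ) : 0 < cocycle f x :=
  mul_pos (Finset.prod_pos fun _ _ => hf _) (inv_pos.mpr (Finset.prod_pos fun _ _ => hf _))

theorem cocycle_eq (hf : ∀ x, 0 < f x) (x : ℤ) : cocycle f x = f x * cocycle f (x - 1) := by
  rcases le_or_gt x 0 with hx | hx
  · obtain ⟨n, rfl⟩ := Int.exists_eq_neg_ofNat hx
    rw [show -(n : ℤ) - 1 = -((n + 1 : ℕ) : ℤ) by push_cast; ring, cocycle_neg_natCast,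
      cocycle_neg_natCast, Finset.prod_range_succ, mul_inv]
    have := (hf (-n)).ne'
    field_simp
  · obtain ⟨n, rfl⟩ : ∃ n : ℕ, x = (n + 1 : ℕ) := ⟨(x - 1).toNat, by omega⟩
    rw [show ((n + 1 : ℕ) : ℤ) - 1 = n by push_cast; ring, cocycle_natCast, cocycle_natCast,
      Finset.prod_range_succ, mul_comm]
    push_cast
    rfl

variable {κ h β : ℝ} {ζ : ℤ → ℝ}

/-- The hypothesis that `f` solves the recursion of the passage functional. -/
def IsPassageSolution (κ h β : ℝ) (ζ : ℤ → ℝ) (f : ℤ → ℝ) : Prop :=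
  (∀ x, 0 < f x) ∧ ∀ x, (κ - ζ x - β) * f x =
    κ * ((1 + h) / 2 + (1 - h) / 2 * (f (x + 1) * f x))

theorem IsPassageSolution.cocycle_harmonic (hf : IsPassageSolution κ h β ζ f) (x : ℤ) :
    κ * driftLaplacian (-h) (cocycle f) x + (ζ x + β) * cocycle f x = 0 := by
  have h1 := cocycle_eq hf.1 x
  have h2 := cocycle_eq hf.1 (x + 1)
  rw [add_sub_cancel_right] at h2
  have h3 := hf.2 x
  simp only [driftLaplacian]
  rw [h2, h1]
  linear_combination (-cocycle f (x - 1)) * h3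

/-- The factor `((1 - h) / (1 + h)) ^ x` comes from the reversible measure of the walk and
conjugates drift `-h` into drift `h`. -/
theorem IsPassageSolution.cocycle_harmonic_dual (hf : IsPassageSolution κ h β ζ f)
    (hh : h ∈ Ioo (0 : ℝ) 1) (x : ℤ) :
    κ * driftLaplacian h (fun x => ((1 - h) / (1 + h)) ^ x * cocycle f x) x +
      (ζ x + β) * (((1 - h) / (1 + h)) ^ x * cocycle f x) = 0 := by
  have h0 := hf.cocycle_harmonic x
  have hp : 0 < 1 + h := by linarith [hh.1]
  have hm : 0 < 1 - h := by linarith [hh.2]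
  have hr : (1 - h) / (1 + h) ≠ 0 := (div_pos hm hp).ne'
  simp only [driftLaplacian] at h0 ⊢
  rw [zpow_add_one₀ hr, zpow_sub_one₀ hr]
  have e1 : (1 + h) / 2 * ((1 - h) / (1 + h)) = (1 - h) / 2 := by field_simp
  have e2 : (1 - h) / 2 * ((1 - h) / (1 + h))⁻¹ = (1 + h) / 2 := by field_simp
  linear_combination (((1 - h) / (1 + h)) ^ x) * h0 +
    κ * ((1 - h) / (1 + h)) ^ x * cocycle f (x + 1) * e1 +
    κ * ((1 - h) / (1 + h)) ^ x * cocycle f (x - 1) * e2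

theorem IsPassageSolution.kernel_le (hf : IsPassageSolution κ h β ζ f) (hκ : 0 < κ)
    (hh : h ∈ Ioc (0 : ℝ) 1) (hζ : ∀ x, ζ x ≤ 0) {t : ℝ} (ht : 0 ≤ t) (y : ℤ) :
    kernel κ h ζ 0 y t ≤ Real.exp (-(β * t)) * cocycle f y := by
  have hh' : -h ∈ Icc (-1 : ℝ) 1 := ⟨by linarith [hh.2], by linarith [hh.1]⟩
  refine (isHeatFlow_kernel_dual hκ hh hζ 0).le_exp_mul hκ.le hh' hζ
    (fun x => (cocycle_pos hf.1 x).le) (fun x => (hf.cocycle_harmonic x).le) (fun x => ?_) ht y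
  by_cases hx : x = 0
  · simp [hx, cocycle_zero]
  · simpa [hx] using (cocycle_pos hf.1 x).le

/-- For `h = 1` all steps go to the right, so the indicator of `(-∞, -n]` is a supersolution that
vanishes at `0`. -/
theorem kernel_neg_nonpos (hκ : 0 < κ) (hh : h = 1) (hζ : ∀ x, ζ x ≤ 0) {t : ℝ} (ht : 0 ≤ t)
    {n : ℕ} (hn : 0 < n) : kernel κ h ζ 0 (-n) t ≤ 0 := by
  have hh' : h ∈ Ioc (0 : ℝ) 1 := by rw [hh]; norm_num
  have := (isHeatFlow_kernel hκ hh' hζ (-n)).le_exp_mul hκ.le ⟨by linarith, by linarith⟩ hζ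
    (H := fun x => if x ≤ -n then 1 else 0) (β := 0) (fun x => by positivity) (fun x => ?_)
    (fun x => ?_) ht 0
  · simpa [hn.ne'] using this
  · simp only [driftLaplacian, hh]
    by_cases h1 : x ≤ -n
    · by_cases h2 : x + 1 ≤ -n
      · simp [h1, h2, hζ x]
      · simp [h1, h2]; linarith [hζ x]
    · simp [h1, show ¬ x + 1 ≤ -n by omega]
  · by_cases h1 : x = -n
    · simp [h1]
    · simp only [h1, if_false]; positivity

/-- For endpoints on the left, `kernel_le` gives the inverse of the product, which is useless when
the product decays. Comparison in the starting point instead, with the conjugated cocycle, puts the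
product in the numerator. -/
theorem IsPassageSolution.kernel_neg_le (hf : IsPassageSolution κ h β ζ f) (hκ : 0 < κ)
    (hh : h ∈ Ioc (0 : ℝ) 1) (hζ : ∀ x, ζ x ≤ 0) {t : ℝ} (ht : 0 ≤ t) (n : ℕ) :
    kernel κ h ζ 0 (-n) t ≤ Real.exp (-(β * t)) * ∏ j ∈ Finset.range n, f (-j) := by
  have hprod : 0 < ∏ j ∈ Finset.range n, f (-j) := Finset.prod_pos fun _ _ => hf.1 _
  rcases hh.2.lt_or_eq with hlt | heq
  · have hp : 0 < 1 + h := by linarith [hh.1]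
    have hr : 0 < (1 - h) / (1 + h) := div_pos (by linarith) hp
    have hr1 : (1 - h) / (1 + h) ≤ 1 := by rw [div_le_one hp]; linarith [hh.1]
    set r := (1 - h) / (1 + h) with hrdef
    -- Normalises the supersolution to be `1` at `-n`. Its value at `0` is then `r ^ n` times the
    -- product, and `r ^ n ≤ 1` is discarded.
    set c : ℝ := (r ^ (-(n : ℤ)) * cocycle f (-n))⁻¹ with hc
    have hc0 : 0 < c := inv_pos.mpr (mul_pos (zpow_pos hr _) (cocycle_pos hf.1 _))
    have := (isHeatFlow_kernel hκ hh hζ (-n)).le_exp_mul hκ.le ⟨by linarith [hh.1], hh.2⟩ hζ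
      (H := fun x => c * (r ^ x * cocycle f x)) (β := β)
      (fun x => (mul_pos hc0 (mul_pos (zpow_pos hr _) (cocycle_pos hf.1 _))).le) (fun x => ?_)
      (fun x => ?_) ht 0
    · refine this.trans (mul_le_mul_of_nonneg_left ?_ (Real.exp_pos _).le)
      rw [zpow_zero, cocycle_zero, mul_one, mul_one, hc, cocycle_neg_natCast, mul_inv, inv_inv,
        zpow_neg, inv_inv, zpow_natCast]
      exact mul_le_of_le_one_left hprod.le (pow_le_one₀ hr.le hr1)
    · rw [driftLaplacian_const_mul]
      have := hf.cocycle_harmonic_dual ⟨hh.1, hlt⟩ x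
      rw [← hrdef] at this
      have h2 : κ * (c * driftLaplacian h (fun y => r ^ y * cocycle f y) x) +
          (ζ x + β) * (c * (r ^ x * cocycle f x)) = 0 := by linear_combination c * this
      exact h2.le
    · by_cases h1 : x = -n
      · simp only [h1, if_true]
        exact (inv_mul_cancel₀ (mul_pos (zpow_pos hr _) (cocycle_pos hf.1 _)).ne').ge
      · simp only [h1, if_false]
        exact (mul_pos hc0 (mul_pos (zpow_pos hr _) (cocycle_pos hf.1 _))).le
  · rcases Nat.eq_zero_or_pos n with rfl | hn
    · have := hf.kernel_le hκ hh hζ ht 0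
      simpa [cocycle_zero] using this
    · exact (kernel_neg_nonpos hκ heq hζ ht hn).trans
        (mul_pos (Real.exp_pos _) hprod).le

/-- The passage functionals of the shifted potentials solve the recursion. -/
theorem isPassageSolution_passage (hκ : 0 < κ) (hh : h ∈ Ioc (0 : ℝ) 1)
    (hfin : ∀ n : ℕ, phi κ h β (shift^[n] ζ) ≠ ∞ ∧ phi κ h β (shiftEquiv.symm^[n] ζ) ≠ ∞) :
    IsPassageSolution κ h β ζ
      (fun x => (passage (stepLeft h) (stepRight h) (visitWeight κ ζ β) x).toReal) := by
  have hphi : ∀ x : ℤ, passage (stepLeft h) (stepRight h) (visitWeight κ ζ β) x =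
      phi κ h β (fun y => ζ (y + (x - 1))) := fun x => by rw [phi_comp_add]; ring_nf
  have hne : ∀ x : ℤ, phi κ h β (fun y => ζ (y + (x - 1))) ≠ ∞ := by
    intro x
    rw [← hphi]
    rcases le_or_gt x 0 with hx | hx
    · obtain ⟨n, hn⟩ := Int.exists_eq_neg_ofNat hx
      have h1 := (hfin (n + 1)).2
      rw [phi_symm_iterate] at h1
      rwa [show (1 : ℤ) - (n + 1 : ℕ) = x by push_cast; omega] at h1
    · have h1 := (hfin (x - 1).toNat).1
      rw [phi_shift_iterate] at h1
      rwa [show (((x - 1).toNat : ℕ) : ℤ) + 1 = x by omega] at h1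
  refine ⟨fun x => ?_, fun x => ?_⟩
  · simp only
    rw [hphi]
    exact toReal_phi_pos hκ hh (hne x)
  · have h1 := pos_of_phi_ne_top hκ hh (hne x)
    simp only [show (1 : ℤ) + (x - 1) = x by ring] at h1
    have h2 := congrArg ENNReal.toReal
      (passage_eq (a := stepLeft h) (b := stepRight h) (c := visitWeight κ ζ β) x)
    have hn := fun x => hphi x ▸ hne x
    rw [visitWeight_eq_ofReal h1, ENNReal.toReal_mul, ENNReal.toReal_ofReal (by positivity),
      ENNReal.toReal_add stepLeft_ne_top (ENNReal.mul_ne_top stepRight_ne_top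
        (ENNReal.mul_ne_top (hn _) (hn _))), ENNReal.toReal_mul, ENNReal.toReal_mul,
      toReal_stepLeft hh, toReal_stepRight hh] at h2
    simp only
    conv_lhs => rw [h2]
    field_simp

theorem prod_toReal_passage (hκ : 0 < κ) (hh : h ∈ Ioc (0 : ℝ) 1)
    (hfin : ∀ n : ℕ, phi κ h β (shift^[n] ζ) ≠ ∞) (n : ℕ) :
    ∏ j ∈ Finset.range n, (passage (stepLeft h) (stepRight h) (visitWeight κ ζ β) (j + 1)).toReal =
      Real.exp (birkhoffSum shift (psi κ h β) n ζ) := by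
  rw [birkhoffSum, Real.exp_sum]
  refine Finset.prod_congr rfl fun j _ => ?_
  rw [exp_psi hκ hh (hfin j), phi_shift_iterate]

theorem prod_toReal_passage_neg (hκ : 0 < κ) (hh : h ∈ Ioc (0 : ℝ) 1)
    (hfin : ∀ n : ℕ, phi κ h β (shiftEquiv.symm^[n] ζ) ≠ ∞) (n : ℕ) :
    ∏ j ∈ Finset.range n, (passage (stepLeft h) (stepRight h) (visitWeight κ ζ β) (-j)).toReal =
      Real.exp (birkhoffSum shiftEquiv.symm (psi κ h β) n (shiftEquiv.symm ζ)) := by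
  rw [birkhoffSum, Real.exp_sum]
  refine Finset.prod_congr rfl fun j _ => ?_
  rw [← Function.iterate_succ_apply, exp_psi hκ hh (hfin (j + 1)), phi_symm_iterate]
  congr 2
  push_cast
  ring

end Harmonic

/-! ### The upper bound -/

section Upper

variable {κ h β : ℝ} {P : Measure (ℤ → ℝ)}

theorem summable_exp_sub_natAbs {K η : ℝ} (hη : 0 < η) :
    Summable fun y : ℤ => Real.exp (K - η * y.natAbs) := by
  have h1 : Summable fun n : ℕ => Real.exp (K - η * n) := by
    have h2 : Summable fun n : ℕ => Real.exp K * Real.exp (-η) ^ n :=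
      (summable_geometric_of_lt_one (Real.exp_pos _).le
        (by rw [← Real.exp_zero]; exact Real.exp_lt_exp.mpr (by linarith))).mul_left _
    refine h2.congr fun n => ?_
    rw [← Real.exp_nat_mul, ← Real.exp_add]
    ring_nf
  exact Summable.of_nat_of_neg (by simpa using h1) (by simpa using h1)

/-- Negative mean makes the products of passage functionals decay exponentially in both directions,
so the pointwise kernel bounds can be summed over endpoints. The majorant `g` covers the case where
`psi` has mean `-∞`. -/
theorem IsAdmissible.ae_exists_kernelMass_le [IsProbabilityMeasure P] (hP : IsAdmissible P)
    (hκ : 0 < κ) (hh : h ∈ Ioc (0 : ℝ) 1) (hfin : ∀ᵐ ζ ∂P, phi κ h β ζ ≠ ∞)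
    {g : (ℤ → ℝ) → ℝ} (hgm : Measurable g) (hgi : Integrable g P) (hg : ∀ ζ, psi κ h β ζ ≤ g ζ)
    (hneg : ∫ ζ, g ζ ∂P < 0) :
    ∀ᵐ ζ ∂P, ∃ C : ℝ, ∀ t, 0 ≤ t → kernelMass κ h ζ 0 t ≤ C * Real.exp (-(β * t)) := by
  obtain ⟨η', h1, h2⟩ := exists_between hneg
  set η := -η' with hη
  have hη0 : 0 < η := by linarith
  have hsym := ergodic_shiftEquiv_symm hP.ergodic
  have hB1 := ae_birkhoffSum_le hP.ergodic hgm hgi h1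
  -- The bound is moved to `shiftEquiv.symm ζ` because the passage at `-j` is the functional of the
  -- potential shifted back `j + 1` times.
  have hB2 := hsym.quasiMeasurePreserving.ae (ae_birkhoffSum_le hsym hgm hgi h1)
  filter_upwards [hB1, hB2, ae_shift_iterate hP.ergodic hfin, hP.nonpos] with
    ζ ⟨K₁, hK₁⟩ ⟨K₂, hK₂⟩ hf hζ
  have hsol := isPassageSolution_passage hκ hh hf
  set K := max K₁ K₂ with hK
  have hbound : ∀ t, 0 ≤ t → ∀ y : ℤ, kernel κ h ζ 0 y t ≤
      Real.exp (-(β * t)) * Real.exp (K - η * y.natAbs) := by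
    intro t ht y
    rcases Int.natAbs_eq y with hy | hy
    · rw [hy]
      refine (hsol.kernel_le hκ hh hζ ht _).trans (mul_le_mul_of_nonneg_left ?_ (Real.exp_pos _).le)
      rw [cocycle_natCast, prod_toReal_passage hκ hh fun n => (hf n).1]
      refine Real.exp_le_exp.mpr ?_
      have h3 : birkhoffSum shift (psi κ h β) y.natAbs ζ ≤ birkhoffSum shift g y.natAbs ζ :=
        Finset.sum_le_sum fun j _ => hg _
      have h4 := hK₁ y.natAbs
      have h5 : K₁ ≤ K := le_max_left _ _
      simp only [Int.natAbs_natCast]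
      rw [hη]; linarith
    · rw [hy]
      refine (hsol.kernel_neg_le hκ hh hζ ht _).trans
        (mul_le_mul_of_nonneg_left ?_ (Real.exp_pos _).le)
      rw [prod_toReal_passage_neg hκ hh fun n => (hf n).2]
      refine Real.exp_le_exp.mpr ?_
      have h3 : birkhoffSum shiftEquiv.symm (psi κ h β) y.natAbs (shiftEquiv.symm ζ) ≤
          birkhoffSum shiftEquiv.symm g y.natAbs (shiftEquiv.symm ζ) :=
        Finset.sum_le_sum fun j _ => hg _
      have h4 := hK₂ y.natAbs
      have h5 : K₂ ≤ K := le_max_right _ _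
      simp only [Int.natAbs_neg, Int.natAbs_natCast]
      rw [hη]; linarith
  have hsum := summable_exp_sub_natAbs (K := K) hη0
  refine ⟨∑' y : ℤ, Real.exp (K - η * y.natAbs), fun t ht => ?_⟩
  rw [mul_comm]
  exact hasSum_le (hbound t ht) (hasSum_kernel hκ hh hζ 0 t) (hsum.hasSum.mul_left _)

end Upper

end PAM

namespace PAM

/-! ### Resolvents and the lower bound above the critical value -/

section Resolvent

variable {κ h β γ : ℝ} {ζ : ℤ → ℝ}

theorem laplaceTransform_kernelENN (β : ℝ) (x y : ℤ) :
    laplaceTransform β (kernelENN κ h ζ x y) =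
      (if x = y then (ENNReal.ofReal (κ - ζ y - β))⁻¹ else 0) + visitWeight κ ζ β y *
        (stepLeft h * laplaceTransform β (kernelENN κ h ζ x (y - 1)) +
          stepRight h * laplaceTransform β (kernelENN κ h ζ x (y + 1))) := by
  have h1 : laplaceTransform β (kernelENN κ h ζ x y) = (ENNReal.ofReal (κ - ζ y - β))⁻¹ *
      ((if x = y then 1 else 0) +
        (ENNReal.ofReal κ * stepLeft h * laplaceTransform β (kernelENN κ h ζ x (y - 1)) +
          ENNReal.ofReal κ * stepRight h * laplaceTransform β (kernelENN κ h ζ x (y + 1)))) :=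
    laplaceTransform_heatKernel β x y
  rw [h1, visitWeight, div_eq_mul_inv, mul_add]
  congr 1
  · split_ifs <;> simp
  · ring

/-- The weight of a passage is bounded by the resolvent on the diagonal. -/
theorem passage_le_laplaceTransform (β : ℝ) (x : ℤ) :
    passage (stepLeft h) (stepRight h) (visitWeight κ ζ β) x ≤
      ENNReal.ofReal κ * stepLeft h * laplaceTransform β (kernelENN κ h ζ x x) := by
  set V : ℤ → ℝ≥0∞ := fun y => if x ≤ y then
    ENNReal.ofReal κ * stepLeft h * laplaceTransform β (kernelENN κ h ζ x y) else 1 with hV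
  have := passage_mul_le (a := stepLeft h) (b := stepRight h) (c := visitWeight κ ζ β) (V := V)
    (x := x) fun y hy => ?_
  · simpa [hV] using this
  · rcases hy.eq_or_lt with rfl | hlt
    · simp only [hV, le_refl, if_true, show ¬ x ≤ x - 1 by omega, if_false,
        show x ≤ x + 1 by omega]
      rw [laplaceTransform_kernelENN β x x, if_pos rfl, mul_one, mul_add, mul_add]
      refine add_le_add ?_ ?_
      · rw [visitWeight, div_eq_mul_inv]
        exact le_of_eq (by ring)
      · calc _ = ENNReal.ofReal κ * stepLeft h * (visitWeight κ ζ β x *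
              (stepRight h * laplaceTransform β (kernelENN κ h ζ x (x + 1)))) := by ring
          _ ≤ _ := by gcongr; exact le_add_self
    · simp only [hV, hy, show x ≤ y - 1 by omega, show x ≤ y + 1 by omega, if_true]
      rw [laplaceTransform_kernelENN β x y, if_neg (by omega), zero_add]
      exact le_of_eq (by ring)

/-- An infinite passage forces the diagonal resolvent at `β` to diverge, which a kernel bounded by
`exp (-γ t)` with `γ > β` would not allow. -/
theorem exists_exp_lt_kernel (hκ : 0 < κ) (hh : h ∈ Ioc (0 : ℝ) 1) (hζ : ∀ x, ζ x ≤ 0)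
    (hβγ : β < γ) {x : ℤ}
    (htop : passage (stepLeft h) (stepRight h) (visitWeight κ ζ β) x = ∞) :
    ∃ t, 0 < t ∧ Real.exp (-(γ * t)) < kernel κ h ζ x x t := by
  by_contra! hcon
  have h1 := passage_le_laplaceTransform (κ := κ) (h := h) (ζ := ζ) β x
  rw [htop, top_le_iff] at h1
  refine ENNReal.mul_ne_top (ENNReal.mul_ne_top ENNReal.ofReal_ne_top stepLeft_ne_top) ?_ h1
  have h2 : laplaceTransform β (kernelENN κ h ζ x x) ≤
      ∫⁻ t in Ioi (0 : ℝ), ENNReal.ofReal (Real.exp (-((γ - β) * t))) := by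
    rw [laplaceTransform, ← lintegral_indicator measurableSet_Ioi]
    refine lintegral_mono_ae ?_
    have h0 : ∀ᵐ s : ℝ, s ≠ 0 := by simp [ae_iff]
    filter_upwards [h0] with t ht
    rcases lt_or_gt_of_ne ht with ht | ht
    · simp [kernelENN, heatKernel_of_neg x x ht]
    · rw [indicator_of_mem (mem_Ioi.mpr ht), ← ofReal_kernel hκ hh hζ,
        ← ENNReal.ofReal_mul (Real.exp_pos _).le]
      refine ENNReal.ofReal_le_ofReal ?_
      calc _ ≤ Real.exp (β * t) * Real.exp (-(γ * t)) :=
            mul_le_mul_of_nonneg_left (hcon t ht) (Real.exp_pos _).le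
        _ = _ := by rw [← Real.exp_add]; ring_nf
  rw [lintegral_Ioi_exp_mul] at h2
  refine ne_top_of_le_ne_top ?_ h2
  simpa using hβγ

theorem kernel_pow_le (hκ : 0 < κ) (hh : h ∈ Ioc (0 : ℝ) 1) (hζ : ∀ x, ζ x ≤ 0) (x : ℤ) {t : ℝ}
    (ht : 0 ≤ t) (n : ℕ) : kernel κ h ζ x x t ^ n ≤ kernel κ h ζ x x (n * t) := by
  have hf := isHeatFlow_kernel hκ hh hζ x
  induction n with
  | zero =>
    have := hf.exp_mul_initial_le hκ.le ⟨by linarith [hh.1], hh.2⟩ le_rfl x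
    simpa using this
  | succ n ih =>
    have h1 := hf.mul_kernel_le hκ hh hζ (s := n * t) (t := t) (by positivity) ht x x
    rw [pow_succ', show ((n + 1 : ℕ) : ℝ) * t = t + n * t by push_cast; ring]
    exact (mul_le_mul_of_nonneg_left ih (kernel_nonneg x x t)).trans h1

theorem exists_exp_le_kernelMass (hκ : 0 < κ) (hh : h ∈ Ioc (0 : ℝ) 1) (hζ : ∀ x, ζ x ≤ 0)
    (hγ : 0 ≤ γ) (hβγ : β < γ) {n : ℕ}
    (htop : passage (stepLeft h) (stepRight h) (visitWeight κ ζ β) n = ∞) :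
    ∃ c, 0 < c ∧ ∀ t, 1 ≤ t → c * Real.exp (-(γ * t)) ≤ kernelMass κ h ζ 0 t := by
  obtain ⟨t₀, ht₀, hlt⟩ := exists_exp_lt_kernel hκ hh hζ hβγ htop
  have hk : 0 < kernel κ h ζ 0 n 1 := by simpa using kernel_pos hκ hh hζ n n one_pos
  -- One unit of time is spent going from `0` to `n`, and the rest on returns to `n` after multiples
  -- of `t₀`. The factor `exp (-(γ * t₀))` pays for rounding up to a multiple; the mass decreases in
  -- time, so overshooting is harmless.
  refine ⟨kernel κ h ζ 0 n 1 * Real.exp (-(γ * t₀)), mul_pos hk (Real.exp_pos _), fun t ht => ?_⟩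
  have h1 := (isHeatFlow_kernelMass hκ hh hζ).mul_kernel_le hκ hh hζ (s := t - 1) (t := 1)
    (by linarith) zero_le_one 0 n
  rw [add_sub_cancel] at h1
  refine le_trans ?_ h1
  rw [mul_assoc]
  refine mul_le_mul_of_nonneg_left ?_ hk.le
  set m := ⌈(t - 1) / t₀⌉₊ with hm
  have hm1 : t - 1 ≤ m * t₀ := (div_le_iff₀ ht₀).mp (Nat.le_ceil _)
  have hm2 : m * t₀ ≤ t - 1 + t₀ := by
    have := (Nat.ceil_lt_add_one (a := (t - 1) / t₀) (div_nonneg (by linarith) ht₀.le)).le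
    calc m * t₀ ≤ ((t - 1) / t₀ + 1) * t₀ := by gcongr
      _ = t - 1 + t₀ := by field_simp
  calc Real.exp (-(γ * t₀)) * Real.exp (-(γ * t)) ≤ Real.exp (-(γ * t₀)) ^ m := by
        rw [← Real.exp_add, ← Real.exp_nat_mul]
        refine Real.exp_le_exp.mpr ?_
        nlinarith [mul_le_mul_of_nonneg_left hm2 hγ]
    _ ≤ kernel κ h ζ n n t₀ ^ m := by gcongr
    _ ≤ kernel κ h ζ n n (m * t₀) := kernel_pow_le hκ hh hζ n ht₀.le m
    _ ≤ kernelMass κ h ζ n (m * t₀) := kernel_le_kernelMass hκ hh hζ _ _ _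
    _ ≤ _ := kernelMass_antitone hκ hh hζ n (by linarith) hm1

variable {P : Measure (ℤ → ℝ)}

/-- Birkhoff sums of minus the indicator of `s` tend to `-∞`, whereas they would all vanish if the
orbit never met `s`. -/
theorem IsAdmissible.ae_exists_shift_mem (hP : IsAdmissible P) [IsProbabilityMeasure P]
    {s : Set (ℤ → ℝ)} (hs : MeasurableSet s) (h0 : P s ≠ 0) :
    ∀ᵐ ζ ∂P, ∃ n : ℕ, shift^[n] ζ ∈ s := by
  set g : (ℤ → ℝ) → ℝ := s.indicator fun _ => -1 with hg
  have hgm : Measurable g := measurable_const.indicator hs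
  have hgi : Integrable g P := (integrable_const _).indicator hs
  have hint : ∫ ζ, g ζ ∂P < 0 := by
    rw [hg, integral_indicator hs, setIntegral_const, smul_eq_mul, mul_neg, mul_one, neg_lt_zero]
    exact ENNReal.toReal_pos h0 (measure_ne_top _ _)
  obtain ⟨η, h1, h2⟩ := exists_between hint
  filter_upwards [ae_birkhoffSum_le hP.ergodic hgm hgi h1] with ζ ⟨K, hK⟩
  by_contra! hcon
  have hzero : ∀ n, birkhoffSum shift g n ζ = 0 := fun n =>
    Finset.sum_eq_zero fun j _ => indicator_of_notMem (hcon j) _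
  obtain ⟨n, hn⟩ := exists_nat_gt (K / -η)
  have := hK n
  rw [hzero] at this
  rw [div_lt_iff₀ (by linarith)] at hn
  linarith

theorem IsAdmissible.ae_exists_exp_le_kernelMass [IsProbabilityMeasure P] (hP : IsAdmissible P)
    (hκ : 0 < κ) (hh : h ∈ Ioc (0 : ℝ) 1) (hinf : ¬ ∀ᵐ ζ ∂P, phi κ h β ζ ≠ ∞) (hγ : 0 ≤ γ)
    (hβγ : β < γ) :
    ∀ᵐ ζ ∂P, ∃ c, 0 < c ∧ ∀ t, 1 ≤ t → c * Real.exp (-(γ * t)) ≤ kernelMass κ h ζ 0 t := by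
  have hs : MeasurableSet {ζ | phi κ h β ζ = ∞} := measurable_phi (measurableSet_singleton _)
  have h0 : P {ζ | phi κ h β ζ = ∞} ≠ 0 := by
    intro h0
    refine hinf ?_
    rw [ae_iff]
    simpa using h0
  filter_upwards [hP.ae_exists_shift_mem hs h0, hP.nonpos] with ζ ⟨n, hn⟩ hζ
  replace hn : phi κ h β (shift^[n] ζ) = ∞ := hn
  rw [phi_shift_iterate] at hn
  exact exists_exp_le_kernelMass hκ hh hζ hγ hβγ (n := n + 1) (by exact_mod_cast hn)

end Resolvent

end PAM

namespace PAM

/-! ### The lower bound at differentiability points -/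

section Derivative

variable {κ h β γ : ℝ} {ζ : ℤ → ℝ}

theorem lintegral_Iic_exp_mul {δ : ℝ} (hδ : 0 < δ) (s : ℝ) :
    ∫⁻ t in Iic s, ENNReal.ofReal (Real.exp (δ * t)) = ENNReal.ofReal (Real.exp (δ * s) / δ) := by
  rw [← ofReal_integral_eq_lintegral_ofReal (integrableOn_exp_mul_Iic hδ s)
    (Eventually.of_forall fun _ => (Real.exp_pos _).le), integral_exp_mul_Iic hδ]

theorem lintegral_Ioi_exp_neg_mul {δ : ℝ} (hδ : 0 < δ) (s : ℝ) :
    ∫⁻ t in Ioi s, ENNReal.ofReal (Real.exp (-δ * t)) =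
      ENNReal.ofReal (Real.exp (-δ * s) / δ) := by
  rw [← ofReal_integral_eq_lintegral_ofReal (integrableOn_exp_mul_Ioi (neg_lt_zero.mpr hδ) s)
    (Eventually.of_forall fun _ => (Real.exp_pos _).le), integral_exp_mul_Ioi (neg_lt_zero.mpr hδ)]
  congr 1
  field_simp

/-- A Chernoff-type splitting: the parameter `β - δ` controls times before `s₁`, `β + δ` controls
times after `s₂`, and in between the kernel is bounded by the mass at `s₁`. -/
theorem laplaceTransform_kernelENN_le (hκ : 0 < κ) (hh : h ∈ Ioc (0 : ℝ) 1) (hζ : ∀ x, ζ x ≤ 0)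
    (hβ : 0 ≤ β) {δ s₁ s₂ F₁ F₂ : ℝ} (hδ : 0 < δ) (hs₁ : 0 ≤ s₁) (hs : s₁ ≤ s₂) (hF₁ : 0 ≤ F₁)
    (hF₂ : 0 ≤ F₂) {y : ℤ}
    (h₁ : ∀ t, 0 ≤ t → kernel κ h ζ 0 y t ≤ Real.exp (-((β - δ) * t)) * F₁)
    (h₂ : ∀ t, 0 ≤ t → kernel κ h ζ 0 y t ≤ Real.exp (-((β + δ) * t)) * F₂) :
    laplaceTransform β (kernelENN κ h ζ 0 y) ≤ ENNReal.ofReal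
      (F₁ * (Real.exp (δ * s₁) / δ) + (s₂ - s₁) * (Real.exp (β * s₂) * kernelMass κ h ζ 0 s₁) +
        F₂ * (Real.exp (-δ * s₂) / δ)) := by
  have hm : 0 ≤ kernelMass κ h ζ 0 s₁ := (kernelMass_pos hκ hh hζ 0 hs₁).le
  have hd : 0 ≤ s₂ - s₁ := sub_nonneg.mpr hs
  have huniv : (univ : Set ℝ) = Iic s₁ ∪ Ioc s₁ s₂ ∪ Ioi s₂ := by
    rw [Iic_union_Ioc_eq_Iic hs, Iic_union_Ioi]
  rw [laplaceTransform, ← setLIntegral_univ, huniv, ENNReal.ofReal_add (by positivity)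
    (by positivity), ENNReal.ofReal_add (by positivity) (by positivity)]
  refine (lintegral_union_le _ _ _).trans (add_le_add ((lintegral_union_le _ _ _).trans
    (add_le_add ?_ ?_)) ?_)
  · rw [ENNReal.ofReal_mul hF₁, ← lintegral_Iic_exp_mul hδ,
      ← lintegral_const_mul' _ _ ENNReal.ofReal_ne_top]
    refine lintegral_mono fun t => ?_
    rcases lt_or_ge t 0 with ht | ht
    · simp [kernelENN, heatKernel_of_neg _ _ ht]
    · rw [← ofReal_kernel hκ hh hζ, ← ENNReal.ofReal_mul (Real.exp_pos _).le,
        ← ENNReal.ofReal_mul hF₁]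
      refine ENNReal.ofReal_le_ofReal ?_
      calc _ ≤ Real.exp (β * t) * (Real.exp (-((β - δ) * t)) * F₁) :=
            mul_le_mul_of_nonneg_left (h₁ t ht) (Real.exp_pos _).le
        _ = _ := by rw [← mul_assoc, ← Real.exp_add, mul_comm]; ring_nf
  · calc _ ≤ ∫⁻ t in Ioc s₁ s₂, ENNReal.ofReal (Real.exp (β * s₂) * kernelMass κ h ζ 0 s₁) := by
          refine setLIntegral_mono measurable_const fun t ht => ?_
          have ht0 : 0 ≤ t := hs₁.trans ht.1.le
          rw [← ofReal_kernel hκ hh hζ, ← ENNReal.ofReal_mul (Real.exp_pos _).le]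
          refine ENNReal.ofReal_le_ofReal (mul_le_mul ?_ ?_ (kernel_nonneg _ _ _)
            (Real.exp_pos _).le)
          · exact Real.exp_le_exp.mpr (mul_le_mul_of_nonneg_left ht.2 hβ)
          · exact (kernel_le_kernelMass hκ hh hζ 0 y t).trans
              (kernelMass_antitone hκ hh hζ 0 hs₁ ht.1.le)
      _ = _ := by
          rw [setLIntegral_const, Real.volume_Ioc, mul_comm, ← ENNReal.ofReal_mul hd]
  · rw [ENNReal.ofReal_mul hF₂, ← lintegral_Ioi_exp_neg_mul hδ,
      ← lintegral_const_mul' _ _ ENNReal.ofReal_ne_top]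
    refine setLIntegral_mono (by fun_prop) fun t ht => ?_
    have ht0 : 0 ≤ t := (hs₁.trans hs).trans (le_of_lt ht)
    rw [← ofReal_kernel hκ hh hζ, ← ENNReal.ofReal_mul (Real.exp_pos _).le,
      ← ENNReal.ofReal_mul hF₂]
    refine ENNReal.ofReal_le_ofReal ?_
    calc _ ≤ Real.exp (β * t) * (Real.exp (-((β + δ) * t)) * F₂) :=
          mul_le_mul_of_nonneg_left (h₂ t ht0) (Real.exp_pos _).le
      _ = _ := by rw [← mul_assoc, ← Real.exp_add, mul_comm]; ring_nf

/-- The resolvent at distance `n` dominates the product of the passage functionals. -/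
theorem ofReal_exp_birkhoffSum_le (hκ : 0 < κ) (hh : h ∈ Ioc (0 : ℝ) 1)
    (hfin : ∀ n : ℕ, phi κ h β (shift^[n] ζ) ≠ ∞) (n : ℕ) :
    ENNReal.ofReal (Real.exp (birkhoffSum shift (psi κ h β) n ζ)) *
      (ENNReal.ofReal (κ - ζ 0 - β))⁻¹ ≤ laplaceTransform β (kernelENN κ h ζ 0 n) := by
  have h1 := prod_passage_mul_le (a := stepLeft h) (b := stepRight h) (c := visitWeight κ ζ β)
    (V := fun y => laplaceTransform β (kernelENN κ h ζ 0 y))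
    (fun y _ => by
      rw [laplaceTransform_kernelENN β 0 y]
      exact le_add_self) n
  refine le_trans (mul_le_mul' (le_of_eq ?_) ?_) h1
  · rw [← prod_toReal_passage hκ hh hfin, ENNReal.ofReal_prod_of_nonneg fun _ _ =>
      ENNReal.toReal_nonneg]
    refine Finset.prod_congr rfl fun j _ => ENNReal.ofReal_toReal ?_
    rw [← phi_shift_iterate]
    exact hfin j
  · rw [laplaceTransform_kernelENN β 0 0, if_pos rfl]
    exact le_self_add

theorem exp_birkhoffSum_le (hκ : 0 < κ) (hh : h ∈ Ioc (0 : ℝ) 1) (hζ : ∀ x, ζ x ≤ 0)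
    (hβ : 0 ≤ β) (hβκ : β < κ) {δ s₁ s₂ : ℝ} (hδ : 0 < δ) (hs₁ : 0 ≤ s₁) (hs : s₁ ≤ s₂)
    (hfin₀ : ∀ n : ℕ, phi κ h β (shift^[n] ζ) ≠ ∞)
    (hfin₁ : ∀ n : ℕ, phi κ h (β - δ) (shift^[n] ζ) ≠ ∞ ∧
      phi κ h (β - δ) (shiftEquiv.symm^[n] ζ) ≠ ∞)
    (hfin₂ : ∀ n : ℕ, phi κ h (β + δ) (shift^[n] ζ) ≠ ∞ ∧
      phi κ h (β + δ) (shiftEquiv.symm^[n] ζ) ≠ ∞) (n : ℕ) :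
    Real.exp (birkhoffSum shift (psi κ h β) n ζ) * (κ - ζ 0 - β)⁻¹ ≤
      Real.exp (birkhoffSum shift (psi κ h (β - δ)) n ζ) * (Real.exp (δ * s₁) / δ) +
        (s₂ - s₁) * (Real.exp (β * s₂) * kernelMass κ h ζ 0 s₁) +
        Real.exp (birkhoffSum shift (psi κ h (β + δ)) n ζ) * (Real.exp (-δ * s₂) / δ) := by
  have hpos : 0 < κ - ζ 0 - β := by linarith [hζ 0]
  have hd : 0 ≤ s₂ - s₁ := sub_nonneg.mpr hs
  have hm : 0 ≤ kernelMass κ h ζ 0 s₁ := (kernelMass_pos hκ hh hζ 0 hs₁).le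
  have h1 := ofReal_exp_birkhoffSum_le hκ hh hfin₀ n
  rw [← ENNReal.ofReal_inv_of_pos hpos, ← ENNReal.ofReal_mul (Real.exp_pos _).le] at h1
  refine (ENNReal.ofReal_le_ofReal_iff (by positivity)).mp (h1.trans ?_)
  refine laplaceTransform_kernelENN_le hκ hh hζ hβ hδ hs₁ hs (Real.exp_pos _).le
    (Real.exp_pos _).le (fun t ht => ?_) (fun t ht => ?_)
  · have := (isPassageSolution_passage hκ hh hfin₁).kernel_le hκ hh hζ ht n
    rwa [cocycle_natCast, prod_toReal_passage hκ hh fun n => (hfin₁ n).1] at this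
  · have := (isPassageSolution_passage hκ hh hfin₂).kernel_le hκ hh hζ ht n
    rwa [cocycle_natCast, prod_toReal_passage hκ hh fun n => (hfin₂ n).1] at this

/-- The choice `δ ε = 8 q` brings both tail exponents down to `n (ℓ - 3 q)`, below the exponent `n
(ℓ - q)` on the left, so the middle term must carry the inequality. By `hα` the resulting lower
bound on `M n` beats the target exponentially. The shift to `n - 1` leaves room for rounding a
continuous time up to a grid point. -/
theorem eventually_exp_le_of_exp_le {c K ℓ q δ ε m : ℝ} {B B₁ B₂ M : ℕ → ℝ} (hc : 0 < c)
    (hq : 0 < q) (hδ : 0 < δ) (hε : 0 < ε) (hℓ : 0 ≤ ℓ) (hq8 : δ * ε = 8 * q)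
    (hα : 0 < γ * (m - ε) - q - β * (m + ε)) (hM : ∀ n, 0 ≤ M n)
    (hB : ∀ n : ℕ, n * (ℓ - q) - K ≤ B n) (hB₁ : ∀ n : ℕ, B₁ n ≤ K + n * (ℓ - δ * m + 5 * q))
    (hB₂ : ∀ n : ℕ, B₂ n ≤ K + n * (ℓ + δ * m + 5 * q))
    (hle : ∀ n : ℕ, Real.exp (B n) * c ≤ Real.exp (B₁ n) * (Real.exp (δ * (n * (m - ε))) / δ) +
      (n * (m + ε) - n * (m - ε)) * (Real.exp (β * (n * (m + ε))) * M n) +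
        Real.exp (B₂ n) * (Real.exp (-δ * (n * (m + ε))) / δ)) :
    ∀ᶠ n : ℕ in atTop, Real.exp (-(γ * ((n - 1) * (m - ε)))) ≤ M n := by
  set α := γ * (m - ε) - q - β * (m + ε) with hαdef
  have hexp : ∀ a : ℝ, 0 < a →
      Tendsto (fun n : ℕ => a * n * Real.exp (-(a * n))) atTop (𝓝 0) := fun a ha => by
    have h1 := (Real.tendsto_pow_mul_exp_neg_atTop_nhds_zero 1).comp
      (tendsto_natCast_atTop_atTop.const_mul_atTop ha)
    refine h1.congr fun n => ?_
    simp
  have hlim : ∀ a b e : ℝ, 0 < a → 0 < e →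
      ∀ᶠ n : ℕ in atTop, b * (n * Real.exp (-(a * n))) < e := fun a b e ha he => by
    have h1 := (hexp a ha).const_mul (b / a)
    rw [mul_zero] at h1
    filter_upwards [h1.eventually_lt_const he] with n hn
    calc _ = b / a * (a * n * Real.exp (-(a * n))) := by field_simp
      _ < e := hn
  have hcK : 0 < c * Real.exp (-K) / 2 := by positivity
  filter_upwards [hlim (2 * q) (2 / δ * Real.exp K) _ (by positivity) hcK,
    hlim α (2 * ε * Real.exp (γ * (m - ε))) _ hα hcK, eventually_ge_atTop 1] with n h1 h2 hn
  have hn1 : (1 : ℝ) ≤ n := by exact_mod_cast hn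
  have hn0 : (0 : ℝ) < n := by linarith
  have key : c * Real.exp (-K) ≤ 2 / δ * Real.exp K * (n * Real.exp (-(2 * q * n))) +
      2 * ε * n * (Real.exp (n * (β * (m + ε) + q)) * M n) := by
    have e0 : 0 < Real.exp (n * (ℓ - q)) := Real.exp_pos _
    refine le_of_mul_le_mul_right ?_ e0
    have i0 : c * Real.exp (-K) * Real.exp (n * (ℓ - q)) ≤ Real.exp (B n) * c := by
      rw [mul_assoc, ← Real.exp_add, mul_comm]
      refine mul_le_mul_of_nonneg_right (Real.exp_le_exp.mpr ?_) hc.le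
      linarith [hB n]
    have tail : ∀ b : ℝ, b ≤ K + n * (ℓ - 3 * q) →
        Real.exp b / δ ≤ 1 / δ * Real.exp K * (n * Real.exp (-(2 * q * n))) *
          Real.exp (n * (ℓ - q)) := fun b hb => by
      calc Real.exp b / δ ≤ Real.exp (K + n * (ℓ - 3 * q)) / δ := by gcongr
        _ = 1 / δ * Real.exp K * (1 * Real.exp (-(2 * q * n))) * Real.exp (n * (ℓ - q)) := by
          rw [show K + n * (ℓ - 3 * q) = K + -(2 * q * n) + n * (ℓ - q) by ring, Real.exp_add,
            Real.exp_add]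
          ring
        _ ≤ _ := by gcongr
    have i1 : Real.exp (B₁ n) * (Real.exp (δ * (n * (m - ε))) / δ) ≤
        1 / δ * Real.exp K * (n * Real.exp (-(2 * q * n))) * Real.exp (n * (ℓ - q)) := by
      rw [← mul_div_assoc, ← Real.exp_add]
      refine tail _ ?_
      have : δ * (n * (m - ε)) = n * (δ * m - 8 * q) := by rw [← hq8]; ring
      linarith [hB₁ n]
    have i2 : Real.exp (B₂ n) * (Real.exp (-δ * (n * (m + ε))) / δ) ≤
        1 / δ * Real.exp K * (n * Real.exp (-(2 * q * n))) * Real.exp (n * (ℓ - q)) := by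
      rw [← mul_div_assoc, ← Real.exp_add]
      refine tail _ ?_
      have : -δ * (n * (m + ε)) = n * (-(δ * m) - 8 * q) := by rw [← hq8]; ring
      linarith [hB₂ n]
    have i3 : (n * (m + ε) - n * (m - ε)) * (Real.exp (β * (n * (m + ε))) * M n) ≤
        2 * ε * n * (Real.exp (n * (β * (m + ε) + q)) * M n) * Real.exp (n * (ℓ - q)) := by
      calc _ = 2 * ε * n * (Real.exp (β * (n * (m + ε))) * M n) := by ring
        _ ≤ 2 * ε * n * (Real.exp (n * (β * (m + ε) + q) + n * (ℓ - q)) * M n) := by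
          have := hM n
          -- Here `ℓ ≥ 0` enters: the factor `exp (n ℓ)` may be inserted for free.
          have : 0 ≤ n * ℓ := by positivity
          gcongr
          linarith
        _ = _ := by rw [Real.exp_add]; ring
    calc _ ≤ _ := i0.trans (hle n)
      _ ≤ _ := add_le_add (add_le_add i1 i3) i2
      _ = _ := by ring
  have h3 : 2 * ε * Real.exp (γ * (m - ε)) * (n * Real.exp (-(α * n))) ≤
      2 * ε * n * (Real.exp (n * (β * (m + ε) + q)) * M n) := by linarith
  have h4 : Real.exp (γ * (m - ε)) * Real.exp (-(α * n)) ≤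
      Real.exp (n * (β * (m + ε) + q)) * M n := by
    refine le_of_mul_le_mul_left ?_ (show 0 < 2 * ε * n by positivity)
    linarith
  refine le_of_mul_le_mul_left ?_ (Real.exp_pos (n * (β * (m + ε) + q)))
  refine le_trans (le_of_eq ?_) h4
  rw [← Real.exp_add, ← Real.exp_add, hαdef]
  ring_nf

variable {P : Measure (ℤ → ℝ)}

theorem IsAdmissible.ae_eventually_exp_le_kernelMass [IsProbabilityMeasure P]
    (hP : IsAdmissible P) (hκ : 0 < κ) (hh : h ∈ Ioc (0 : ℝ) 1) {βcr m : ℝ} (hcr : βcr ≤ κ)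
    (hfin : ∀ β < βcr, ∀ᵐ ζ ∂P, phi κ h β ζ ≠ ∞)
    (hint : ∀ β < βcr, Integrable (psi κ h β) P) (hβ : 0 ≤ β) (hβcr : β < βcr)
    (hell : 0 ≤ ell κ h P β) (hm : 0 < m) (hder : HasDerivAt (ell κ h P) m β) (hγ : β < γ) :
    ∀ᵐ ζ ∂P, ∀ᶠ t in atTop, Real.exp (-(γ * t)) ≤ kernelMass κ h ζ 0 t := by
  -- Chosen so that `γ (m - ε) - β (m + ε) - q ≥ m (γ - β) / 2` whenever `q ≤ ε`.
  set ε := m * (γ - β) / (2 * (1 + β + γ)) with hεdef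
  have hden : 0 < 1 + β + γ := by linarith
  have hε : 0 < ε := div_pos (mul_pos hm (by linarith)) (by linarith)
  have hεeq : ε * (1 + β + γ) = m * (γ - β) / 2 := by rw [hεdef]; field_simp
  have hεm : ε < m := by
    have : ε * (1 + β + γ) < m * (1 + β + γ) := by rw [hεeq]; nlinarith
    exact lt_of_mul_lt_mul_right this hden.le
  have hder' := (hasDerivAt_iff_isLittleO.mp hder).def (half_pos hε)
  obtain ⟨r, hr, hball⟩ := Metric.eventually_nhds_iff.mp hder'
  set δ := min (r / 2) (min 1 ((βcr - β) / 2)) with hδdef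
  have hδ : 0 < δ := lt_min (by linarith) (lt_min one_pos (by linarith))
  have hδr : δ < r := (min_le_left _ _).trans_lt (by linarith)
  have hδ1 : δ ≤ 1 := (min_le_right _ _).trans (min_le_left _ _)
  have hδcr : δ ≤ (βcr - β) / 2 := (min_le_right _ _).trans (min_le_right _ _)
  have hd₁ : β - δ < βcr := by linarith
  have hd₂ : β + δ < βcr := by linarith
  set ℓ := ell κ h P β with hℓ
  set q := δ * ε / 8 with hqdef
  have hq : 0 < q := by positivity
  -- The error in the first-order expansion is at most `δ ε / 2 = 4 q`.
  have he₁ : ell κ h P (β - δ) ≤ ℓ - δ * m + 4 * q := by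
    have h1 := hball (y := β - δ) (by rw [Real.dist_eq, sub_sub_cancel_left, abs_neg, abs_of_pos hδ]; exact hδr)
    rw [sub_sub_cancel_left, norm_neg, Real.norm_of_nonneg hδ.le, smul_eq_mul] at h1
    have h2 := (abs_le.mp h1).2
    rw [hqdef]; linarith
  have he₂ : ell κ h P (β + δ) ≤ ℓ + δ * m + 4 * q := by
    have h1 := hball (y := β + δ) (by rw [Real.dist_eq, add_sub_cancel_left, abs_of_pos hδ]; exact hδr)
    rw [add_sub_cancel_left, Real.norm_of_nonneg hδ.le, smul_eq_mul] at h1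
    have h2 := (abs_le.mp h1).2
    rw [hqdef]; linarith
  have hα : 0 < γ * (m - ε) - q - β * (m + ε) := by
    have h1 : q ≤ ε := by rw [hqdef]; nlinarith
    nlinarith [mul_pos hm (sub_pos.mpr hγ)]
  filter_upwards [hP.nonpos, ae_shift_iterate hP.ergodic (hfin β hβcr),
    ae_shift_iterate hP.ergodic (hfin _ hd₁), ae_shift_iterate hP.ergodic (hfin _ hd₂),
    ae_le_birkhoffSum hP.ergodic measurable_psi (hint β hβcr) (sub_lt_self ℓ hq),
    ae_birkhoffSum_le hP.ergodic measurable_psi (hint _ hd₁)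
      (show _ < ℓ - δ * m + 5 * q from he₁.trans_lt (by linarith)),
    ae_birkhoffSum_le hP.ergodic measurable_psi (hint _ hd₂)
      (show _ < ℓ + δ * m + 5 * q from he₂.trans_lt (by linarith))] with
    ζ hζ hf₀ hf₁ hf₂ ⟨K₀, hK₀⟩ ⟨K₁, hK₁⟩ ⟨K₂, hK₂⟩
  set K := max K₀ (max K₁ K₂) with hKdef
  have hK0 : K₀ ≤ K := le_max_left _ _
  have hK1 : K₁ ≤ K := (le_max_left _ _).trans (le_max_right _ _)
  have hK2 : K₂ ≤ K := (le_max_right _ _).trans (le_max_right _ _)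
  have hβκ : β < κ := hβcr.trans_le hcr
  have hmε : 0 < m - ε := by linarith
  have hev := eventually_exp_le_of_exp_le (c := (κ - ζ 0 - β)⁻¹) (K := K) (γ := γ) (β := β)
    (M := fun n => kernelMass κ h ζ 0 (n * (m - ε)))
    (inv_pos.mpr (by linarith [hζ 0])) hq hδ hε hell (by rw [hqdef]; ring) hα
    (fun n => (kernelMass_pos hκ hh hζ 0 (by positivity)).le)
    (fun n => by linarith [hK₀ n]) (fun n => by linarith [hK₁ n]) (fun n => by linarith [hK₂ n])
    (fun n => exp_birkhoffSum_le hκ hh hζ hβ hβκ hδ (by positivity)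
      (by gcongr; linarith) (fun n => (hf₀ n).1) hf₁ hf₂ n)
  have hceil : Tendsto (fun t : ℝ => ⌈t / (m - ε)⌉₊) atTop atTop :=
    tendsto_nat_ceil_atTop.comp (tendsto_id.atTop_div_const hmε)
  filter_upwards [hceil.eventually hev, eventually_ge_atTop 0] with t ht ht0
  have h1 : t ≤ ⌈t / (m - ε)⌉₊ * (m - ε) := (div_le_iff₀ hmε).mp (Nat.le_ceil _)
  have h2 : (⌈t / (m - ε)⌉₊ - 1) * (m - ε) ≤ t := by
    rw [← le_div_iff₀ hmε]
    linarith [Nat.ceil_lt_add_one (div_nonneg ht0 hmε.le)]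
  refine le_trans (Real.exp_le_exp.mpr ?_) (ht.trans (kernelMass_antitone hκ hh hζ 0 ht0 h1))
  exact neg_le_neg (mul_le_mul_of_nonneg_left h2 (by linarith))

end Derivative

end PAM

namespace PAM

/-! ### The growth rate -/

section Growth

theorem tendsto_log_div {f : ℝ → ℝ} {β : ℝ} {b γ : ℕ → ℝ} (hf : ∀ t, 0 ≤ t → 0 < f t)
    (hb : Tendsto b atTop (𝓝 β)) (hγ : Tendsto γ atTop (𝓝 β))
    (hup : ∀ k, ∃ C : ℝ, ∀ t, 0 ≤ t → f t ≤ C * Real.exp (-(b k * t)))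
    (hlo : ∀ k, ∃ c : ℝ, 0 < c ∧ ∀ᶠ t in atTop, c * Real.exp (-(γ k * t)) ≤ f t) :
    Tendsto (fun t : ℝ => 1 / t * Real.log (f t)) atTop (𝓝 (-β)) := by
  have hlim : ∀ c a : ℝ, Tendsto (fun t : ℝ => 1 / t * c - a) atTop (𝓝 (-a)) := fun c a => by
    have h1 : Tendsto (fun t : ℝ => 1 / t) atTop (𝓝 0) := by
      simpa using tendsto_inv_atTop_zero (𝕜 := ℝ)
    simpa using (h1.mul_const c).sub_const a
  refine tendsto_order.mpr ⟨fun a ha => ?_, fun a ha => ?_⟩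
  · obtain ⟨k, hk⟩ := (hγ.eventually_lt_const (show β < -a by linarith)).exists
    obtain ⟨c, hc, hle⟩ := hlo k
    filter_upwards [hle, (hlim (Real.log c) (γ k)).eventually_const_lt
      (show a < -γ k by linarith), eventually_gt_atTop 0] with t h1 h2 ht
    have h3 := Real.log_le_log (mul_pos hc (Real.exp_pos _)) h1
    rw [Real.log_mul hc.ne' (Real.exp_pos _).ne', Real.log_exp] at h3
    calc a < 1 / t * Real.log c - γ k := h2
      _ = 1 / t * (Real.log c + -(γ k * t)) := by field_simp; ring
      _ ≤ _ := by gcongr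
  · obtain ⟨k, hk⟩ := (hb.eventually_const_lt (show -a < β by linarith)).exists
    obtain ⟨C, hC⟩ := hup k
    have hC0 : 0 < C := pos_of_mul_pos_left ((hf 0 le_rfl).trans_le (hC 0 le_rfl))
      (Real.exp_pos _).le
    filter_upwards [(hlim (Real.log C) (b k)).eventually_lt_const
      (show -b k < a by linarith), eventually_gt_atTop 0] with t h2 ht
    have h3 := Real.log_le_log (hf t ht.le) (hC t ht.le)
    rw [Real.log_mul hC0.ne' (Real.exp_pos _).ne', Real.log_exp] at h3
    calc 1 / t * Real.log (f t) ≤ 1 / t * (Real.log C + -(b k * t)) := by gcongr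
      _ = 1 / t * Real.log C - b k := by field_simp; ring
      _ < a := h2

variable {κ h : ℝ} {P : Measure (ℤ → ℝ)}

/-- Countably many rates converging to `β` suffice, so the exceptional null sets can be united.
Nonpositive rates in the upper bound are covered by mass at most `1`. -/
theorem ae_tendsto_log_kernelMass (hκ : 0 < κ) (hh : h ∈ Ioc (0 : ℝ) 1)
    (hnp : ∀ᵐ ζ ∂P, ∀ x, ζ x ≤ 0) {β : ℝ}
    (hup : ∀ b < β, 0 < b →
      ∀ᵐ ζ ∂P, ∃ C : ℝ, ∀ t, 0 ≤ t → kernelMass κ h ζ 0 t ≤ C * Real.exp (-(b * t)))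
    (hlo : ∀ γ, β < γ → ∀ᵐ ζ ∂P, ∃ c : ℝ, 0 < c ∧
      ∀ᶠ t in atTop, c * Real.exp (-(γ * t)) ≤ kernelMass κ h ζ 0 t) :
    ∀ᵐ ζ ∂P, Tendsto (fun t : ℝ => 1 / t * Real.log (kernelMass κ h ζ 0 t)) atTop (𝓝 (-β)) := by
  have hup' : ∀ b < β,
      ∀ᵐ ζ ∂P, ∃ C : ℝ, ∀ t, 0 ≤ t → kernelMass κ h ζ 0 t ≤ C * Real.exp (-(b * t)) := by
    intro b hb
    rcases le_or_gt b 0 with h0 | h0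
    · filter_upwards [hnp] with ζ hζ
      refine ⟨1, fun t ht => (kernelMass_le_one hκ hh hζ 0 t).trans ?_⟩
      rw [one_mul]
      exact Real.one_le_exp (by nlinarith)
    · exact hup b hb h0
  obtain ⟨b, -, hb, hbl⟩ := exists_seq_strictMono_tendsto β
  obtain ⟨γ, -, hγ, hγl⟩ := exists_seq_strictAnti_tendsto β
  filter_upwards [hnp, ae_all_iff.mpr fun k => hup' (b k) (hb k),
    ae_all_iff.mpr fun k => hlo (γ k) (hγ k)] with ζ hζ h1 h2
  exact tendsto_log_div (fun t ht => kernelMass_pos hκ hh hζ 0 ht) hbl hγl h1 h2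

/-- Monotone functions are differentiable almost everywhere, which avoids differentiating under the
expectation; the lower slope bound makes the derivative positive. -/
theorem IsAdmissible.exists_hasDerivAt_ell [IsProbabilityMeasure P] (hP : IsAdmissible P)
    (hκ : 0 < κ) (hh : h ∈ Ioc (0 : ℝ) 1) {βcr : ℝ}
    (hbd : ∀ β < βcr, ∃ C : ℝ≥0∞, C ≠ ∞ ∧ ∀ᵐ ζ ∂P, phi κ h β ζ ≤ C)
    (hint : ∀ β < βcr, Integrable (psi κ h β) P) {a b : ℝ} (ha : 0 ≤ a) (hab : a < b)
    (hb : b ≤ βcr) : ∃ β ∈ Ioo a b, ∃ m, 0 < m ∧ HasDerivAt (ell κ h P) m β := by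
  have hI := (hP.integrable_inv hκ).2
  set I := ∫ ζ : ℤ → ℝ, 1 / (κ - ζ 1) ∂P
  have hinc : ∀ x ∈ Ioo a b, ∀ y ∈ Ioo a b, x ≤ y →
      (y - x) * I ≤ ell κ h P y - ell κ h P x := fun x hx y hy hxy =>
    hP.le_ell_sub_ell hκ hh hbd hint (ha.trans hx.1.le) hxy (hy.2.trans_le hb)
  have hmono : MonotoneOn (ell κ h P) (Ioo a b) := fun x hx y hy hxy => by
    have := hinc x hx y hy hxy
    have : 0 ≤ (y - x) * I := mul_nonneg (sub_nonneg.mpr hxy) hI.le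
    linarith
  have hae := hmono.ae_differentiableWithinAt measurableSet_Ioo
  have : NeBot (ae (volume.restrict (Ioo a b))) := by
    rw [ae_neBot, ne_eq, Measure.restrict_eq_zero, Real.volume_Ioo]
    simpa using hab
  obtain ⟨β, hd, hβ⟩ := (hae.and (ae_restrict_mem measurableSet_Ioo)).exists
  have hnhds := Ioo_mem_nhds hβ.1 hβ.2
  have hder := (hd.differentiableAt hnhds).hasDerivAt
  refine ⟨β, hβ, _, lt_of_lt_of_le hI ?_, hder⟩
  have hsl := (hasDerivAt_iff_tendsto_slope.mp hder).mono_left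
    (nhdsWithin_mono β fun y (hy : β < y) => hy.ne' : 𝓝[>] β ≤ 𝓝[≠] β)
  refine ge_of_tendsto hsl ?_
  filter_upwards [self_mem_nhdsWithin, mem_nhdsWithin_of_mem_nhds hnhds] with y hy hyab
  have hy' : 0 < y - β := sub_pos.mpr hy
  rw [slope_def_field, le_div_iff₀ hy', mul_comm]
  exact hinc β hβ y hyab (le_of_lt hy)

theorem IsAdmissible.exists_growth_rate [IsProbabilityMeasure P] (hP : IsAdmissible P)
    (hκ : 0 < κ) (hh : h ∈ Ioc (0 : ℝ) 1) :
    ∃ βcr : ℝ, IsCriticalValue κ h P βcr ∧ ∃ lam : ℝ,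
      (∀ᵐ ζ ∂P,
        Tendsto (fun t : ℝ => 1 / t * Real.log (kernelMass κ h ζ 0 t)) atTop (𝓝 lam)) ∧
      (∀ β ∈ Ioo (-βcr) 0, L κ h P (-β) = 0 → lam = β) ∧
      ((¬ ∃ β ∈ Ioo (-βcr) 0, L κ h P (-β) = 0) → lam = -βcr) := by
  obtain ⟨βcr, h0, hcr, hbd, hinf⟩ := hP.exists_threshold hκ hh
  refine ⟨βcr, isCriticalValue_of_threshold hκ hh hbd hinf, ?_⟩
  have hL : ∀ β ∈ Ioo (-βcr) 0, L κ h P (-β) = 0 ↔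
      Integrable (psi κ h (-β)) P ∧ ell κ h P (-β) = 0 := fun β hβ =>
    L_eq_zero_iff hκ hh (hbd _ (by linarith [hβ.1]))
  have hfin : ∀ β < βcr, ∀ᵐ ζ ∂P, phi κ h β ζ ≠ ∞ := fun β hβ => ae_phi_ne_top hbd hβ
  have hupper : ∀ b < βcr, (Integrable (psi κ h b) P → ell κ h P b < 0) →
      ∀ᵐ ζ ∂P, ∃ C : ℝ, ∀ t, 0 ≤ t → kernelMass κ h ζ 0 t ≤ C * Real.exp (-(b * t)) := by
    intro b hb hneg
    obtain ⟨g, hgm, hgi, hg, hgneg⟩ := exists_integrable_ge_psi (hbd b hb) hneg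
    exact hP.ae_exists_kernelMass_le hκ hh (hfin b hb) hgm hgi hg hgneg
  by_cases hz : ∃ β ∈ Ioo (-βcr) 0, L κ h P (-β) = 0
  · obtain ⟨β, hβ, hLβ⟩ := hz
    obtain ⟨hiβ, heβ⟩ := (hL β hβ).mp hLβ
    have hβcr : -β < βcr := by linarith [hβ.1]
    have hint : ∀ b < βcr, Integrable (psi κ h b) P := fun b hb =>
      hP.integrable_psi hκ hh hcr hbd hβcr hb hiβ
    have hI := (hP.integrable_inv hκ).2
    have hlt : ∀ b b', 0 ≤ b → b < b' → b' < βcr → ell κ h P b < ell κ h P b' :=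
      fun b b' hb hbb' hb' => by
        have h1 := hP.le_ell_sub_ell hκ hh hbd hint hb hbb'.le hb'
        have h2 := mul_pos (sub_pos.mpr hbb') hI
        linarith
    refine ⟨β, ?_, fun β' hβ' hLβ' => ?_, fun hno => absurd ⟨β, hβ, hLβ⟩ hno⟩
    · have := ae_tendsto_log_kernelMass hκ hh hP.nonpos (β := -β)
        (fun b hb hb0 => hupper b (hb.trans hβcr) fun _ => heβ ▸ hlt b (-β) hb0.le hb hβcr)
        (fun γ hγ => ?_)
      · simpa using this
      -- The lower bound need not be proved at the zero itself: a differentiability point just above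
      -- it, where `ell > 0`, is enough.
      · obtain ⟨b, hb, m, hm, hder⟩ := hP.exists_hasDerivAt_ell hκ hh hbd hint
          (a := -β) (b := min γ βcr) (by linarith [hβ.2]) (lt_min hγ hβcr) (min_le_right _ _)
        have hbcr : b < βcr := hb.2.trans_le (min_le_right _ _)
        have hb0 : 0 ≤ b := by linarith [hb.1, hβ.2]
        filter_upwards [hP.ae_eventually_exp_le_kernelMass hκ hh hcr hfin hint hb0 hbcr
          (heβ ▸ (hlt (-β) b (by linarith [hβ.2]) hb.1 hbcr).le) hm hder
          (hb.2.trans_le (min_le_left _ _))] with ζ hζ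
        exact ⟨1, one_pos, by simpa using hζ⟩
    · obtain ⟨-, heβ'⟩ := (hL β' hβ').mp hLβ'
      rcases lt_trichotomy β β' with hlt' | heq | hlt'
      · have := hlt (-β') (-β) (by linarith [hβ'.2]) (by linarith) hβcr
        linarith
      · exact heq
      · have := hlt (-β) (-β') (by linarith [hβ.2]) (by linarith) (by linarith [hβ'.1])
        linarith
  · refine ⟨-βcr, ae_tendsto_log_kernelMass hκ hh hP.nonpos (fun b hb hb0 => ?_) fun γ hγ => ?_,
      fun β hβ hLβ => absurd ⟨β, hβ, hLβ⟩ hz, fun _ => rfl⟩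
    -- If `ell b ≥ 0` for some `b` in `(0, βcr)`, then continuity and `ell 0 < 0` would produce a
    -- zero, which is excluded.
    · refine hupper b hb fun hib => ?_
      by_contra! hcon
      have hint : ∀ b < βcr, Integrable (psi κ h b) P := fun b' hb' =>
        hP.integrable_psi hκ hh hcr hbd hb hb' hib
      have hneg := hP.ell_zero_neg hκ hh (hint 0 (hb0.trans hb))
      obtain ⟨c, hc, hc0⟩ := intermediate_value_Icc hb0.le
        (hP.continuousOn_ell hκ hh hcr hbd hint hb0.le hb) (mem_Icc.mpr ⟨hneg.le, hcon⟩)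
      have hcpos : 0 < c := by
        rcases hc.1.eq_or_lt with rfl | hlt
        · linarith
        · exact hlt
      have hcβ : -c ∈ Ioo (-βcr) 0 := ⟨by linarith [hc.2], by linarith⟩
      refine hz ⟨-c, hcβ, (hL _ hcβ).mpr ?_⟩
      rw [neg_neg]
      exact ⟨hint c (hc.2.trans_lt hb), hc0⟩
    · obtain ⟨b, hb1, hb2⟩ := exists_between hγ
      filter_upwards [hP.ae_exists_exp_le_kernelMass hκ hh (hinf b hb1) (h0.trans hγ.le) hb2] with
        ζ ⟨c, hc, hle⟩
      exact ⟨c, hc, (eventually_ge_atTop 1).mono fun t ht => hle t ht⟩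

end Growth

/-! ### The standing assumptions -/

theorem isAdmissible_map {Ω : Type*} [MeasurableSpace Ω] {μ : Measure Ω} {ξ : Ω → ℤ → ℝ}
    (hξ : Measurable ξ) (hnonconst : ¬ ∃ c : ℝ, ∀ᵐ ω ∂μ, ∀ x, ξ ω x = c)
    (hsup : essSup (fun ω => (ξ ω 0 : EReal)) μ = 0)
    (hlaw : IsErgodicBounded (μ.map ξ) ∨ IsIIDNonpos (μ.map ξ)) : IsAdmissible (μ.map ξ) := by
  have herg : Ergodic shift (μ.map ξ) := by
    rcases hlaw with hE | ⟨η, hη, -, hP⟩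
    · exact hE.1
    · rw [hP]; exact ergodic_shift_infinitePi η
  have hnp : ∀ᵐ ζ ∂μ.map ξ, ∀ x, ζ x ≤ 0 := by
    rcases hlaw with ⟨-, b, -, hb⟩ | ⟨η, hη, hη0, hP⟩
    · filter_upwards [hb] with ζ hζ x using (hζ x).2
    · rw [hP, ae_all_iff]
      exact fun x => (measurePreserving_eval_infinitePi (fun _ : ℤ => η)
        x).quasiMeasurePreserving.ae hη0
  refine ⟨herg, hnp, fun ε hε hzero => ?_, fun hzero => hnonconst ⟨0, ?_⟩, ?_⟩
  · have hs : MeasurableSet {ζ : ℤ → ℝ | -ε < ζ 0} :=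
      measurableSet_lt measurable_const (measurable_pi_apply 0)
    have h1 : shift ⁻¹' {ζ : ℤ → ℝ | -ε < ζ 0} = {ζ | -ε < ζ 1} := by
      ext ζ; simp [shift]
    have h2 := herg.toMeasurePreserving.measure_preimage hs.nullMeasurableSet
    rw [h1, hzero, Measure.map_apply hξ hs] at h2
    have h3 : ∀ᵐ ω ∂μ, (ξ ω 0 : EReal) ≤ ((-ε : ℝ) : EReal) := by
      rw [ae_iff, h2]
      congr 1
      ext ω
      simp [← EReal.coe_neg]
    have h4 := essSup_le_of_ae_le _ h3
    rw [hsup] at h4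
    have : (0 : ℝ) ≤ -ε := by exact_mod_cast h4
    linarith
  -- If `ζ 1 < 0` had probability zero, invariance under both shifts would make the field
  -- identically `0`, hence constant.
  · have h1 : ∀ᵐ ζ ∂μ.map ξ, 0 ≤ ζ 1 := by
      rw [ae_iff]
      simpa using hzero
    have h2 : ∀ᵐ ζ ∂μ.map ξ, ∀ x, ζ x = 0 := by
      filter_upwards [ae_shift_iterate herg h1, hnp] with ζ h2 h3 x
      refine le_antisymm (h3 x) ?_
      rcases le_or_gt 1 x with hx | hx
      · have := (h2 (x - 1).toNat).1
        rw [shift_iterate] at this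
        rwa [show (1 : ℤ) + ((x - 1).toNat : ℕ) = x by omega] at this
      · have := (h2 (1 - x).toNat).2
        rw [shiftEquiv_symm_iterate] at this
        rwa [show (1 : ℤ) - ((1 - x).toNat : ℕ) = x by omega] at this
    exact ae_of_ae_map hξ.aemeasurable h2
  · rcases hlaw with ⟨-, b, hb0, hb⟩ | hI
    · exact Or.inl ⟨b, hb0, by filter_upwards [hb] with ζ hζ x using (hζ x).1⟩
    · exact Or.inr hI

end PAM

theorem mainTheorem1 {Ω : Type*} [MeasurableSpace Ω] (μ : Measure Ω) [IsProbabilityMeasure μ]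
    (κ h : ℝ) (hκ : 0 < κ) (hh : h ∈ Ioc (0 : ℝ) 1)
    (ξ : Ω → ℤ → ℝ) (hξ : Measurable ξ)
    (hnonconst : ¬ ∃ c : ℝ, ∀ᵐ ω ∂μ, ∀ x, ξ ω x = c)
    (hsup : essSup (fun ω => (ξ ω 0 : EReal)) μ = 0)
    (hlaw : PAM.IsErgodicBounded (μ.map ξ) ∨ PAM.IsIIDNonpos (μ.map ξ)) :
    ∃ βcr : ℝ, PAM.IsCriticalValue κ h (μ.map ξ) βcr ∧
      ∃ lam : ℝ,
        (∀ᵐ ω ∂μ,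
          (∃ u, PAM.IsSolution κ h (ξ ω) u) ∧
          ∀ u, PAM.IsSolution κ h (ξ ω) u →
            (∀ t, 0 ≤ t → 0 < u t 0) ∧
            Tendsto (fun t : ℝ => 1 / t * Real.log (u t 0)) atTop (𝓝 lam)) ∧
        (∀ β ∈ Ioo (-βcr) 0, PAM.L κ h (μ.map ξ) (-β) = 0 → lam = β) ∧
        ((¬ ∃ β ∈ Ioo (-βcr) 0, PAM.L κ h (μ.map ξ) (-β) = 0) → lam = -βcr) := by
  have : IsProbabilityMeasure (μ.map ξ) := Measure.isProbabilityMeasure_map hξ.aemeasurable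
  have hP := PAM.isAdmissible_map hξ hnonconst hsup hlaw
  obtain ⟨βcr, hβcr, lam, hlim, h1, h2⟩ := hP.exists_growth_rate hκ hh
  refine ⟨βcr, hβcr, lam, ?_, h1, h2⟩
  have hh' : h ∈ Icc (-1 : ℝ) 1 := ⟨by linarith [hh.1], hh.2⟩
  filter_upwards [ae_of_ae_map hξ.aemeasurable hlim, ae_of_ae_map hξ.aemeasurable hP.nonpos] with
    ω hω hζ
  have hflow := PAM.isHeatFlow_kernelMass hκ hh hζ
  refine ⟨⟨_, PAM.isSolution_iff_isHeatFlow.mpr hflow⟩, fun u hu => ?_⟩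
  -- Uniqueness of bounded solutions identifies every `u` with the total mass of the kernel.
  have heq : ∀ t, 0 ≤ t → u t 0 = PAM.kernelMass κ h (ξ ω) 0 t := fun t ht =>
    (PAM.isSolution_iff_isHeatFlow.mp hu).unique hκ.le hh' hζ hflow ht 0
  refine ⟨fun t ht => heq t ht ▸ PAM.kernelMass_pos hκ hh hζ 0 ht, hω.congr' ?_⟩
  filter_upwards [eventually_ge_atTop 0] with t ht
  rw [heq t ht]
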